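/- Lemma 3.4. Let $T>0$ and $0<\underline\sigma\le\overline\sigma$. Let $\Omega_T=C_0([0,T];\mathbb R)$ be the space of continuous paths started at $0$, with the supremum norm and its Borel $\sigma$-algebra, and let $B$ be the canonical process. Let $\mathcal P$ be the set of probability measures $P$ on $\Omega_T$ under which $B$ is a martingale with $\underline\sigma^2\,dt\le d\langle B\rangle_t\le\overline\sigma^2\,dt$. Let $\hat{\mathbb E}[\xi]=\sup_{P\in\mathcal P}E_P[\xi]$ be the (one-dimensional, non-degenerate) $G$-expectation, $G(a)=\frac12(\overline\sigma^2a^+-\underline\sigma^2a^-)$. A property holds quasi-surely (q.s.) if it holds outside a Borel set $A$ with $\sup_{P\in\mathcal P}P(A)=0$; random variables are identified if they agree q.s. Let $L_{ip}(\Omega_T)$ be the set of all $\varphi(B_{t_1},\dots,B_{t_n})$ with $t_i\in[0,T]$ and $\varphi$ bounded and Lipschitz. For $p\ge1$ let $L_G^p(\Omega_T)$ be its completion under $\hat{\mathbb E}[|\xi|^p]^{1/p}$. For $\xi\in L_{ip}(\Omega_T)$ let $\hat{\mathbb E}_t[\xi](\omega)=\hat{\mathbb E}[\xi(\omega\otimes_t\cdot)]$,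 where $\omega\otimes_t\omega'$ follows $\omega$ on $[0,t]$ and has the increments of $\omega'$ on $[t,T]$; extend $\hat{\mathbb E}_t$ continuously to $L_G^1(\Omega_T)$. A $G$-martingale is a process $(M_t)_{t\in[0,T]}$ with $M_t\in L_G^1(\Omega_T)$ and $\hat{\mathbb E}_s[M_t]=M_s$ q.s. for all $s\le t$; it is called decreasing if q.s. its paths are non-increasing. Let $S_G^p(0,T)$ be the completion of the set of processes $h(t,B_{t_1\wedge t},\dots,B_{t_n\wedge t})$, $h$ bounded and Lipschitz, under $\hat{\mathbb E}[\sup_{t\in[0,T]}|\eta_t|^p]^{1/p}$. Let $X\in S_G^\alpha(0,T)$ for some $\alpha>1$ and let $\alpha^*=\frac{\alpha}{\alpha-1}$. Let $K^1,K^2$ be decreasing $G$-martingales with $K^j_0=0$ q.s. and $K^j_T\in L_G^{\alpha^*}(\Omega_T)$, $j=1,2$. Then q.s. the pathwise Stieltjes integrals $\int_0^tX_s^+\,dK_s^1$ and $\int_0^tX_s^-\,dK_s^2$ exist for all $t\in[0,T]$, and the process $$\int_0^tX_s^+\,dK_s^1+\int_0^tX_s^-\,dK_s^2,\qquad t\in[0,T],$$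 is a decreasing $G$-martingale. -/

import Mathlib

open MeasureTheory ProbabilityTheory Filter Topology
open scoped NNReal ENNReal

namespace GExpectation

/-- The time interval `[0, T]`. -/
abbrev Time (T : ℝ) : Type := Set.Icc (0 : ℝ) T

/-- The path space `Ω_T = C_0([0, T]; ℝ)`: real continuous functions on `[0, T]` that vanish at
time `0`, with the supremum norm. -/
abbrev PathSpace (T : ℝ) : Type := {ω : C(Time T, ℝ) // ∀ t : Time T, (t : ℝ) = 0 → ω t = 0}

/-- `Ω_T` carries its Borel σ-algebra. -/
instance instMeasurableSpacePathSpace (T : ℝ) : MeasurableSpace (PathSpace T) := borel _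

instance instBorelSpacePathSpace (T : ℝ) : BorelSpace (PathSpace T) := ⟨rfl⟩

/-- The canonical process `B_t(ω) = ω_t`. -/
def B {T : ℝ} (t : Time T) (ω : PathSpace T) : ℝ := ω.1 t

theorem continuous_B {T : ℝ} (t : Time T) : Continuous (B t : PathSpace T → ℝ) :=
  (ContinuousEvalConst.continuous_eval_const t).comp continuous_subtype_val

/-- The canonical filtration `ℬ(Ω_t) = σ(B_s, s ≤ t)`. -/
noncomputable def canonicalFiltration (T : ℝ) :
    Filtration (Time T) (instMeasurableSpacePathSpace T) :=
  Filtration.natural (fun t : Time T => (B t : PathSpace T → ℝ))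
    (fun t => (continuous_B t).stronglyMeasurable)

/-- The set `𝒫` of martingale laws with volatility in `[σl, σu]`: the probability measures on `Ω_T`
under which `B` is a martingale whose quadratic variation satisfies
`σl² dt ≤ d⟨B⟩_t ≤ σu² dt`. The two bounds on `⟨B⟩` are stated in martingale-problem form:
`B_t² - σl² t` is a submartingale and `B_t² - σu² t` is a supermartingale. -/
def martingaleLaws (T σl σu : ℝ) : Set (Measure (PathSpace T)) :=
  {P | IsProbabilityMeasure P ∧
    Martingale (fun t : Time T => (B t : PathSpace T → ℝ)) (canonicalFiltration T) P ∧
    Submartingale (fun (t : Time T) (ω : PathSpace T) => (B t ω) ^ 2 - σl ^ 2 * (t : ℝ))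
      (canonicalFiltration T) P ∧
    Supermartingale (fun (t : Time T) (ω : PathSpace T) => (B t ω) ^ 2 - σu ^ 2 * (t : ℝ))
      (canonicalFiltration T) P}

/-- The `G`-expectation `Ê[ξ] = sup_{P ∈ 𝒫} E_P[ξ]` with
`G(a) = (σu² a⁺ - σl² a⁻) / 2`, for bounded Borel `ξ`. -/
noncomputable def gExp (T σl σu : ℝ) (ξ : PathSpace T → ℝ) : ℝ :=
  ⨆ P : martingaleLaws T σl σu, ∫ ω, ξ ω ∂(P : Measure (PathSpace T))

/-- The `G`-expectation of `[0, ∞]`-valued functions, `Ê[f] = sup_{P ∈ 𝒫} E_P[f]` when `f` is Borel.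
A function that is not Borel is replaced by its Borel majorants (outer expectation). -/
noncomputable def gExpNonneg (T σl σu : ℝ) (f : PathSpace T → ℝ≥0∞) : ℝ≥0∞ :=
  ⨅ (g : PathSpace T → ℝ≥0∞) (_ : Measurable g) (_ : ∀ ω, f ω ≤ g ω),
    ⨆ P ∈ martingaleLaws T σl σu, ∫⁻ ω, g ω ∂P

/-- The capacity `c(A) = sup_{P ∈ 𝒫} P(A)`. -/
noncomputable def capacity (T σl σu : ℝ) (A : Set (PathSpace T)) : ℝ≥0∞ :=
  ⨆ P ∈ martingaleLaws T σl σu, P A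

/-- A property holds quasi-surely if it holds outside a polar Borel set. -/
def QuasiSurely (T σl σu : ℝ) (p : PathSpace T → Prop) : Prop :=
  ∃ A : Set (PathSpace T), MeasurableSet A ∧ capacity T σl σu A = 0 ∧ ∀ ω ∉ A, p ω

/-- `L_ip(Ω_T)`: the random variables `φ(B_{t₁}, …, B_{tₙ})` with `φ` bounded and Lipschitz. -/
def Lip (T : ℝ) : Set (PathSpace T → ℝ) :=
  {ξ | ∃ (n : ℕ) (t : Fin n → Time T) (φ : (Fin n → ℝ) → ℝ),
    (∃ C : ℝ, ∀ x, |φ x| ≤ C) ∧ (∃ L : ℝ≥0, LipschitzWith L φ) ∧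
    ∀ ω, ξ ω = φ (fun i => B (t i) ω)}

/-- `ξₙ → ξ` in the norm `‖ξ‖_{p,G} = Ê[|ξ|^p]^{1/p}`. -/
def TendstoLG (T σl σu p : ℝ) (ξ' : ℕ → PathSpace T → ℝ) (ξ : PathSpace T → ℝ) : Prop :=
  Tendsto (fun n => gExpNonneg T σl σu (fun ω => ENNReal.ofReal (|ξ' n ω - ξ ω| ^ p)))
    atTop (𝓝 0)

/-- `L_G^p(Ω_T)`: the completion of `L_ip(Ω_T)` under `‖·‖_{p,G}`, realized by functions on `Ω_T`
(which are determined quasi-surely). -/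
def LG (T σl σu p : ℝ) : Set (PathSpace T → ℝ) :=
  {ξ | ∃ ξ' : ℕ → PathSpace T → ℝ, (∀ n, ξ' n ∈ Lip T) ∧ TendstoLG T σl σu p ξ' ξ}

/-- The path that follows `ω` up to time `t` and then has the increments of `ω'`:
`s ↦ ω_s` for `s ≤ t` and `s ↦ ω_t + ω'_s - ω'_t` for `s ≥ t`. -/
def concat {T : ℝ} (t : Time T) (ω ω' : PathSpace T) : PathSpace T :=
  ⟨⟨fun s => ω.1 (min s t) + (ω'.1 (max s t) - ω'.1 t), by fun_prop⟩, by
    intro s hs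
    have hst : s ≤ t := by
      change (s : ℝ) ≤ (t : ℝ)
      rw [hs]; exact t.2.1
    change ω.1 (min s t) + (ω'.1 (max s t) - ω'.1 t) = 0
    rw [min_eq_left hst, max_eq_right hst, ω.2 s hs]
    simp⟩

/-- The conditional `G`-expectation on `L_ip(Ω_T)`. If
`ξ = φ(B_{t₁} - B_{t₀}, …, B_{tₘ} - B_{tₘ₋₁})` with `t = tᵢ`, this is
`Ê_t[ξ] = φ̃(B_{t₁} - B_{t₀}, …, B_{tᵢ} - B_{tᵢ₋₁})`, where
`φ̃(x₁, …, xᵢ) = Ê[φ(x₁, …, xᵢ, B_{tᵢ₊₁} - B_{tᵢ}, …, B_{tₘ} - B_{tₘ₋₁})]`: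
the increments up to time `t` are frozen at those of `ω`. -/
noncomputable def condGExpLip (T σl σu : ℝ) (t : Time T) (ξ : PathSpace T → ℝ) :
    PathSpace T → ℝ :=
  fun ω => gExp T σl σu (fun ω' => ξ (concat t ω ω'))

/-- `ζ = Ê_t[ξ]` quasi-surely, for `ξ ∈ L_G^1(Ω_T)`: the continuous extension of `Ê_t` from
`L_ip(Ω_T)` to its completion `L_G^1(Ω_T)` under `‖·‖_{1,G}`. -/
def IsCondGExp (T σl σu : ℝ) (t : Time T) (ξ ζ : PathSpace T → ℝ) : Prop :=
  ∃ ξ' : ℕ → PathSpace T → ℝ, (∀ n, ξ' n ∈ Lip T) ∧ TendstoLG T σl σu 1 ξ' ξ ∧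
    TendstoLG T σl σu 1 (fun n => condGExpLip T σl σu t (ξ' n)) ζ

/-- `G`-martingales: processes with values in `L_G^1(Ω_T)` and `Ê_s[M_t] = M_s` for `s ≤ t`. -/
def IsGMartingale (T σl σu : ℝ) (M : Time T → PathSpace T → ℝ) : Prop :=
  (∀ t, M t ∈ LG T σl σu 1) ∧ ∀ s t, s ≤ t → IsCondGExp T σl σu s (M t) (M s)

/-- Decreasing `G`-martingales: `G`-martingales with quasi-surely non-increasing paths. -/
def IsDecreasingGMartingale (T σl σu : ℝ) (K : Time T → PathSpace T → ℝ) : Prop :=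
  IsGMartingale T σl σu K ∧ QuasiSurely T σl σu (fun ω => Antitone (fun t => K t ω))

/-- `S_G^0(0, T)`: the processes `h(t, B_{t₁ ∧ t}, …, B_{tₙ ∧ t})` with `h` bounded and
Lipschitz. -/
def SG0 (T : ℝ) : Set (Time T → PathSpace T → ℝ) :=
  {η | ∃ (n : ℕ) (τ : Fin n → Time T) (h : ℝ × (Fin n → ℝ) → ℝ),
    (∃ C : ℝ, ∀ x, |h x| ≤ C) ∧ (∃ L : ℝ≥0, LipschitzWith L h) ∧
    ∀ t ω, η t ω = h ((t : ℝ), fun i => B (min (τ i) t) ω)}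

/-- `S_G^p(0, T)`: the completion of `S_G^0(0, T)` under the norm
`Ê[sup_{t ∈ [0, T]} |η_t|^p]^{1/p}`, realized by processes on `Ω_T`. -/
def SG (T σl σu p : ℝ) : Set (Time T → PathSpace T → ℝ) :=
  {X | ∃ η : ℕ → Time T → PathSpace T → ℝ, (∀ m, η m ∈ SG0 T) ∧
    Tendsto (fun m => gExpNonneg T σl σu
      (fun ω => ⨆ t : Time T, ENNReal.ofReal (|η m t ω - X t ω| ^ p))) atTop (𝓝 0)}

/-- `I = ∫_a^b f dg` as a Riemann–Stieltjes integral: the sums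
`∑ᵢ f(τᵢ) (g(pᵢ₊₁) - g(pᵢ))` over the tagged partitions of `[a, b]` converge to `I` as the mesh
tends to `0`. For `f` continuous and `g` monotone this limit exists; for right-continuous `g` it is
the Lebesgue–Stieltjes integral over `(a, b]`. -/
def HasStieltjesIntegral {T : ℝ} (f g : Time T → ℝ) (a b : Time T) (I : ℝ) : Prop :=
  ∀ ε > 0, ∃ δ > 0, ∀ (n : ℕ) (p : Fin (n + 1) → Time T) (τ : Fin n → Time T),
    Monotone p → p 0 = a → p (Fin.last n) = b →
    (∀ i : Fin n, p i.castSucc ≤ τ i ∧ τ i ≤ p i.succ) →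
    (∀ i : Fin n, (p i.succ : ℝ) - (p i.castSucc : ℝ) ≤ δ) →
    |(∑ i : Fin n, f (τ i) * (g (p i.succ) - g (p i.castSucc))) - I| ≤ ε

open Classical in
/-- The value of `∫_a^b f dg`, and `0` if the integral does not exist. -/
noncomputable def stieltjesIntegral {T : ℝ} (f g : Time T → ℝ) (a b : Time T) : ℝ :=
  if h : ∃ I, HasStieltjesIntegral f g a b I then h.choose else 0

end GExpectation

/-! The conditional `G`-expectation is only sublinear, so a nonnegative combination of increments of
two `G`-martingales need not have conditional expectation zero. The statement holds because X⁺ and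
X⁻ are never both positive: on each path at most one of the two terms a ΔK¹ and b ΔK² with
coefficients frozen at time u survives, and positive homogeneity gives Ê_u[a ΔK¹ + b ΔK²] = 0
(`condGExpLip_add_mul`).

To iterate this along a partition, only half of the tower property is used, Ê_s[Ê_t[ξ]] ≤ Ê_s[ξ]
(`gExp_condGExpLip_le`). It comes from the stability of 𝒫 under pasting nearly optimal laws at time
t (`paste_mem`), and it makes the conditional expectation of a Riemann sum nonnegative up to
approximation (`exists_approx_riemannSum`). The opposite bound is free: the integrands are
nonnegative and the K's decrease, so the Riemann sum itself is nonpositive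
(`gNorm_condGExpLip_le_of_nonpos`).

The Riemann sums must then converge to the integral in the norm Ê[|·|]. If X is replaced by η in
S_G^0, the pathwise error is at most (3e + w)(|K¹_T| + |K²_T|), where e bounds |η - X| uniformly in
time and w bounds the oscillation of η over short intervals. The first term is small by Young's
inequality with exponents α and α* (`exists_gExpNonneg_mul_le`). The second is small because paths
have a modulus of continuity in probability that is uniform over 𝒫 (`exists_measure_oscSet_le`,
`exists_osc_mul_le`). Second moments suffice for the latter: a large excursion made of small steps
contains two successive exits, which squares the Chebyshev bound.

All pathwise facts about ∫ f dg, for f continuous and g non-increasing, follow from one local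
estimate for a primitive (`IsPrimitive`); no one-sided continuity of g is needed. Nonemptiness of 𝒫
is never proved: if 𝒫 were empty, every norm would vanish and the martingale identity would be
trivial. -/

namespace GExpectation

variable {T σl σu : ℝ}

/-! ### Concatenation of paths and the canonical filtration -/

theorem B_concat (t r : Time T) (ω ω' : PathSpace T) :
    B r (concat t ω ω') = B (min r t) ω + (B (max r t) ω' - B t ω') := rfl

theorem B_concat_of_le {t r : Time T} (h : r ≤ t) (ω ω' : PathSpace T) :
    B r (concat t ω ω') = B r ω := by
  rw [B_concat, min_eq_left h, max_eq_right h]; ring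

theorem B_concat_of_ge {t r : Time T} (h : t ≤ r) (ω ω' : PathSpace T) :
    B r (concat t ω ω') = B t ω + (B r ω' - B t ω') := by
  rw [B_concat, min_eq_right h, max_eq_left h]

theorem pathSpace_ext {ω ω' : PathSpace T} (h : ∀ r, B r ω = B r ω') : ω = ω' :=
  Subtype.ext (ContinuousMap.ext h)

theorem concat_concat {s t : Time T} (h : s ≤ t) (ω ω' ω'' : PathSpace T) :
    concat t (concat s ω ω') ω'' = concat s ω (concat t ω' ω'') := by
  refine pathSpace_ext fun r => ?_
  rcases le_total r s with hrs | hrs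
  · rw [B_concat_of_le (hrs.trans h), B_concat_of_le hrs, B_concat_of_le hrs]
  rcases le_total r t with hrt | hrt
  · rw [B_concat_of_le hrt, B_concat_of_ge hrs, B_concat_of_ge hrs, B_concat_of_le hrt,
      B_concat_of_le h]
  · rw [B_concat_of_ge hrt, B_concat_of_ge h, B_concat_of_ge hrs, B_concat_of_ge hrt,
      B_concat_of_le h]
    ring

theorem concat_concat_left {s t : Time T} (h : s ≤ t) (ω ω' ω'' : PathSpace T) :
    concat s (concat t ω ω') ω'' = concat s ω ω'' := by
  refine pathSpace_ext fun r => ?_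
  rcases le_total r s with hrs | hrs
  · rw [B_concat_of_le hrs, B_concat_of_le hrs, B_concat_of_le (hrs.trans h)]
  · rw [B_concat_of_ge hrs, B_concat_of_ge hrs, B_concat_of_le h]

theorem continuous_concat (t : Time T) :
    Continuous fun p : PathSpace T × PathSpace T => concat t p.1 p.2 := by
  refine Continuous.subtype_mk (ContinuousMap.continuous_of_continuous_uncurry _ ?_) _
  have hev : ∀ g : (PathSpace T × PathSpace T) × Time T → Time T, Continuous g →
      Continuous (fun q : (PathSpace T × PathSpace T) × Time T => q.1.1.1 (g q)) ∧
      Continuous (fun q : (PathSpace T × PathSpace T) × Time T => q.1.2.1 (g q)) := by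
    intro g hg
    constructor
    · exact ContinuousEval.continuous_eval.comp (((continuous_subtype_val.comp
        (continuous_fst.comp continuous_fst))).prodMk hg)
    · exact ContinuousEval.continuous_eval.comp (((continuous_subtype_val.comp
        (continuous_snd.comp continuous_fst))).prodMk hg)
  exact ((hev (fun q => min q.2 t) (by fun_prop)).1).add
    (((hev (fun q => max q.2 t) (by fun_prop)).2).sub ((hev (fun _ => t) (by fun_prop)).2))

theorem measurable_concat (t : Time T) :
    Measurable fun p : PathSpace T × PathSpace T => concat t p.1 p.2 :=
  (continuous_concat t).measurable

theorem measurable_concat_right (t : Time T) (ω : PathSpace T) :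
    Measurable fun ω' : PathSpace T => concat t ω ω' :=
  (measurable_concat t).comp (measurable_const.prodMk measurable_id)

theorem measurable_B (t : Time T) : Measurable (B t : PathSpace T → ℝ) :=
  (continuous_B t).measurable

theorem stronglyMeasurable_B {q r : Time T} (h : q ≤ r) :
    StronglyMeasurable[canonicalFiltration T r] (B q : PathSpace T → ℝ) :=
  (Filtration.stronglyAdapted_natural
    (fun t : Time T => (continuous_B t).stronglyMeasurable) q).mono
    ((canonicalFiltration T).mono h)

theorem canonicalFiltration_eq (r : Time T) :
    (canonicalFiltration T r : MeasurableSpace (PathSpace T)) =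
      ⨆ j ≤ r, MeasurableSpace.comap (B j) (borel ℝ) := by
  rw [← BorelSpace.measurable_eq (α := ℝ)]
  rfl

/-- The generators of the σ-algebra at time r are preimages under restriction of the path to [0, r].
Giving the target the discrete σ-algebra avoids any measurability question there. -/
theorem mem_iff_of_agree {r : Time T} {A : Set (PathSpace T)}
    (hA : MeasurableSet[canonicalFiltration T r] A) {ω ω' : PathSpace T}
    (h : ∀ q ≤ r, B q ω = B q ω') : ω ∈ A ↔ ω' ∈ A := by
  let Φ : PathSpace T → (Set.Iic r → ℝ) := fun ω j => B j.1 ω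
  have hle : (canonicalFiltration T r : MeasurableSpace (PathSpace T)) ≤
      MeasurableSpace.comap Φ ⊤ := by
    rw [canonicalFiltration_eq]
    refine iSup₂_le fun j hj => ?_
    rintro _ ⟨S, -, rfl⟩
    exact ⟨{x | x ⟨j, hj⟩ ∈ S}, trivial, rfl⟩
  obtain ⟨S, -, rfl⟩ := hle A hA
  have : Φ ω = Φ ω' := funext fun j => h j.1 j.2
  simp only [Set.mem_preimage, this]

theorem measurable_concat_filtration {t r : Time T} (h : t ≤ r) (ω : PathSpace T) :
    Measurable[canonicalFiltration T r, canonicalFiltration T r] (concat t ω) := by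
  rw [measurable_iff_comap_le]
  conv_lhs => rw [canonicalFiltration_eq]
  simp only [MeasurableSpace.comap_iSup, MeasurableSpace.comap_comp]
  refine iSup₂_le fun j hj => ?_
  rw [← measurable_iff_comap_le]
  have h1 : ∀ q ≤ r, Measurable[canonicalFiltration T r] (B q : PathSpace T → ℝ) :=
    fun q hq => (stronglyMeasurable_B hq).measurable
  have : (B j ∘ concat t ω) = fun ω' => B (min j t) ω + (B (max j t) ω' - B t ω') := rfl
  rw [this, ← BorelSpace.measurable_eq (α := ℝ)]
  exact measurable_const.add ((h1 _ (max_le hj h)).sub (h1 _ h))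

theorem concat_mem_iff {r t : Time T} (h : r ≤ t) {A : Set (PathSpace T)}
    (hA : MeasurableSet[canonicalFiltration T r] A) (ω ω' : PathSpace T) :
    concat t ω ω' ∈ A ↔ ω ∈ A :=
  mem_iff_of_agree hA fun _ hq => B_concat_of_le (hq.trans h) ω ω'

theorem abs_B_sub_le_dist (r : Time T) (ω ω' : PathSpace T) :
    |B r ω - B r ω'| ≤ dist ω ω' := by
  rw [← Real.dist_eq]
  exact ContinuousMap.dist_apply_le_dist (f := ω.1) (g := ω'.1) r

theorem B_of_eq_zero {t : Time T} (h : (t : ℝ) = 0) (ω : PathSpace T) : B t ω = 0 :=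
  ω.2 t h

/-! ### Second moments and orthogonality of increments -/

theorem integrable_B {P : Measure (PathSpace T)} (hP : P ∈ martingaleLaws T σl σu) (v : Time T) :
    Integrable (B v) P :=
  hP.2.1.integrable v

theorem integrable_B_sq {P : Measure (PathSpace T)} (hP : P ∈ martingaleLaws T σl σu)
    (v : Time T) : Integrable (fun ω => B v ω ^ 2) P := by
  have := hP.1
  have h := (hP.2.2.1.integrable v).add (integrable_const (σl ^ 2 * (v : ℝ)))
  refine h.congr (ae_of_all _ fun ω => ?_)
  simp

theorem memLp_B {P : Measure (PathSpace T)} (hP : P ∈ martingaleLaws T σl σu) (v : Time T) :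
    MemLp (B v) 2 P :=
  (memLp_two_iff_integrable_sq (continuous_B v).aestronglyMeasurable).2 (integrable_B_sq hP v)

theorem integral_B_sq_le {P : Measure (PathSpace T)} (hP : P ∈ martingaleLaws T σl σu)
    (v : Time T) : ∫ ω, B v ω ^ 2 ∂P ≤ σu ^ 2 * T := by
  have := hP.1
  let z : Time T := ⟨0, le_rfl, v.2.1.trans v.2.2⟩
  have hz : z ≤ v := v.2.1
  have h := hP.2.2.2.setIntegral_le hz MeasurableSet.univ
  rw [setIntegral_univ, setIntegral_univ, integral_sub (integrable_B_sq hP v) (integrable_const _),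
    integral_sub (integrable_B_sq hP z) (integrable_const _)] at h
  have hz0 : ∀ ω : PathSpace T, B z ω = 0 := B_of_eq_zero rfl
  have hzr : (z : ℝ) = 0 := rfl
  simp only [hz0, hzr, integral_const, probReal_univ, smul_eq_mul, mul_zero, one_mul] at h
  norm_num at h
  exact h.trans (mul_le_mul_of_nonneg_left v.2.2 (sq_nonneg _))

theorem lintegral_B_sq_le {P : Measure (PathSpace T)} (hP : P ∈ martingaleLaws T σl σu)
    (v : Time T) : ∫⁻ ω, ENNReal.ofReal (B v ω ^ 2) ∂P ≤ ENNReal.ofReal (σu ^ 2 * T) := by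
  rw [← ofReal_integral_eq_lintegral_ofReal (integrable_B_sq hP v)
    (ae_of_all _ fun ω => sq_nonneg _)]
  exact ENNReal.ofReal_le_ofReal (integral_B_sq_le hP v)

/-- Z can be pulled out of the conditional expectation given the past at r, and the increment has
conditional expectation zero. Square integrability of Z makes the product integrable. -/
theorem integral_mul_increment {P : Measure (PathSpace T)} (hP : P ∈ martingaleLaws T σl σu)
    {r v : Time T} (h : r ≤ v) {Z : PathSpace T → ℝ}
    (hZm : StronglyMeasurable[canonicalFiltration T r] Z) (hZ : MemLp Z 2 P) :
    ∫ ω, Z ω * (B v ω - B r ω) ∂P = 0 := by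
  have := hP.1
  have hm := (canonicalFiltration T).le r
  have hint : Integrable (B v - B r) P := (integrable_B hP v).sub (integrable_B hP r)
  have hprod : Integrable (Z * (B v - B r)) P := hZ.integrable_mul ((memLp_B hP v).sub (memLp_B hP r))
  have h1 : P[B v - B r | canonicalFiltration T r] =ᵐ[P] 0 := by
    filter_upwards [condExp_sub (integrable_B hP v) (integrable_B hP r) (canonicalFiltration T r),
      hP.2.1.condExp_ae_eq h, hP.2.1.condExp_ae_eq (le_refl r)] with ω h1 h2 h3
    rw [h1, Pi.sub_apply, h2, h3]; simp
  have h2 := condExp_mul_of_stronglyMeasurable_left hZm hprod hint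
  calc ∫ ω, Z ω * (B v ω - B r ω) ∂P = ∫ ω, (Z * (B v - B r)) ω ∂P := rfl
    _ = ∫ ω, (P[Z * (B v - B r) | canonicalFiltration T r]) ω ∂P := (integral_condExp hm).symm
    _ = ∫ ω, (0 : ℝ) ∂P := integral_congr_ae (by
        filter_upwards [h1, h2] with ω h1 h2
        rw [h2, Pi.mul_apply, h1]; simp)
    _ = 0 := by simp

theorem setIntegral_mul_increment {P : Measure (PathSpace T)}
    (hP : P ∈ martingaleLaws T σl σu) {r v : Time T} (h : r ≤ v) {Z : PathSpace T → ℝ}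
    (hZm : StronglyMeasurable[canonicalFiltration T r] Z) (hZ : MemLp Z 2 P)
    {A : Set (PathSpace T)} (hA : MeasurableSet[canonicalFiltration T r] A) :
    ∫ ω in A, Z ω * (B v ω - B r ω) ∂P = 0 := by
  have hA' := (canonicalFiltration T).le r A hA
  rw [← integral_indicator hA', ← integral_mul_increment hP h (hZm.indicator hA)
    (hZ.indicator hA')]
  refine integral_congr_ae (ae_of_all _ fun ω => ?_)
  by_cases hω : ω ∈ A <;> simp [hω]

/-! ### Stability of the martingale laws under pasting -/

/-- The processes `p B² + q B - c t`, whose submartingale properties characterize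
`martingaleLaws`. -/
def testProcess (p q c : ℝ) (v : Time T) (ω : PathSpace T) : ℝ :=
  p * B v ω ^ 2 + q * B v ω - c * (v : ℝ)

theorem stronglyAdapted_testProcess (p q c : ℝ) :
    StronglyAdapted (canonicalFiltration T) (testProcess p q c) := fun _ =>
  (((stronglyMeasurable_B le_rfl).pow 2).const_mul p |>.add
    ((stronglyMeasurable_B le_rfl).const_mul q)).sub stronglyMeasurable_const

theorem measurable_testProcess (p q c : ℝ) (v : Time T) :
    Measurable (testProcess p q c v : PathSpace T → ℝ) :=
  (((measurable_B v).pow_const 2).const_mul p |>.add ((measurable_B v).const_mul q)).sub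
    measurable_const

theorem integrable_testProcess {P : Measure (PathSpace T)} [IsFiniteMeasure P] {v : Time T}
    (h : Integrable (fun ω => B v ω ^ 2) P) (p q c : ℝ) : Integrable (testProcess p q c v) P := by
  have h2 : MemLp (B v) 2 P :=
    (memLp_two_iff_integrable_sq (continuous_B v).aestronglyMeasurable).2 h
  exact ((h.const_mul p).add ((h2.integrable (by norm_num)).const_mul q)).sub (integrable_const _)

/-- Putting all four conditions into the same form lets the pasting argument be carried out once,
for a general test process. -/
theorem mem_martingaleLaws_iff {P : Measure (PathSpace T)} : P ∈ martingaleLaws T σl σu ↔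
    IsProbabilityMeasure P ∧
    Submartingale (testProcess 0 1 0) (canonicalFiltration T) P ∧
    Submartingale (testProcess 0 (-1) 0) (canonicalFiltration T) P ∧
    Submartingale (testProcess 1 0 (σl ^ 2)) (canonicalFiltration T) P ∧
    Submartingale (testProcess (-1) 0 (-σu ^ 2)) (canonicalFiltration T) P := by
  have e1 : (testProcess 0 1 0 : Time T → PathSpace T → ℝ) = fun t => B t := by
    funext t ω; simp [testProcess]
  have e2 : (testProcess 0 (-1) 0 : Time T → PathSpace T → ℝ) = -(fun t => B t) := by
    funext t ω; simp [testProcess]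
  have e3 : (testProcess 1 0 (σl ^ 2) : Time T → PathSpace T → ℝ) =
      fun t ω => B t ω ^ 2 - σl ^ 2 * (t : ℝ) := by
    funext t ω; simp [testProcess]
  have e4 : (testProcess (-1) 0 (-σu ^ 2) : Time T → PathSpace T → ℝ) =
      -(fun t ω => B t ω ^ 2 - σu ^ 2 * (t : ℝ)) := by
    funext t ω; simp [testProcess]; ring
  rw [e1, e2, e3, e4]
  constructor
  · rintro ⟨h0, h1, h2, h3⟩
    exact ⟨h0, h1.submartingale, h1.supermartingale.neg, h2, h3.neg⟩
  · rintro ⟨h0, h1, h2, h3, h4⟩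
    refine ⟨h0, martingale_iff.2 ⟨?_, h1⟩, h3, ?_⟩
    · simpa using h2.neg
    · simpa using h4.neg

/-- The law of the path that follows `P` up to time `t` and then, given the past `ω`, has the
increments of `κ ω`. -/
noncomputable def paste (t : Time T) (P : Measure (PathSpace T))
    (κ : Kernel (PathSpace T) (PathSpace T)) : Measure (PathSpace T) :=
  (P ⊗ₘ κ).map fun p => concat t p.1 p.2

theorem lintegral_paste (t : Time T) (P : Measure (PathSpace T)) [IsProbabilityMeasure P]
    (κ : Kernel (PathSpace T) (PathSpace T)) [IsMarkovKernel κ] {f : PathSpace T → ℝ≥0∞}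
    (hf : Measurable f) :
    ∫⁻ ω, f ω ∂(paste t P κ) = ∫⁻ ω, ∫⁻ ω', f (concat t ω ω') ∂(κ ω) ∂P := by
  rw [paste, lintegral_map hf (measurable_concat t)]
  exact Measure.lintegral_compProd (hf.comp (measurable_concat t))

theorem integral_paste (t : Time T) (P : Measure (PathSpace T)) [IsProbabilityMeasure P]
    (κ : Kernel (PathSpace T) (PathSpace T)) [IsMarkovKernel κ] {f : PathSpace T → ℝ}
    (hf : Measurable f) (hi : Integrable f (paste t P κ)) :
    ∫ ω, f ω ∂(paste t P κ) = ∫ ω, ∫ ω', f (concat t ω ω') ∂(κ ω) ∂P := by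
  have hi' := (integrable_map_measure hf.aestronglyMeasurable
    (measurable_concat t).aemeasurable).1 hi
  rw [paste, integral_map (measurable_concat t).aemeasurable hf.aestronglyMeasurable]
  exact Measure.integral_compProd hi'

instance isProbabilityMeasure_paste (t : Time T) (P : Measure (PathSpace T))
    [IsProbabilityMeasure P] (κ : Kernel (PathSpace T) (PathSpace T)) [IsMarkovKernel κ] :
    IsProbabilityMeasure (paste t P κ) :=
  Measure.isProbabilityMeasure_map (measurable_concat t).aemeasurable

/-- The pasted value is a sum of three terms, so its square is at most three times the sum of
squares. Each square has expectation at most σu² T, uniformly over the laws in the kernel. -/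
theorem integrable_B_sq_paste (t : Time T) {P : Measure (PathSpace T)}
    (hP : P ∈ martingaleLaws T σl σu) {κ : Kernel (PathSpace T) (PathSpace T)} [IsMarkovKernel κ]
    (hκ : ∀ ω, κ ω ∈ martingaleLaws T σl σu) (v : Time T) :
    Integrable (fun ω => B v ω ^ 2) (paste t P κ) := by
  have := hP.1
  have hm := (measurable_B (T := T) v).pow_const 2
  refine ⟨hm.aestronglyMeasurable, ?_⟩
  rw [hasFiniteIntegral_iff_ofReal (ae_of_all _ fun ω => sq_nonneg _),
    lintegral_paste t P κ hm.ennreal_ofReal]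
  have hm' : ∀ r, Measurable fun ω : PathSpace T => ENNReal.ofReal (B r ω ^ 2) :=
    fun r => ((measurable_B r).pow_const 2).ennreal_ofReal
  let C := ENNReal.ofReal (σu ^ 2 * T)
  have hle : ∀ ω, ∫⁻ ω', ENNReal.ofReal (B v (concat t ω ω') ^ 2) ∂(κ ω) ≤
      3 * ENNReal.ofReal (B (min v t) ω ^ 2) + (3 * C + 3 * C) := by
    intro ω
    calc ∫⁻ ω', ENNReal.ofReal (B v (concat t ω ω') ^ 2) ∂(κ ω)
        ≤ ∫⁻ ω', (3 * ENNReal.ofReal (B (min v t) ω ^ 2) +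
          (3 * ENNReal.ofReal (B (max v t) ω' ^ 2) + 3 * ENNReal.ofReal (B t ω' ^ 2))) ∂(κ ω) := by
          refine lintegral_mono fun ω' => ?_
          have h3 : (3 : ℝ≥0∞) = ENNReal.ofReal 3 := by simp
          rw [h3, ← ENNReal.ofReal_mul (by norm_num), ← ENNReal.ofReal_mul (by norm_num),
            ← ENNReal.ofReal_mul (by norm_num), ← ENNReal.ofReal_add (by positivity) (by positivity),
            ← ENNReal.ofReal_add (by positivity) (by positivity)]
          refine ENNReal.ofReal_le_ofReal ?_
          rw [B_concat]
          nlinarith [sq_nonneg (B (min v t) ω - B (max v t) ω'), sq_nonneg (B (min v t) ω + B t ω'),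
            sq_nonneg (B (max v t) ω' + B t ω')]
      _ = 3 * ENNReal.ofReal (B (min v t) ω ^ 2) +
          (3 * (∫⁻ ω', ENNReal.ofReal (B (max v t) ω' ^ 2) ∂(κ ω)) +
            3 * ∫⁻ ω', ENNReal.ofReal (B t ω' ^ 2) ∂(κ ω)) := by
          rw [lintegral_add_left measurable_const, lintegral_add_left ((hm' _).const_mul _),
            lintegral_const_mul _ (hm' _), lintegral_const_mul _ (hm' _)]
          simp
      _ ≤ _ := by
          gcongr <;> exact lintegral_B_sq_le (hκ ω) _
  calc _ ≤ ∫⁻ ω, (3 * ENNReal.ofReal (B (min v t) ω ^ 2) + (3 * C + 3 * C)) ∂P := lintegral_mono hle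
    _ = 3 * (∫⁻ ω, ENNReal.ofReal (B (min v t) ω ^ 2) ∂P) + (3 * C + 3 * C) := by
        rw [lintegral_add_right _ measurable_const, lintegral_const_mul _ (hm' _)]
        simp
    _ ≤ 3 * C + (3 * C + 3 * C) := by
        gcongr; exact lintegral_B_sq_le hP _
    _ < ⊤ := by
        have : C < ⊤ := ENNReal.ofReal_lt_top
        have h3 : 3 * C < ⊤ := ENNReal.mul_lt_top (by simp) this
        simp [h3]

/-- Up to time t the pasted path is the path under P. After t, with the past ω fixed, the increment
of the test process is its increment under κ ω plus the cross term 2p (B_t(ω) - B_t(ω'))(B_v -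
B_r)(ω'), whose integral over an event of the past vanishes by orthogonality. -/
theorem setIntegral_paste_le (t : Time T) {P : Measure (PathSpace T)}
    (hP : P ∈ martingaleLaws T σl σu) {κ : Kernel (PathSpace T) (PathSpace T)} [IsMarkovKernel κ]
    (hκ : ∀ ω, κ ω ∈ martingaleLaws T σl σu) {p q c : ℝ}
    (hY : ∀ Q ∈ martingaleLaws T σl σu,
      Submartingale (testProcess p q c) (canonicalFiltration T) Q)
    {r v : Time T} (hrv : r ≤ v) (hcase : v ≤ t ∨ t ≤ r) {A : Set (PathSpace T)}
    (hA : MeasurableSet[canonicalFiltration T r] A) :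
    ∫ ω in A, testProcess p q c r ω ∂(paste t P κ) ≤
      ∫ ω in A, testProcess p q c v ω ∂(paste t P κ) := by
  have := hP.1
  have hA' := (canonicalFiltration T).le r A hA
  have hint : ∀ v, Integrable (testProcess p q c v) (paste t P κ) := fun v =>
    integrable_testProcess (integrable_B_sq_paste t hP hκ v) p q c
  rcases hcase with hvt | htr
  · have key : ∀ w ≤ t, ∫ ω in A, testProcess p q c w ω ∂(paste t P κ) =
        ∫ ω in A, testProcess p q c w ω ∂P := by
      intro w hw
      rw [← integral_indicator hA', integral_paste t P κ
        ((measurable_testProcess p q c w).indicator hA') ((hint w).indicator hA'),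
        ← integral_indicator hA']
      refine integral_congr_ae (ae_of_all _ fun ω => ?_)
      have : ∀ ω', A.indicator (testProcess p q c w) (concat t ω ω') =
          A.indicator (testProcess p q c w) ω := by
        intro ω'
        by_cases hω : ω ∈ A
        · rw [Set.indicator_of_mem hω,
            Set.indicator_of_mem ((concat_mem_iff (hrv.trans hvt) hA ω ω').2 hω), testProcess,
            testProcess, B_concat_of_le hw]
        · rw [Set.indicator_of_notMem hω,
            Set.indicator_of_notMem (fun h => hω ((concat_mem_iff (hrv.trans hvt) hA ω ω').1 h))]
      simp [this]
    rw [key r (hrv.trans hvt), key v hvt]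
    exact (hY P hP).setIntegral_le hrv hA
  · have hpaste := integral_paste t P κ
      (((measurable_testProcess p q c v).sub (measurable_testProcess p q c r)).indicator hA')
      (((hint v).sub (hint r)).indicator hA')
    simp only [Pi.sub_def] at hpaste
    rw [← sub_nonneg, ← integral_sub (hint v).integrableOn (hint r).integrableOn,
      ← integral_indicator hA', hpaste]
    refine integral_nonneg fun ω => ?_
    have hQ := hκ ω
    set Q := κ ω
    have := hQ.1
    have hAω := measurable_concat_filtration htr ω hA
    have hAω' := (canonicalFiltration T).le r _ hAω
    have hiQ : ∀ v, Integrable (testProcess p q c v) Q := fun v => (hY Q hQ).integrable v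
    have hZ : StronglyMeasurable[canonicalFiltration T r]
        (fun ω' => 2 * p * (B t ω - B t ω')) :=
      (stronglyMeasurable_const.sub (stronglyMeasurable_B htr)).const_mul _
    have hZ2 : MemLp (fun ω' => 2 * p * (B t ω - B t ω')) 2 Q :=
      ((memLp_const _).sub (memLp_B hQ t)).const_mul _
    have h0 := setIntegral_mul_increment hQ hrv hZ hZ2 hAω
    have hprod : Integrable (fun ω' => 2 * p * (B t ω - B t ω') * (B v ω' - B r ω')) Q :=
      hZ2.integrable_mul ((memLp_B hQ v).sub (memLp_B hQ r))
    have h1 : ∫ ω', A.indicator (fun ω => testProcess p q c v ω - testProcess p q c r ω)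
        (concat t ω ω') ∂Q = ∫ ω' in concat t ω ⁻¹' A,
          ((testProcess p q c v ω' - testProcess p q c r ω') +
            2 * p * (B t ω - B t ω') * (B v ω' - B r ω')) ∂Q := by
      rw [← integral_indicator hAω']
      refine integral_congr_ae (ae_of_all _ fun ω' => ?_)
      by_cases h : concat t ω ω' ∈ A
      · have h' : ω' ∈ concat t ω ⁻¹' A := h
        simp only [Set.indicator_of_mem h, Set.indicator_of_mem h', testProcess,
          B_concat_of_ge htr, B_concat_of_ge (htr.trans hrv)]
        ring
      · have h' : ω' ∉ concat t ω ⁻¹' A := h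
        simp only [Set.indicator_of_notMem h, Set.indicator_of_notMem h']
    have h2 := integral_add ((hiQ v).sub (hiQ r)).integrableOn
      (hprod.integrableOn (s := concat t ω ⁻¹' A))
    simp only [Pi.sub_apply] at h2
    rw [Pi.zero_apply, h1, h2, h0, add_zero,
      integral_sub (hiQ v).integrableOn (hiQ r).integrableOn, sub_nonneg]
    exact (hY Q hQ).setIntegral_le hrv hAω

theorem submartingale_paste (t : Time T) {P : Measure (PathSpace T)}
    (hP : P ∈ martingaleLaws T σl σu) {κ : Kernel (PathSpace T) (PathSpace T)} [IsMarkovKernel κ]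
    (hκ : ∀ ω, κ ω ∈ martingaleLaws T σl σu) {p q c : ℝ}
    (hY : ∀ Q ∈ martingaleLaws T σl σu,
      Submartingale (testProcess p q c) (canonicalFiltration T) Q) :
    Submartingale (testProcess p q c) (canonicalFiltration T) (paste t P κ) := by
  have := hP.1
  refine submartingale_of_setIntegral_le (stronglyAdapted_testProcess p q c)
    (fun v => integrable_testProcess (integrable_B_sq_paste t hP hκ v) p q c) ?_
  intro r v hrv A hA
  rcases le_total v t with hvt | htv
  · exact setIntegral_paste_le t hP hκ hY hrv (Or.inl hvt) hA
  rcases le_total t r with htr | hrt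
  · exact setIntegral_paste_le t hP hκ hY hrv (Or.inr htr) hA
  -- When r < t < v the comparison passes through time t; A also belongs to the σ-algebra at t.
  · exact (setIntegral_paste_le t hP hκ hY hrt (Or.inl le_rfl) hA).trans
      (setIntegral_paste_le t hP hκ hY htv (Or.inr le_rfl) ((canonicalFiltration T).mono hrt A hA))

theorem paste_mem (t : Time T) {P : Measure (PathSpace T)}
    (hP : P ∈ martingaleLaws T σl σu) {κ : Kernel (PathSpace T) (PathSpace T)} [IsMarkovKernel κ]
    (hκ : ∀ ω, κ ω ∈ martingaleLaws T σl σu) : paste t P κ ∈ martingaleLaws T σl σu := by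
  have := hP.1
  rw [mem_martingaleLaws_iff]
  exact ⟨inferInstance,
    submartingale_paste t hP hκ fun Q hQ => (mem_martingaleLaws_iff.1 hQ).2.1,
    submartingale_paste t hP hκ fun Q hQ => (mem_martingaleLaws_iff.1 hQ).2.2.1,
    submartingale_paste t hP hκ fun Q hQ => (mem_martingaleLaws_iff.1 hQ).2.2.2.1,
    submartingale_paste t hP hκ fun Q hQ => (mem_martingaleLaws_iff.1 hQ).2.2.2.2⟩

/-! ### The algebra of Lipschitz cylinder variables -/

/-- `ξ` is `L`-Lipschitz in the values of the path at the times in `s`. -/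
def DependsLip (s : Finset (Time T)) (L : ℝ) (ξ : PathSpace T → ℝ) : Prop :=
  ∀ ω ω' : PathSpace T, ∀ d : ℝ, 0 ≤ d → (∀ i ∈ s, |B i ω - B i ω'| ≤ d) → |ξ ω - ξ ω'| ≤ L * d

/-- This form has no explicit φ, which makes closure properties easy: finite sets of times can be
merged freely. In the converse direction φ is recovered from its values on the range of the
evaluation map. -/
theorem mem_Lip_iff {ξ : PathSpace T → ℝ} : ξ ∈ Lip T ↔ (∃ C, ∀ ω, |ξ ω| ≤ C) ∧
    ∃ (s : Finset (Time T)) (L : ℝ), 0 ≤ L ∧ DependsLip s L ξ := by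
  constructor
  · rintro ⟨n, t, φ, ⟨C, hC⟩, ⟨L, hL⟩, h⟩
    refine ⟨⟨C, fun ω => by rw [h]; exact hC _⟩, Finset.univ.image t, L, L.2, ?_⟩
    intro ω ω' d hd hi
    rw [h, h, ← Real.dist_eq]
    refine (hL.dist_le_mul _ _).trans (mul_le_mul_of_nonneg_left ?_ L.2)
    rw [dist_pi_le_iff hd]
    intro i
    rw [Real.dist_eq]
    exact hi _ (Finset.mem_image_of_mem _ (Finset.mem_univ i))
  · rintro ⟨⟨C, hC⟩, s, L, hL, h⟩
    let t : Fin s.card → Time T := fun i => (s.equivFin.symm i : Time T)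
    let Ψ : PathSpace T → (Fin s.card → ℝ) := fun ω i => B (t i) ω
    have key : ∀ ω ω', |ξ ω - ξ ω'| ≤ L * dist (Ψ ω) (Ψ ω') := by
      intro ω ω'
      refine h ω ω' _ dist_nonneg fun i hi => ?_
      have := dist_le_pi_dist (Ψ ω) (Ψ ω') (s.equivFin ⟨i, hi⟩)
      simpa [Ψ, t, Real.dist_eq] using this
    have hfac : Function.FactorsThrough ξ Ψ := by
      intro ω ω' hω
      have := key ω ω'
      rw [hω, dist_self, mul_zero] at this
      exact sub_eq_zero.1 (abs_eq_zero.1 (le_antisymm this (abs_nonneg _)))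
    have hlip : LipschitzOnWith L.toNNReal (Function.extend Ψ ξ 0) (Set.range Ψ) := by
      refine LipschitzOnWith.of_dist_le_mul ?_
      rintro _ ⟨ω, rfl⟩ _ ⟨ω', rfl⟩
      rw [hfac.extend_apply, hfac.extend_apply, Real.dist_eq, Real.coe_toNNReal _ hL]
      exact key ω ω'
    -- The evaluation map need not be onto, for B vanishes at time 0, so a Lipschitz extension is
    -- taken. It may be unbounded and is truncated to [-C, C] below.
    obtain ⟨g, hg, hgeq⟩ := hlip.extend_real
    refine ⟨s.card, t, fun x => max (-C) (min C (g x)), ⟨|C|, fun x => ?_⟩,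
      ⟨L.toNNReal, (hg.const_min C).const_max (-C)⟩, fun ω => ?_⟩
    · rw [abs_le]
      refine ⟨(neg_le_neg (le_abs_self C)).trans (le_max_left _ _), max_le (neg_le_abs C) ?_⟩
      exact (min_le_left _ _).trans (le_abs_self C)
    · have h1 : g (Ψ ω) = ξ ω := by
        rw [← hgeq (Set.mem_range_self ω), hfac.extend_apply]
      change ξ ω = max (-C) (min C (g (Ψ ω)))
      rw [h1, min_eq_right (abs_le.1 (hC ω)).2, max_eq_right (abs_le.1 (hC ω)).1]

/-- Both arguments are bounded, so F need only be Lipschitz on bounded sets; this covers products.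
-/
theorem Lip.comp₂ {ξ ξ' : PathSpace T → ℝ} (hξ : ξ ∈ Lip T) (hξ' : ξ' ∈ Lip T)
    {F : ℝ → ℝ → ℝ} (hF : ∀ C, ∃ K, 0 ≤ K ∧ ∀ a b a' b', |a| ≤ C → |b| ≤ C → |a'| ≤ C → |b'| ≤ C →
      |F a b - F a' b'| ≤ K * (|a - a'| + |b - b'|)) :
    (fun ω => F (ξ ω) (ξ' ω)) ∈ Lip T := by
  classical
  obtain ⟨⟨C, hC⟩, s, L, hL, h⟩ := mem_Lip_iff.1 hξ
  obtain ⟨⟨C', hC'⟩, s', L', hL', h'⟩ := mem_Lip_iff.1 hξ'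
  obtain ⟨K, hK, hKF⟩ := hF (max (max C C') 0)
  have b1 : ∀ ω, |ξ ω| ≤ max (max C C') 0 := fun ω =>
    (hC ω).trans ((le_max_left _ _).trans (le_max_left _ _))
  have b2 : ∀ ω, |ξ' ω| ≤ max (max C C') 0 := fun ω =>
    (hC' ω).trans ((le_max_right _ _).trans (le_max_left _ _))
  refine mem_Lip_iff.2 ⟨⟨|F 0 0| + K * (C + C'), fun ω => ?_⟩, s ∪ s', K * (L + L'), by positivity,
    fun ω ω' d hd hi => ?_⟩
  · have h0 : |(0 : ℝ)| ≤ max (max C C') 0 := by simp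
    have := hKF (ξ ω) (ξ' ω) 0 0 (b1 ω) (b2 ω) h0 h0
    rw [sub_zero, sub_zero] at this
    calc |F (ξ ω) (ξ' ω)| = |F 0 0 + (F (ξ ω) (ξ' ω) - F 0 0)| := by ring_nf
      _ ≤ |F 0 0| + |F (ξ ω) (ξ' ω) - F 0 0| := abs_add_le _ _
      _ ≤ _ := by
        gcongr
        exact this.trans (mul_le_mul_of_nonneg_left (add_le_add (hC ω) (hC' ω)) hK)
  · refine (hKF _ _ _ _ (b1 ω) (b2 ω) (b1 ω') (b2 ω')).trans ?_
    rw [mul_assoc, add_mul]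
    gcongr
    · exact h ω ω' d hd fun i his => hi i (Finset.mem_union_left _ his)
    · exact h' ω ω' d hd fun i his => hi i (Finset.mem_union_right _ his)

theorem Lip.const (c : ℝ) : (fun _ => c) ∈ Lip T :=
  mem_Lip_iff.2 ⟨⟨|c|, fun _ => le_rfl⟩, ∅, 0, le_rfl, fun ω ω' d _ _ => by simp⟩

theorem Lip.add {ξ ξ' : PathSpace T → ℝ} (hξ : ξ ∈ Lip T) (hξ' : ξ' ∈ Lip T) :
    (fun ω => ξ ω + ξ' ω) ∈ Lip T :=
  Lip.comp₂ hξ hξ' fun C => ⟨1, zero_le_one, fun a b a' b' _ _ _ _ => by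
    rw [one_mul]
    calc |a + b - (a' + b')| = |(a - a') + (b - b')| := by ring_nf
      _ ≤ _ := abs_add_le _ _⟩

theorem Lip.sub {ξ ξ' : PathSpace T → ℝ} (hξ : ξ ∈ Lip T) (hξ' : ξ' ∈ Lip T) :
    (fun ω => ξ ω - ξ' ω) ∈ Lip T :=
  Lip.comp₂ hξ hξ' fun C => ⟨1, zero_le_one, fun a b a' b' _ _ _ _ => by
    rw [one_mul]
    calc |a - b - (a' - b')| = |(a - a') - (b - b')| := by ring_nf
      _ ≤ _ := abs_sub _ _⟩

theorem Lip.mul {ξ ξ' : PathSpace T → ℝ} (hξ : ξ ∈ Lip T) (hξ' : ξ' ∈ Lip T) :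
    (fun ω => ξ ω * ξ' ω) ∈ Lip T :=
  Lip.comp₂ hξ hξ' fun C => ⟨|C|, abs_nonneg C, fun a b a' b' ha hb ha' hb' => by
    have h1 := le_abs_self C
    calc |a * b - a' * b'| = |(a - a') * b + a' * (b - b')| := by ring_nf
      _ ≤ |(a - a') * b| + |a' * (b - b')| := abs_add_le _ _
      _ = |a - a'| * |b| + |a'| * |b - b'| := by rw [abs_mul, abs_mul]
      _ ≤ |a - a'| * |C| + |C| * |b - b'| :=
        add_le_add (mul_le_mul_of_nonneg_left (hb.trans h1) (abs_nonneg _))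
          (mul_le_mul_of_nonneg_right (ha'.trans h1) (abs_nonneg _))
      _ = _ := by ring⟩

theorem Lip.abs {ξ : PathSpace T → ℝ} (hξ : ξ ∈ Lip T) : (fun ω => |ξ ω|) ∈ Lip T :=
  Lip.comp₂ (F := fun a _ => |a|) hξ hξ fun C => ⟨1, zero_le_one, fun a b a' b' _ _ _ _ => by
    rw [one_mul]
    exact (abs_abs_sub_abs_le _ _).trans (le_add_of_nonneg_right (abs_nonneg _))⟩

theorem Lip.max_zero {ξ : PathSpace T → ℝ} (hξ : ξ ∈ Lip T) : (fun ω => max (ξ ω) 0) ∈ Lip T :=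
  Lip.comp₂ (F := fun a _ => max a 0) hξ hξ fun C => ⟨1, zero_le_one, fun a b a' b' _ _ _ _ => by
    rw [one_mul]
    exact (abs_max_sub_max_le_abs a a' 0).trans (le_add_of_nonneg_right (abs_nonneg _))⟩

theorem Lip.neg {ξ : PathSpace T → ℝ} (hξ : ξ ∈ Lip T) : (fun ω => -ξ ω) ∈ Lip T := by
  simpa using Lip.sub (Lip.const 0) hξ

/-! ### The sublinear expectation of bounded variables -/

/-- Bounded Borel random variables. -/
def BddMeasurable (ξ : PathSpace T → ℝ) : Prop := Measurable ξ ∧ ∃ C, ∀ ω, |ξ ω| ≤ C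

theorem Lip.bddMeasurable {ξ : PathSpace T → ℝ} (hξ : ξ ∈ Lip T) : BddMeasurable ξ := by
  obtain ⟨hC, s, L, hL, h⟩ := mem_Lip_iff.1 hξ
  refine ⟨Continuous.measurable (LipschitzWith.continuous (K := L.toNNReal) ?_), hC⟩
  refine LipschitzWith.of_dist_le_mul fun ω ω' => ?_
  rw [Real.dist_eq, Real.coe_toNNReal _ hL]
  exact h ω ω' _ dist_nonneg fun i _ => abs_B_sub_le_dist i ω ω'

theorem BddMeasurable.integrable {ξ : PathSpace T → ℝ} (h : BddMeasurable ξ)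
    (P : Measure (PathSpace T)) [IsFiniteMeasure P] : Integrable ξ P := by
  obtain ⟨hm, C, hC⟩ := h
  exact Integrable.of_bound hm.aestronglyMeasurable C (ae_of_all _ hC)

theorem BddMeasurable.section {ξ : PathSpace T → ℝ} (h : BddMeasurable ξ) (t : Time T)
    (ω : PathSpace T) : BddMeasurable fun ω' => ξ (concat t ω ω') :=
  ⟨h.1.comp (measurable_concat_right t ω), h.2.imp fun _ hC _ => hC _⟩

theorem BddMeasurable.bddAbove {ξ : PathSpace T → ℝ} (h : BddMeasurable ξ) :
    BddAbove (Set.range fun P : martingaleLaws T σl σu =>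
      ∫ ω, ξ ω ∂(P : Measure (PathSpace T))) := by
  obtain ⟨hm, C, hC⟩ := h
  refine ⟨C, ?_⟩
  rintro _ ⟨P, rfl⟩
  have := P.2.1
  have h1 := norm_integral_le_of_norm_le_const (μ := (P : Measure (PathSpace T))) (f := ξ)
    (ae_of_all _ hC)
  rw [probReal_univ, mul_one] at h1
  exact (le_abs_self _).trans h1

theorem le_gExp {ξ : PathSpace T → ℝ} (h : BddMeasurable ξ) {P : Measure (PathSpace T)}
    (hP : P ∈ martingaleLaws T σl σu) : ∫ ω, ξ ω ∂P ≤ gExp T σl σu ξ :=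
  le_ciSup (f := fun P : martingaleLaws T σl σu => ∫ ω, ξ ω ∂(P : Measure (PathSpace T)))
    h.bddAbove ⟨P, hP⟩

theorem gExp_le (hne : (martingaleLaws T σl σu).Nonempty) {ξ : PathSpace T → ℝ} {c : ℝ}
    (h : ∀ P ∈ martingaleLaws T σl σu, ∫ ω, ξ ω ∂P ≤ c) : gExp T σl σu ξ ≤ c := by
  have := hne.to_subtype
  exact ciSup_le fun P => h P P.2

theorem gExp_mono (hne : (martingaleLaws T σl σu).Nonempty) {ξ ξ' : PathSpace T → ℝ}
    (h : BddMeasurable ξ) (h' : BddMeasurable ξ') (hle : ∀ ω, ξ ω ≤ ξ' ω) :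
    gExp T σl σu ξ ≤ gExp T σl σu ξ' := by
  refine gExp_le hne fun P hP => ?_
  have := hP.1
  exact (integral_mono (h.integrable P) (h'.integrable P) hle).trans (le_gExp h' hP)

theorem BddMeasurable.sub {ξ ξ' : PathSpace T → ℝ}
    (h : BddMeasurable ξ) (h' : BddMeasurable ξ') : BddMeasurable fun ω => ξ ω - ξ' ω := by
  obtain ⟨hm, C, hC⟩ := h
  obtain ⟨hm', C', hC'⟩ := h'
  exact ⟨hm.sub hm', C + C', fun ω => (abs_sub _ _).trans (add_le_add (hC ω) (hC' ω))⟩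

theorem BddMeasurable.abs {ξ : PathSpace T → ℝ} (h : BddMeasurable ξ) :
    BddMeasurable fun ω => |ξ ω| :=
  ⟨h.1.abs, h.2.imp fun _ hC ω => by rw [abs_abs]; exact hC ω⟩

theorem gExp_nonneg {ξ : PathSpace T → ℝ} (h : ∀ ω, 0 ≤ ξ ω) : 0 ≤ gExp T σl σu ξ :=
  Real.iSup_nonneg fun _ => integral_nonneg h

theorem gExp_const (hne : (martingaleLaws T σl σu).Nonempty) (c : ℝ) :
    gExp T σl σu (fun _ => c) = c := by
  have := hne.to_subtype
  have h : ∀ P : martingaleLaws T σl σu, ∫ _, c ∂(P : Measure (PathSpace T)) = c := fun P => by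
    have := P.2.1
    simp
  simp only [gExp, h, ciSup_const]

theorem gExp_const_add (hne : (martingaleLaws T σl σu).Nonempty) (c : ℝ) {ξ : PathSpace T → ℝ}
    (h : BddMeasurable ξ) : gExp T σl σu (fun ω => c + ξ ω) = c + gExp T σl σu ξ := by
  have := hne.to_subtype
  have h1 : ∀ P : martingaleLaws T σl σu, ∫ ω, c + ξ ω ∂(P : Measure (PathSpace T)) =
      c + ∫ ω, ξ ω ∂(P : Measure (PathSpace T)) := fun P => by
    have := P.2.1
    rw [integral_add (integrable_const _) (h.integrable _)]
    simp
  simp only [gExp, h1]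
  rw [add_ciSup h.bddAbove]

theorem gExp_const_mul {c : ℝ} (hc : 0 ≤ c) (ξ : PathSpace T → ℝ) :
    gExp T σl σu (fun ω => c * ξ ω) = c * gExp T σl σu ξ := by
  simp only [gExp, integral_const_mul]
  rw [Real.mul_iSup_of_nonneg hc]

theorem abs_gExp_sub_le (hne : (martingaleLaws T σl σu).Nonempty) {ξ ξ' : PathSpace T → ℝ}
    (h : BddMeasurable ξ) (h' : BddMeasurable ξ') :
    |gExp T σl σu ξ - gExp T σl σu ξ'| ≤ gExp T σl σu fun ω => |ξ ω - ξ' ω| := by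
  have main : ∀ {ξ ξ' : PathSpace T → ℝ}, BddMeasurable ξ → BddMeasurable ξ' →
      gExp T σl σu ξ - gExp T σl σu ξ' ≤ gExp T σl σu fun ω => |ξ ω - ξ' ω| := by
    intro ξ ξ' h h'
    rw [sub_le_iff_le_add]
    refine gExp_le hne fun P hP => ?_
    have := hP.1
    have h1 := le_gExp (h.sub h').abs hP
    have h2 := le_gExp h' hP
    have h3 := integral_mono (h.integrable P)
      (((h.sub h').abs.integrable P).add (h'.integrable P)) (fun ω => by
        change ξ ω ≤ |ξ ω - ξ' ω| + ξ' ω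
        linarith [le_abs_self (ξ ω - ξ' ω)])
    rw [integral_add' ((h.sub h').abs.integrable P) (h'.integrable P)] at h3
    linarith
  rw [abs_sub_le_iff]
  refine ⟨main h h', (main h' h).trans (le_of_eq ?_)⟩
  congr 1; funext ω; exact abs_sub_comm _ _

theorem abs_gExp_le (hne : (martingaleLaws T σl σu).Nonempty) {ξ : PathSpace T → ℝ} {C : ℝ}
    (h : BddMeasurable ξ) (hC : ∀ ω, |ξ ω| ≤ C) : |gExp T σl σu ξ| ≤ C := by
  have h0 : BddMeasurable fun _ : PathSpace T => (0 : ℝ) := (Lip.bddMeasurable (Lip.const 0))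
  have := abs_gExp_sub_le hne h h0
  rw [gExp_const hne, sub_zero] at this
  refine this.trans ((gExp_mono hne (h.sub h0).abs (Lip.bddMeasurable (Lip.const C))
    fun ω => ?_).trans (gExp_const hne C).le)
  simpa using hC ω

/-! ### Conditional expectation of cylinder variables and the tower inequality -/

theorem condGExpLip_concat (t : Time T) (ξ : PathSpace T → ℝ) {s : Time T} (h : t ≤ s)
    (ω ω' : PathSpace T) :
    condGExpLip T σl σu t ξ (concat s ω ω') = condGExpLip T σl σu t ξ ω := by
  simp only [condGExpLip, concat_concat_left h]

/-- Two concatenations with the same future have the same increments after t, so their values at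
time i differ exactly as the pasts do at i ∧ t. The Lipschitz constant is therefore preserved. -/
theorem DependsLip.condGExpLip (hne : (martingaleLaws T σl σu).Nonempty) {ξ : PathSpace T → ℝ}
    (hb : BddMeasurable ξ) [DecidableEq (Time T)] {s : Finset (Time T)} {L : ℝ}
    (h : DependsLip s L ξ) (t : Time T) :
    DependsLip (s.image fun i => min i t) L (condGExpLip T σl σu t ξ) := by
  intro ω ω' d hd hi
  refine (abs_gExp_sub_le hne (hb.section t ω) (hb.section t ω')).trans ?_
  refine (gExp_mono hne ((hb.section t ω).sub (hb.section t ω')).abs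
    (Lip.bddMeasurable (Lip.const (L * d))) fun ω'' => ?_).trans (gExp_const hne _).le
  refine h _ _ d hd fun i his => ?_
  rw [B_concat, B_concat, add_sub_add_right_eq_sub]
  exact hi _ (Finset.mem_image_of_mem _ his)

theorem condGExpLip_mem (hne : (martingaleLaws T σl σu).Nonempty) {ξ : PathSpace T → ℝ}
    (hξ : ξ ∈ Lip T) (t : Time T) : condGExpLip T σl σu t ξ ∈ Lip T := by
  classical
  have hb := Lip.bddMeasurable hξ
  obtain ⟨⟨C, hC⟩, s, L, hL, h⟩ := mem_Lip_iff.1 hξ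
  exact mem_Lip_iff.2 ⟨⟨C, fun ω => abs_gExp_le hne (hb.section t ω) fun _ => hC _⟩, _, L, hL,
    h.condGExpLip hne hb t⟩

theorem Lip.section {ξ : PathSpace T → ℝ} (hξ : ξ ∈ Lip T) (t : Time T) (ω : PathSpace T) :
    (fun ω' => ξ (concat t ω ω')) ∈ Lip T := by
  classical
  obtain ⟨⟨C, hC⟩, s, L, hL, h⟩ := mem_Lip_iff.1 hξ
  refine mem_Lip_iff.2 ⟨⟨C, fun _ => hC _⟩, insert t (s.image fun i => max i t), L * 2,
    by positivity, fun ω' ω'' d hd hi => ?_⟩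
  rw [mul_assoc]
  refine h _ _ _ (by positivity) fun i his => ?_
  have h1 := hi t (Finset.mem_insert_self _ _)
  have h2 := hi (max i t) (Finset.mem_insert_of_mem (Finset.mem_image_of_mem _ his))
  rw [B_concat, B_concat]
  rw [abs_le] at h1 h2 ⊢
  constructor <;> linarith [h1.1, h1.2, h2.1, h2.2]

/-- For each P, pasting at time t a law that is nearly optimal given the past produces another
element of 𝒫 whose expectation of ξ nearly reaches E_P[Ê_t[ξ]]. -/
theorem gExp_condGExpLip_le (hne : (martingaleLaws T σl σu).Nonempty) {ξ : PathSpace T → ℝ}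
    (hξ : ξ ∈ Lip T) (t : Time T) :
    gExp T σl σu (condGExpLip T σl σu t ξ) ≤ gExp T σl σu ξ := by
  classical
  have hb := Lip.bddMeasurable hξ
  have hub := Lip.bddMeasurable (condGExpLip_mem hne hξ t)
  obtain ⟨-, s, L, hL, h⟩ := mem_Lip_iff.1 hξ
  have := hne.to_subtype
  refine gExp_le hne fun P hP => ?_
  have hPp := hP.1
  have : Nonempty (PathSpace T) := nonempty_of_isProbabilityMeasure P
  refine le_of_forall_pos_le_add fun ε₀ hε₀ => ?_
  -- One ε is lost to near-optimality. Moving between ω and a path within ε of it costs L ε twice,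
  -- once in the conditional expectation and once in the integral.
  obtain ⟨ε, hε, hεε⟩ : ∃ ε > 0, (1 + 2 * L) * ε = ε₀ :=
    ⟨ε₀ / (1 + 2 * L), by positivity, by field_simp⟩
  let w : ℕ → PathSpace T := TopologicalSpace.denseSeq (PathSpace T)
  have hQ : ∀ j, ∃ Q ∈ martingaleLaws T σl σu,
      condGExpLip T σl σu t ξ (w j) - ε < ∫ ω', ξ (concat t (w j) ω') ∂Q := by
    intro j
    obtain ⟨Q, hQ⟩ := exists_lt_of_lt_ciSup (sub_lt_self (condGExpLip T σl σu t ξ (w j)) hε)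
    exact ⟨Q, Q.2, hQ⟩
  choose Q hQmem hQ using hQ
  have hfind : ∀ ω, ∃ j, dist ω (w j) < ε := fun ω =>
    (TopologicalSpace.denseRange_denseSeq (PathSpace T)).exists_dist_lt ω hε
  -- Each ω uses the law chosen for the first dense path within ε of it. Only countably many laws
  -- occur, so the kernel is measurable without a selection theorem.
  let i : PathSpace T → ℕ := fun ω => Nat.find (hfind ω)
  have hi : Measurable i := measurable_find hfind fun k =>
    (isOpen_lt (continuous_id.dist continuous_const) continuous_const).measurableSet
  let κ : Kernel (PathSpace T) (PathSpace T) := (Kernel.ofFunOfCountable Q).comap i hi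
  have hκapp : ∀ ω, κ ω = Q (i ω) := fun ω => rfl
  have hκmem : ∀ ω, κ ω ∈ martingaleLaws T σl σu := fun ω => hQmem _
  have : IsMarkovKernel κ := ⟨fun ω => (hκmem ω).1⟩
  have hpaste := paste_mem t hP hκmem
  have hint : Integrable ξ (paste t P κ) := hb.integrable _
  have h1 := le_gExp hb hpaste
  have hintκ : Integrable (fun ω => ∫ ω', ξ (concat t ω ω') ∂(κ ω)) P := by
    obtain ⟨C, hC⟩ := hb.2
    refine Integrable.of_bound (StronglyMeasurable.integral_kernel_prod_right'
      (hb.1.comp (measurable_concat t)).stronglyMeasurable).aestronglyMeasurable C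
      (ae_of_all _ fun ω => ?_)
    have h1 := norm_integral_le_of_norm_le_const (μ := κ ω) (f := fun ω' => ξ (concat t ω ω'))
      (ae_of_all _ fun ω' => hC _)
    rwa [probReal_univ, mul_one] at h1
  rw [integral_paste t P κ hb.1 hint] at h1
  have hdiff : ∀ ω ω₂ ω', dist ω ω₂ < ε → |ξ (concat t ω ω') - ξ (concat t ω₂ ω')| ≤ L * ε := by
    intro ω ω₂ ω' hd
    refine h _ _ _ hε.le fun i _ => ?_
    rw [B_concat, B_concat, add_sub_add_right_eq_sub]
    exact (abs_B_sub_le_dist _ _ _).trans hd.le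
  have h2 : ∀ ω, condGExpLip T σl σu t ξ ω ≤ (∫ ω', ξ (concat t ω ω') ∂(κ ω)) + ε₀ := by
    intro ω
    have hd : dist ω (w (i ω)) < ε := Nat.find_spec (hfind ω)
    have hp := (hQmem (i ω)).1
    have e1 : condGExpLip T σl σu t ξ ω ≤ condGExpLip T σl σu t ξ (w (i ω)) + L * ε := by
      have := (abs_gExp_sub_le hne (hb.section t ω) (hb.section t (w (i ω)))).trans
        ((gExp_mono hne ((hb.section t ω).sub (hb.section t _)).abs
          (Lip.bddMeasurable (Lip.const (L * ε))) fun ω'' => hdiff _ _ ω'' hd).trans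
            (gExp_const hne _).le)
      rw [condGExpLip, condGExpLip]
      linarith [(abs_le.1 this).2]
    have e2 : ∫ ω', ξ (concat t (w (i ω)) ω') ∂(Q (i ω)) ≤
        (∫ ω', ξ (concat t ω ω') ∂(Q (i ω))) + L * ε := by
      have := integral_mono ((hb.section t (w (i ω))).integrable (Q (i ω)))
        (((hb.section t ω).integrable (Q (i ω))).add (integrable_const (L * ε))) (fun ω' => by
          change ξ (concat t (w (i ω)) ω') ≤ ξ (concat t ω ω') + L * ε
          linarith [(abs_le.1 (hdiff _ _ ω' hd)).1])
      rw [integral_add' ((hb.section t ω).integrable (Q (i ω))) (integrable_const _)] at this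
      simpa using this
    have e3 := hQ (i ω)
    rw [hκapp]
    linarith
  have h3 := integral_mono (hub.integrable P) (hintκ.add (integrable_const ε₀)) h2
  rw [integral_add' hintκ (integrable_const _)] at h3
  simp only [integral_const, probReal_univ, one_smul] at h3
  linarith

theorem condGExpLip_condGExpLip_le (hne : (martingaleLaws T σl σu).Nonempty)
    {ξ : PathSpace T → ℝ} (hξ : ξ ∈ Lip T) {s t : Time T} (h : s ≤ t) (ω : PathSpace T) :
    condGExpLip T σl σu s (condGExpLip T σl σu t ξ) ω ≤ condGExpLip T σl σu s ξ ω := by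
  have := gExp_condGExpLip_le hne (Lip.section hξ s ω) t
  refine le_trans (le_of_eq ?_) this
  unfold condGExpLip
  simp only [concat_concat h]

/-! ### A modulus of continuity uniform over the martingale laws -/

theorem integrable_B_sub_sq {P : Measure (PathSpace T)} (hP : P ∈ martingaleLaws T σl σu)
    (r v : Time T) : Integrable (fun ω => (B v ω - B r ω) ^ 2) P :=
  (memLp_two_iff_integrable_sq ((continuous_B v).sub (continuous_B r)).aestronglyMeasurable).1
    ((memLp_B hP v).sub (memLp_B hP r))

theorem setIntegral_increment_sq_le {P : Measure (PathSpace T)}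
    (hP : P ∈ martingaleLaws T σl σu) {r v : Time T} (h : r ≤ v) {A : Set (PathSpace T)}
    (hA : MeasurableSet[canonicalFiltration T r] A) :
    ∫ ω in A, (B v ω - B r ω) ^ 2 ∂P ≤ σu ^ 2 * ((v : ℝ) - r) * P.real A := by
  have := hP.1
  have h0 := setIntegral_mul_increment hP h (stronglyMeasurable_B (le_refl r)) (memLp_B hP r) hA
  have h1 := hP.2.2.2.setIntegral_le h hA
  rw [integral_sub (integrable_B_sq hP v).integrableOn (integrable_const _),
    integral_sub (integrable_B_sq hP r).integrableOn (integrable_const _), setIntegral_const,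
    setIntegral_const, smul_eq_mul, smul_eq_mul] at h1
  have hp : Integrable (fun ω => B r ω * (B v ω - B r ω)) P :=
    (memLp_B hP r).integrable_mul ((memLp_B hP v).sub (memLp_B hP r))
  have h2 : ∫ ω in A, (B v ω - B r ω) ^ 2 ∂P =
      (∫ ω in A, B v ω ^ 2 ∂P) - (∫ ω in A, B r ω ^ 2 ∂P) -
        2 * ∫ ω in A, B r ω * (B v ω - B r ω) ∂P := by
    have hsq : Integrable (fun ω => B v ω ^ 2 - B r ω ^ 2) P :=
      (integrable_B_sq hP v).sub (integrable_B_sq hP r)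
    rw [← integral_sub (integrable_B_sq hP v).integrableOn (integrable_B_sq hP r).integrableOn,
      ← integral_const_mul, ← integral_sub hsq.integrableOn (hp.const_mul 2).integrableOn]
    congr 1; funext ω; ring
  rw [h2, h0]
  linarith

/-- Expanding (B_v - B_a)² around B_r - B_a, the cross term integrates to zero and the remaining
term is a square. -/
theorem setIntegral_increment_sq_mono {P : Measure (PathSpace T)}
    (hP : P ∈ martingaleLaws T σl σu) {a r v : Time T} (har : a ≤ r) (h : r ≤ v)
    {A : Set (PathSpace T)} (hA : MeasurableSet[canonicalFiltration T r] A) :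
    ∫ ω in A, (B r ω - B a ω) ^ 2 ∂P ≤ ∫ ω in A, (B v ω - B a ω) ^ 2 ∂P := by
  have hZ := (memLp_B hP r).sub (memLp_B hP a)
  have h0 := setIntegral_mul_increment hP h
    ((stronglyMeasurable_B (le_refl r)).sub (stronglyMeasurable_B har)) hZ hA
  have hp : Integrable (fun ω => (B r ω - B a ω) * (B v ω - B r ω)) P :=
    hZ.integrable_mul ((memLp_B hP v).sub (memLp_B hP r))
  have hi1 := integrable_B_sub_sq hP a r
  have h1 := setIntegral_mono (μ := P) (s := A) (f := fun ω => (B r ω - B a ω) ^ 2 +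
    2 * ((B r ω - B a ω) * (B v ω - B r ω)))
    (hi1.add (hp.const_mul 2)).integrableOn (integrable_B_sub_sq hP a v).integrableOn
    (fun ω => by
      change (B r ω - B a ω) ^ 2 + 2 * ((B r ω - B a ω) * (B v ω - B r ω)) ≤ (B v ω - B a ω) ^ 2
      nlinarith [sq_nonneg (B v ω - B r ω)])
  rw [integral_add hi1.integrableOn (hp.const_mul 2).integrableOn, integral_const_mul] at h1
  simp only [Pi.sub_apply] at h0
  rw [h0] at h1
  simpa using h1

/-- The paths that leave the `ε`-neighbourhood of their value at `c 0`, along the times `c`, for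
the first time at index `k`. -/
def firstExit (c : ℕ → Time T) (ε : ℝ) (k : ℕ) : Set (PathSpace T) :=
  {ω | ε ≤ |B (c k) ω - B (c 0) ω| ∧ ∀ j < k, |B (c j) ω - B (c 0) ω| < ε}

theorem measurableSet_firstExit {c : ℕ → Time T} (hc : Monotone c) (ε : ℝ) (k : ℕ) :
    MeasurableSet[canonicalFiltration T (c k)] (firstExit c ε k) := by
  have h1 : ∀ j ≤ k, Measurable[canonicalFiltration T (c k)]
      (fun ω : PathSpace T => |B (c j) ω - B (c 0) ω|) := fun j hj =>
    continuous_abs.measurable.comp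
      ((stronglyMeasurable_B (hc hj)).sub (stronglyMeasurable_B (hc (Nat.zero_le k)))).measurable
  have h2 : firstExit c ε k = {ω | ε ≤ |B (c k) ω - B (c 0) ω|} ∩
      ⋂ j ∈ Finset.range k, {ω | |B (c j) ω - B (c 0) ω| < ε} := by
    ext ω; simp [firstExit]
  rw [h2]
  refine MeasurableSet.inter (h1 k le_rfl measurableSet_Ici) ?_
  refine Finset.measurableSet_biInter _ fun j hj => ?_
  exact h1 j (Finset.mem_range.1 hj).le measurableSet_Iio

theorem firstExit_disjoint (c : ℕ → Time T) (ε : ℝ) :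
    Pairwise fun i j => Disjoint (firstExit c ε i) (firstExit c ε j) := by
  intro i j hij
  rw [Set.disjoint_left]
  rintro ω ⟨h1, h2⟩ ⟨h3, h4⟩
  rcases lt_or_gt_of_ne hij with h | h
  · exact absurd (h4 i h) (not_lt.2 h1)
  · exact absurd (h2 j h) (not_lt.2 h3)

theorem exists_firstExit {c : ℕ → Time T} {ε : ℝ} {ω : PathSpace T} {k : ℕ}
    (h : ε ≤ |B (c k) ω - B (c 0) ω|) : ∃ j ≤ k, ω ∈ firstExit c ε j := by
  classical
  have hex : ∃ j, ε ≤ |B (c j) ω - B (c 0) ω| := ⟨k, h⟩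
  exact ⟨Nat.find hex, Nat.find_min' hex h, Nat.find_spec hex,
    fun j hj => not_le.1 (Nat.find_min hex hj)⟩

/-- Kolmogorov's maximal inequality, localized to an event A known at the starting time. On each
first-exit set the squared displacement is at least ε² and grows in mean until the final time; the
exit sets are disjoint. The factor P(A) is what allows the bound to be iterated. -/
theorem sum_firstExit_le {P : Measure (PathSpace T)} (hP : P ∈ martingaleLaws T σl σu)
    {c : ℕ → Time T} (hc : Monotone c) {ε : ℝ} (hε : 0 < ε) {A : Set (PathSpace T)}
    (hA : MeasurableSet[canonicalFiltration T (c 0)] A) (n : ℕ) :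
    ∑ k ∈ Finset.range (n + 1), P.real (A ∩ firstExit c ε k) ≤
      σu ^ 2 * ((c n : ℝ) - c 0) / ε ^ 2 * P.real A := by
  have := hP.1
  have hm : ∀ k, MeasurableSet[canonicalFiltration T (c k)] (A ∩ firstExit c ε k) := fun k =>
    ((canonicalFiltration T).mono (hc (Nat.zero_le k)) A hA).inter (measurableSet_firstExit hc ε k)
  have hm' : ∀ k, MeasurableSet (A ∩ firstExit c ε k) := fun k =>
    (canonicalFiltration T).le _ _ (hm k)
  have h1 : ∀ k ∈ Finset.range (n + 1), ε ^ 2 * P.real (A ∩ firstExit c ε k) ≤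
      ∫ ω in A ∩ firstExit c ε k, (B (c n) ω - B (c 0) ω) ^ 2 ∂P := by
    intro k hk
    refine le_trans ?_ (setIntegral_increment_sq_mono hP (hc (Nat.zero_le k))
      (hc (Nat.lt_succ_iff.1 (Finset.mem_range.1 hk))) (hm k))
    rw [mul_comm, ← smul_eq_mul, ← setIntegral_const]
    refine setIntegral_mono_on (integrable_const _) (integrable_B_sub_sq hP _ _).integrableOn
      (hm' k) fun ω hω => ?_
    rw [← sq_abs (B (c k) ω - B (c 0) ω)]
    exact pow_le_pow_left₀ hε.le hω.2.1 2
  have h2 : ∑ k ∈ Finset.range (n + 1),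
      ∫ ω in A ∩ firstExit c ε k, (B (c n) ω - B (c 0) ω) ^ 2 ∂P ≤
      ∫ ω in A, (B (c n) ω - B (c 0) ω) ^ 2 ∂P := by
    rw [← integral_biUnion_finset _ (fun k _ => hm' k) (fun i _ j _ hij =>
      (firstExit_disjoint c ε hij).mono Set.inter_subset_right Set.inter_subset_right)
      (fun k _ => (integrable_B_sub_sq hP _ _).integrableOn)]
    refine setIntegral_mono_set (integrable_B_sub_sq hP _ _).integrableOn
      (ae_of_all _ fun ω => sq_nonneg _) (Eventually.of_forall ?_)
    exact Set.iUnion₂_subset fun k _ => Set.inter_subset_left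
  have h3 := (Finset.sum_le_sum h1).trans (h2.trans (setIntegral_increment_sq_le hP
    (hc (Nat.zero_le n)) hA))
  rw [← Finset.mul_sum] at h3
  rw [div_mul_eq_mul_div, le_div_iff₀ (by positivity)]
  linarith

/-- With steps at most ε, the first exit from the ε-neighbourhood lands within 2ε of the start, so
reaching distance 3ε requires a second exit by ε from that point. Applying the maximal inequality
twice gives a squared bound. -/
theorem measure_grid_exit_le {P : Measure (PathSpace T)} (hP : P ∈ martingaleLaws T σl σu)
    {c : ℕ → Time T} (hc : Monotone c) {ε : ℝ} (hε : 0 < ε) (n : ℕ) :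
    P.real {ω | (∃ k ≤ n, 3 * ε ≤ |B (c k) ω - B (c 0) ω|) ∧
      ∀ k < n, |B (c (k + 1)) ω - B (c k) ω| ≤ ε} ≤
      (σu ^ 2 * ((c n : ℝ) - c 0) / ε ^ 2) ^ 2 := by
  have := hP.1
  set q := σu ^ 2 * ((c n : ℝ) - c 0) / ε ^ 2
  have hq : ∀ j ≤ n, σu ^ 2 * ((c n : ℝ) - c j) / ε ^ 2 ≤ q := by
    intro j hj
    have : (c 0 : ℝ) ≤ c j := hc (Nat.zero_le j)
    simp only [q]
    gcongr
  have hsub : {ω | (∃ k ≤ n, 3 * ε ≤ |B (c k) ω - B (c 0) ω|) ∧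
      ∀ k < n, |B (c (k + 1)) ω - B (c k) ω| ≤ ε} ⊆
      ⋃ j ∈ Finset.range (n + 1), ⋃ i ∈ Finset.range (n - j + 1),
        (firstExit c ε j ∩ firstExit (fun k => c (j + k)) ε i) := by
    rintro ω ⟨⟨k, hkn, hk⟩, hstep⟩
    obtain ⟨j, hjk, hj⟩ := exists_firstExit (c := c) (ε := ε) (ω := ω) (k := k) (by linarith)
    have hj2 : |B (c j) ω - B (c 0) ω| ≤ 2 * ε := by
      cases j with
      | zero => simp; exact hε.le
      | succ j =>
        have e1 := hj.2 j (Nat.lt_succ_self j)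
        have e2 := hstep j (by omega)
        rw [abs_le] at e2 ⊢
        rw [abs_lt] at e1
        constructor <;> linarith [e1.1, e1.2, e2.1, e2.2]
    have hk2 : ε ≤ |B (c (j + (k - j))) ω - B (c (j + 0)) ω| := by
      rw [Nat.add_sub_cancel' hjk, Nat.add_zero]
      have := abs_sub_abs_le_abs_sub (B (c k) ω - B (c 0) ω) (B (c j) ω - B (c 0) ω)
      rw [sub_sub_sub_cancel_right] at this
      linarith
    obtain ⟨i, hi, hi'⟩ := exists_firstExit (c := fun k => c (j + k)) hk2
    simp only [Set.mem_iUnion, Finset.mem_range]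
    exact ⟨j, by omega, i, by omega, hj, hi'⟩
  calc _ ≤ P.real (⋃ j ∈ Finset.range (n + 1), ⋃ i ∈ Finset.range (n - j + 1),
        (firstExit c ε j ∩ firstExit (fun k => c (j + k)) ε i)) := measureReal_mono hsub (measure_ne_top _ _)
    _ ≤ ∑ j ∈ Finset.range (n + 1), ∑ i ∈ Finset.range (n - j + 1),
        P.real (firstExit c ε j ∩ firstExit (fun k => c (j + k)) ε i) :=
      (measureReal_biUnion_finset_le _ _).trans
        (Finset.sum_le_sum fun j _ => measureReal_biUnion_finset_le _ _)
    _ ≤ ∑ j ∈ Finset.range (n + 1), q * P.real (firstExit c ε j) := by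
      refine Finset.sum_le_sum fun j hj => ?_
      have hjn : j ≤ n := Nat.lt_succ_iff.1 (Finset.mem_range.1 hj)
      have := sum_firstExit_le hP (c := fun k => c (j + k))
        (fun _ _ h => hc (Nat.add_le_add_left h j)) hε (A := firstExit c ε j)
        (measurableSet_firstExit hc ε j) (n - j)
      simp only [Nat.add_sub_cancel' hjn, Nat.add_zero] at this
      exact this.trans (mul_le_mul_of_nonneg_right (hq j hjn) measureReal_nonneg)
    _ = q * ∑ j ∈ Finset.range (n + 1), P.real (firstExit c ε j) := by rw [Finset.mul_sum]
    _ ≤ q * q := by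
      have := sum_firstExit_le hP hc hε (A := Set.univ) MeasurableSet.univ n
      simp only [Set.univ_inter, probReal_univ, mul_one] at this
      have h0 : 0 ≤ q := (Finset.sum_nonneg fun j _ => measureReal_nonneg).trans this
      exact mul_le_mul_of_nonneg_left this h0
    _ = q ^ 2 := (sq q).symm

/-- The points that divide `[u, v]` into `n` intervals of equal length. -/
noncomputable def grid (u v : Time T) (h : u ≤ v) (n k : ℕ) : Time T :=
  ⟨u + min ((k : ℝ) / n) 1 * ((v : ℝ) - u), by
    have huv : (u : ℝ) ≤ v := h
    have h0 : 0 ≤ min ((k : ℝ) / n) 1 := le_min (by positivity) zero_le_one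
    have h1 : min ((k : ℝ) / n) 1 ≤ 1 := min_le_right _ _
    have := u.2.1
    have := v.2.2
    constructor <;> nlinarith⟩

theorem grid_zero {u v : Time T} (h : u ≤ v) (n : ℕ) : grid u v h n 0 = u := by
  apply Subtype.ext; simp [grid]

theorem grid_last {u v : Time T} (h : u ≤ v) {n : ℕ} (hn : 0 < n) : grid u v h n n = v := by
  apply Subtype.ext
  have : (n : ℝ) ≠ 0 := by positivity
  simp [grid, div_self this]

theorem grid_mono {u v : Time T} (h : u ≤ v) (n : ℕ) : Monotone (grid u v h n) := by
  intro i j hij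
  have huv : (u : ℝ) ≤ v := h
  change (u : ℝ) + min ((i : ℝ) / n) 1 * ((v : ℝ) - u) ≤ u + min ((j : ℝ) / n) 1 * ((v : ℝ) - u)
  have : (i : ℝ) ≤ j := by exact_mod_cast hij
  have := sub_nonneg.2 huv
  gcongr

theorem grid_step {u v : Time T} (h : u ≤ v) (n k : ℕ) :
    (grid u v h n (k + 1) : ℝ) - grid u v h n k ≤ ((v : ℝ) - u) / n := by
  have huv : (u : ℝ) ≤ v := h
  have h1 : min (((k + 1 : ℕ) : ℝ) / n) 1 ≤ min ((k : ℝ) / n) 1 + 1 / n := by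
    have h2 : ((k + 1 : ℕ) : ℝ) / n = (k : ℝ) / n + 1 / n := by push_cast; ring
    have h3 : (0 : ℝ) ≤ 1 / n := by positivity
    rw [h2, ← min_add_add_right]
    exact min_le_min le_rfl (by linarith)
  have h4 := mul_le_mul_of_nonneg_right h1 (sub_nonneg.2 huv)
  have h5 : (u + min (((k + 1 : ℕ) : ℝ) / n) 1 * ((v : ℝ) - u)) -
      (u + min ((k : ℝ) / n) 1 * ((v : ℝ) - u)) ≤ ((v : ℝ) - u) / n := by
    have : ((v : ℝ) - u) / n = 1 / n * ((v : ℝ) - u) := by ring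
    rw [this]; linarith
  exact h5

theorem le_grid {u v : Time T} (h : u ≤ v) (n k : ℕ) : u ≤ grid u v h n k := by
  conv_lhs => rw [← grid_zero h n]
  exact grid_mono h n (Nat.zero_le k)

theorem exists_grid_between {u v : Time T} (h : u ≤ v) {n : ℕ} (hn : 0 < n) {x : Time T}
    (hu : u ≤ x) (hv : x ≤ v) : ∃ k < n, grid u v h n k ≤ x ∧ x ≤ grid u v h n (k + 1) := by
  classical
  have hex : ∃ k, x ≤ grid u v h n (k + 1) :=
    ⟨n - 1, by rwa [Nat.sub_add_cancel hn, grid_last h hn]⟩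
  refine ⟨Nat.find hex, ?_, ?_, Nat.find_spec hex⟩
  · refine lt_of_le_of_lt (Nat.find_min' hex (m := n - 1) ?_) (by omega)
    rwa [Nat.sub_add_cancel hn, grid_last h hn]
  · rcases Nat.eq_zero_or_pos (Nat.find hex) with h0 | h0
    · rw [h0, grid_zero]; exact hu
    · have := Nat.find_min hex (m := Nat.find hex - 1) (by omega)
      rw [Nat.sub_add_cancel h0] at this
      exact (not_le.1 this).le

theorem exists_modulus (ω : PathSpace T) {ε : ℝ} (hε : 0 < ε) :
    ∃ δ > 0, ∀ u v : Time T, |(u : ℝ) - v| < δ → |B u ω - B v ω| < ε := by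
  have huc : UniformContinuous ω.1 := CompactSpace.uniformContinuous_of_continuous ω.1.continuous
  obtain ⟨δ, hδ, h⟩ := Metric.uniformContinuous_iff.1 huc ε hε
  exact ⟨δ, hδ, fun u v huv => h (a := u) (b := v) huv⟩

/-- On a continuous path the excursion is seen by every sufficiently fine grid, and those grids have
steps at most ε. The event thus lies in the increasing union of tail intersections of the grid
events, and the bound passes to the limit. -/
theorem measure_exit_le {P : Measure (PathSpace T)} (hP : P ∈ martingaleLaws T σl σu)
    {a b : Time T} (hab : a ≤ b) {ε : ℝ} (hε : 0 < ε) :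
    P.real {ω | ∃ x, a ≤ x ∧ x ≤ b ∧ 3 * ε < |B x ω - B a ω|} ≤
      (σu ^ 2 * ((b : ℝ) - a) / ε ^ 2) ^ 2 := by
  have := hP.1
  let E : ℕ → Set (PathSpace T) := fun m =>
    {ω | (∃ k ≤ m + 1, 3 * ε ≤ |B (grid a b hab (m + 1) k) ω - B (grid a b hab (m + 1) 0) ω|) ∧
      ∀ k < m + 1, |B (grid a b hab (m + 1) (k + 1)) ω - B (grid a b hab (m + 1) k) ω| ≤ ε}
  have hE : ∀ m, P.real (E m) ≤ (σu ^ 2 * ((b : ℝ) - a) / ε ^ 2) ^ 2 := by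
    intro m
    have := measure_grid_exit_le hP (grid_mono hab (m + 1)) hε (m + 1)
    rw [grid_last hab (Nat.succ_pos m)] at this
    refine this.trans (le_of_eq ?_)
    rw [grid_zero]
  have hsub : {ω | ∃ x, a ≤ x ∧ x ≤ b ∧ 3 * ε < |B x ω - B a ω|} ⊆ ⋃ M, ⋂ m ∈ Set.Ici M, E m := by
    rintro ω ⟨x, hax, hxb, hx⟩
    -- The modulus keeps grid steps within ε and also moves x to a grid point without using up the
    -- slack in the strict inequality 3ε < |B_x - B_a|.
    obtain ⟨δ, hδ, hmod⟩ := exists_modulus ω (lt_min hε (sub_pos.2 hx))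
    obtain ⟨M, hM⟩ := exists_nat_gt (((b : ℝ) - a) / δ)
    rw [Set.mem_iUnion]
    refine ⟨M, Set.mem_iInter₂.2 fun m hm => ?_⟩
    have hstep : ((b : ℝ) - a) / (m + 1 : ℕ) < δ := by
      rw [div_lt_comm₀ (by positivity) hδ]
      refine hM.trans_le ?_
      have : (M : ℝ) ≤ m := by exact_mod_cast hm
      push_cast; linarith
    constructor
    · obtain ⟨k, hk, hk1, hk2⟩ := exists_grid_between hab (Nat.succ_pos m) hax hxb
      refine ⟨k, hk.le, ?_⟩
      rw [grid_zero]
      have hk1' : (grid a b hab (m + 1) k : ℝ) ≤ x := hk1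
      have hk2' : (x : ℝ) ≤ grid a b hab (m + 1) (k + 1) := hk2
      have h1 := grid_step hab (m + 1) k
      have h2 := hmod x (grid a b hab (m + 1) k) (by
        rw [abs_lt]; constructor <;> linarith)
      have h3 := h2.trans_le (min_le_right _ _)
      have h4 := abs_sub_abs_le_abs_sub (B x ω - B a ω) (B (grid a b hab (m + 1) k) ω - B a ω)
      rw [sub_sub_sub_cancel_right] at h4
      linarith
    · intro k _
      have h1 := grid_step hab (m + 1) k
      have h0 : (grid a b hab (m + 1) k : ℝ) ≤ grid a b hab (m + 1) (k + 1) :=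
        grid_mono hab (m + 1) (Nat.le_succ k)
      refine ((hmod _ _ ?_).trans_le (min_le_left _ _)).le
      rw [abs_lt]; constructor <;> linarith
  refine (measureReal_mono hsub).trans ?_
  have hmono : Monotone fun M => ⋂ m ∈ Set.Ici M, E m := fun M M' h =>
    Set.biInter_subset_biInter_left (Set.Ici_subset_Ici.2 h)
  have hlim := tendsto_measure_iUnion_atTop (μ := P) hmono
  have hlim' := (ENNReal.tendsto_toReal (measure_ne_top P _)).comp hlim
  refine le_of_tendsto hlim' (Eventually.of_forall fun M => ?_)
  refine (measureReal_mono (μ := P) ?_).trans (hE M)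
  exact Set.biInter_subset_of_mem (Set.mem_Ici.2 le_rfl)

/-- The paths whose oscillation over time intervals of length at most `δ` exceeds `ε`. -/
def oscSet (T δ ε : ℝ) : Set (PathSpace T) :=
  {ω | ∃ u v : Time T, |(u : ℝ) - v| ≤ δ ∧ ε < |B u ω - B v ω|}

theorem measurableSet_oscSet (δ ε : ℝ) : MeasurableSet (oscSet T δ ε) := by
  have : oscSet T δ ε = ⋃ (u : Time T) (v : Time T) (_ : |(u : ℝ) - v| ≤ δ),
      {ω | ε < |B u ω - B v ω|} := by
    ext ω; simp only [oscSet, Set.mem_iUnion, Set.mem_ofPred_eq, exists_prop]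
  rw [this]
  refine IsOpen.measurableSet (isOpen_iUnion fun u => isOpen_iUnion fun v => isOpen_iUnion fun _ => ?_)
  exact isOpen_lt continuous_const ((continuous_B u).sub (continuous_B v)).abs

/-- Over N cells of length T/N, the squared exit bound is of order 1/N² per cell, so the sum is of
order 1/N. Chebyshev alone, of order 1/N per cell, would not become small after summation. -/
theorem exists_measure_oscSet_le (hT : 0 < T) {ε : ℝ} (hε : 0 < ε) :
    ∃ δ > 0, ∀ P ∈ martingaleLaws T σl σu, P (oscSet T δ ε) ≤ ENNReal.ofReal ε := by
  -- Two times at distance at most T/N lie in the same or in adjacent cells, so at most three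
  -- displacements of size 3ε' are added.
  set ε' := ε / 9
  have hε' : 0 < ε' := by positivity
  let z : Time T := ⟨0, le_rfl, hT.le⟩
  let e : Time T := ⟨T, hT.le, le_rfl⟩
  have hze : z ≤ e := hT.le
  obtain ⟨N, hN⟩ := exists_nat_gt ((σu ^ 2 * T / ε' ^ 2) ^ 2 / ε)
  have hN0 : (0 : ℝ) < N := lt_of_le_of_lt (by positivity) hN
  have hNpos : 0 < N := by exact_mod_cast hN0
  refine ⟨T / N, by positivity, fun P hP => ?_⟩
  have := hP.1
  let c := grid z e hze N
  have hsub : oscSet T (T / N) ε ⊆ ⋃ k ∈ Finset.range N,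
      {ω | ∃ x, c k ≤ x ∧ x ≤ c (k + 1) ∧ 3 * ε' < |B x ω - B (c k) ω|} := by
    intro ω hω
    by_contra hcon
    simp only [Set.mem_iUnion, Finset.mem_range, Set.mem_ofPred_eq, not_exists, not_and,
      not_lt] at hcon
    have main : ∀ u v : Time T, u ≤ v → |(u : ℝ) - v| ≤ T / N → |B u ω - B v ω| ≤ ε := by
      intro u v huv hd
      have huv' : (u : ℝ) ≤ v := huv
      rw [abs_sub_comm, abs_of_nonneg (by linarith)] at hd
      obtain ⟨k, hk, hk1, hk2⟩ := exists_grid_between hze hNpos (x := u) u.2.1 u.2.2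
      have b1 := hcon k hk u hk1 hk2
      have b2 := hcon k hk (c (k + 1)) (grid_mono hze N (Nat.le_succ k)) le_rfl
      have h9 : ε = 9 * ε' := by simp only [ε']; ring
      rcases le_total v (c (k + 1)) with hv | hv
      · have b3 := hcon k hk v (hk1.trans huv) hv
        rw [abs_le] at *
        constructor <;> linarith [b1.1, b1.2, b3.1, b3.2]
      · rcases Nat.lt_or_ge (k + 1) N with hkN | hkN
        · have hv2 : v ≤ c (k + 1 + 1) := by
            have hk2' : (u : ℝ) ≤ c (k + 1) := hk2
            have e1 : (c (k + 1) : ℝ) = (k + 1 : ℝ) / N * T := by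
              have : ((k : ℝ) + 1) / N ≤ 1 := by
                rw [div_le_one hN0]; exact_mod_cast hkN.le
              simp [c, grid, z, e, this]
            have e2 : (c (k + 1 + 1) : ℝ) = (k + 1 + 1 : ℝ) / N * T := by
              have : ((k : ℝ) + 1 + 1) / N ≤ 1 := by
                rw [div_le_one hN0]; exact_mod_cast hkN
              simp [c, grid, z, e, this]
            change (v : ℝ) ≤ c (k + 1 + 1)
            have e3 : (k + 1 + 1 : ℝ) / N * T = (k + 1 : ℝ) / N * T + T / N := by ring
            linarith
          have b3 := hcon (k + 1) hkN v hv hv2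
          rw [abs_le] at *
          constructor <;> linarith [b1.1, b1.2, b2.1, b2.2, b3.1, b3.2]
        · have hkN' : k + 1 = N := by omega
          have hv2 : v ≤ c (k + 1) := by
            rw [hkN']
            simp only [c, grid_last hze hNpos]
            exact v.2.2
          have b3 := hcon k hk v (hk1.trans huv) hv2
          rw [abs_le] at *
          constructor <;> linarith [b1.1, b1.2, b3.1, b3.2]
    obtain ⟨u, v, hd, hlt⟩ := hω
    rcases le_total u v with h | h
    · exact absurd (main u v h hd) (not_le.2 hlt)
    · rw [abs_sub_comm] at hd hlt
      exact absurd (main v u h hd) (not_le.2 hlt)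
  have hreal : P.real (oscSet T (T / N) ε) ≤ ε := by
    calc _ ≤ ∑ k ∈ Finset.range N, P.real
          {ω | ∃ x, c k ≤ x ∧ x ≤ c (k + 1) ∧ 3 * ε' < |B x ω - B (c k) ω|} :=
          (measureReal_mono hsub (measure_ne_top _ _)).trans (measureReal_biUnion_finset_le _ _)
      _ ≤ ∑ k ∈ Finset.range N, (σu ^ 2 * (T / N) / ε' ^ 2) ^ 2 := by
          refine Finset.sum_le_sum fun k _ => ?_
          refine (measure_exit_le hP (grid_mono hze N (Nat.le_succ k)) hε').trans ?_
          have h1 := grid_step hze N k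
          have h2 : (c k : ℝ) ≤ c (k + 1) := grid_mono hze N (Nat.le_succ k)
          have h3 : ((e : ℝ) - z) / N = T / N := by simp [e, z]
          rw [h3] at h1
          have h4 := sub_nonneg.2 h2
          exact pow_le_pow_left₀ (by positivity) (by gcongr) 2
      _ = (σu ^ 2 * T / ε' ^ 2) ^ 2 / N := by
          rw [Finset.sum_const, Finset.card_range, nsmul_eq_mul]
          field_simp
      _ ≤ ε := by
          rw [div_le_comm₀ hN0 hε]; exact hN.le
  rw [← ofReal_measureReal]
  exact ENNReal.ofReal_le_ofReal hreal

/-! ### Quasi-sure calculus and the outer expectation -/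

theorem QuasiSurely.of_forall {p : PathSpace T → Prop} (h : ∀ ω, p ω) : QuasiSurely T σl σu p :=
  ⟨∅, MeasurableSet.empty, by simp [capacity], fun ω _ => h ω⟩

theorem QuasiSurely.mono {p q : PathSpace T → Prop} (hp : QuasiSurely T σl σu p)
    (h : ∀ ω, p ω → q ω) : QuasiSurely T σl σu q := by
  obtain ⟨A, hA, hc, hA'⟩ := hp
  exact ⟨A, hA, hc, fun ω hω => h ω (hA' ω hω)⟩

theorem capacity_eq_zero_iff {A : Set (PathSpace T)} :
    capacity T σl σu A = 0 ↔ ∀ P ∈ martingaleLaws T σl σu, P A = 0 := by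
  simp [capacity]

theorem QuasiSurely.and {p q : PathSpace T → Prop} (hp : QuasiSurely T σl σu p)
    (hq : QuasiSurely T σl σu q) : QuasiSurely T σl σu fun ω => p ω ∧ q ω := by
  obtain ⟨A, hA, hc, hA'⟩ := hp
  obtain ⟨A₂, hA₂, hc₂, hA₂'⟩ := hq
  rw [capacity_eq_zero_iff] at hc hc₂
  refine ⟨A ∪ A₂, hA.union hA₂, capacity_eq_zero_iff.2 fun P hP =>
    measure_union_null (hc P hP) (hc₂ P hP), fun ω hω => ?_⟩
  rw [Set.mem_union, not_or] at hω
  exact ⟨hA' ω hω.1, hA₂' ω hω.2⟩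

/-- Raising g to ∞ on the polar set gives a Borel majorant valid everywhere and changes no
expectation under 𝒫. -/
theorem gExpNonneg_le_of_qs {f g : PathSpace T → ℝ≥0∞} (hg : Measurable g)
    (h : QuasiSurely T σl σu fun ω => f ω ≤ g ω) :
    gExpNonneg T σl σu f ≤ ⨆ P ∈ martingaleLaws T σl σu, ∫⁻ ω, g ω ∂P := by
  obtain ⟨A, hA, hc, hA'⟩ := h
  rw [capacity_eq_zero_iff] at hc
  have hm : Measurable fun ω => A.indicator (fun _ => (⊤ : ℝ≥0∞)) ω + g ω :=
    (measurable_const.indicator hA).add hg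
  refine (iInf₂_le _ hm).trans ((iInf_le _ fun ω => ?_).trans ?_)
  · by_cases hω : ω ∈ A
    · simp [hω]
    · simpa [hω] using hA' ω hω
  · refine iSup₂_mono fun P hP => ?_
    rw [lintegral_add_left (measurable_const.indicator hA), lintegral_indicator_const hA, hc P hP]
    simp

theorem exists_majorant {f : PathSpace T → ℝ≥0∞} {c : ℝ≥0∞} (h : gExpNonneg T σl σu f < c) :
    ∃ g : PathSpace T → ℝ≥0∞, Measurable g ∧ (∀ ω, f ω ≤ g ω) ∧
      ⨆ P ∈ martingaleLaws T σl σu, ∫⁻ ω, g ω ∂P < c := by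
  simpa only [gExpNonneg, iInf_lt_iff, exists_prop] using h

theorem gExpNonneg_mono_qs {f g : PathSpace T → ℝ≥0∞}
    (h : QuasiSurely T σl σu fun ω => f ω ≤ g ω) :
    gExpNonneg T σl σu f ≤ gExpNonneg T σl σu g := by
  refine le_of_forall_gt fun c hc => ?_
  obtain ⟨g', hm, hle, hlt⟩ := exists_majorant hc
  exact (gExpNonneg_le_of_qs hm (h.mono fun ω hω => hω.trans (hle ω))).trans_lt hlt

theorem gExpNonneg_add_le (f g : PathSpace T → ℝ≥0∞) :
    gExpNonneg T σl σu (fun ω => f ω + g ω) ≤ gExpNonneg T σl σu f + gExpNonneg T σl σu g := by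
  refine ENNReal.le_of_forall_pos_le_add fun ε hε hfin => ?_
  have hε2 : (ε / 2 : ℝ≥0∞) ≠ 0 := by simp [hε.ne']
  have hf := ENNReal.lt_add_right (lt_of_le_of_lt le_self_add hfin).ne hε2
  have hg := ENNReal.lt_add_right (lt_of_le_of_lt le_add_self hfin).ne hε2
  obtain ⟨f', hf'm, hf', hf'lt⟩ := exists_majorant hf
  obtain ⟨g', hg'm, hg', hg'lt⟩ := exists_majorant hg
  calc _ ≤ ⨆ P ∈ martingaleLaws T σl σu, ∫⁻ ω, f' ω + g' ω ∂P :=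
        gExpNonneg_le_of_qs (hf'm.add hg'm) (.of_forall fun ω => add_le_add (hf' ω) (hg' ω))
    _ ≤ (⨆ P ∈ martingaleLaws T σl σu, ∫⁻ ω, f' ω ∂P) +
        ⨆ P ∈ martingaleLaws T σl σu, ∫⁻ ω, g' ω ∂P := by
        refine iSup₂_le fun P hP => ?_
        rw [lintegral_add_left hf'm]
        exact add_le_add (le_iSup₂ (f := fun P _ => ∫⁻ ω, f' ω ∂P) P hP)
          (le_iSup₂ (f := fun P _ => ∫⁻ ω, g' ω ∂P) P hP)
    _ ≤ (gExpNonneg T σl σu f + ε / 2) + (gExpNonneg T σl σu g + ε / 2) :=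
        add_le_add hf'lt.le hg'lt.le
    _ = _ := by rw [add_add_add_comm, ENNReal.add_halves]

theorem gExpNonneg_const_le (c : ℝ≥0∞) : gExpNonneg T σl σu (fun _ => c) ≤ c := by
  refine (gExpNonneg_le_of_qs measurable_const (.of_forall fun _ => le_rfl)).trans ?_
  refine iSup₂_le fun P hP => ?_
  have := hP.1
  simp

theorem gExpNonneg_const_mul_le {c : ℝ≥0∞} (hc : c ≠ ⊤) (f : PathSpace T → ℝ≥0∞) :
    gExpNonneg T σl σu (fun ω => c * f ω) ≤ c * gExpNonneg T σl σu f := by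
  rcases eq_or_ne c 0 with rfl | h0
  · simpa using gExpNonneg_const_le (T := T) (σl := σl) (σu := σu) 0
  rw [← ENNReal.inv_mul_le_iff h0 hc]
  refine le_of_forall_gt fun d hd => ?_
  obtain ⟨g, hgm, hg, hlt⟩ := exists_majorant hd
  refine lt_of_le_of_lt ?_ hlt
  rw [ENNReal.inv_mul_le_iff h0 hc]
  refine (gExpNonneg_le_of_qs (hgm.const_mul c)
    (.of_forall fun ω => mul_le_mul_right (hg ω) c)).trans ?_
  refine iSup₂_le fun P hP => ?_
  rw [lintegral_const_mul _ hgm]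
  exact mul_le_mul_right (le_iSup₂ (f := fun P _ => ∫⁻ ω, g ω ∂P) P hP) c

/-- The infimum of Borel majorants with expectations tending to 0 has integral zero under every law,
so it vanishes off one polar set that serves all laws. -/
theorem quasiSurely_exists_lt {f : ℕ → PathSpace T → ℝ≥0∞}
    (h : Tendsto (fun m => gExpNonneg T σl σu (f m)) atTop (𝓝 0)) :
    QuasiSurely T σl σu fun ω => ∀ ε > 0, ∃ m, f m ω < ε := by
  have h1 : ∀ k : ℕ, ∃ m, gExpNonneg T σl σu (f m) < ((k : ℝ≥0∞) + 1)⁻¹ := fun k =>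
    (h.eventually (gt_mem_nhds (ENNReal.inv_pos.2 (by finiteness)))).exists
  choose m hm using h1
  choose g hgm hg hlt using fun k => exists_majorant (hm k)
  have hmeas : Measurable fun ω => ⨅ k, g k ω := Measurable.iInf hgm
  refine ⟨{ω | 0 < ⨅ k, g k ω}, hmeas measurableSet_Ioi, ?_, ?_⟩
  · refine capacity_eq_zero_iff.2 fun P hP => ?_
    have hle : ∀ k : ℕ, ∫⁻ ω, ⨅ k, g k ω ∂P ≤ ((k : ℝ≥0∞) + 1)⁻¹ := fun k =>
      (lintegral_mono fun ω => iInf_le _ k).trans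
        ((le_iSup₂ (f := fun P _ => ∫⁻ ω, g k ω ∂P) P hP).trans (hlt k).le)
    have h0 : ∫⁻ ω, ⨅ k, g k ω ∂P = 0 := by
      have hlim : Tendsto (fun n : ℕ => ((n : ℝ≥0∞) + 1)⁻¹) atTop (𝓝 0) := by
        simpa using (tendsto_add_atTop_iff_nat 1).2 ENNReal.tendsto_inv_nat_nhds_zero
      exact le_antisymm (ge_of_tendsto' hlim hle) bot_le
    rw [lintegral_eq_zero_iff hmeas] at h0
    refine measure_mono_null (fun ω hω => ?_) (ae_iff.1 h0)
    exact ne_of_gt hω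
  · intro ω hω ε hε
    have h0 : ⨅ k, g k ω = 0 := by simpa using hω
    obtain ⟨k, hk⟩ := iInf_lt_iff.1 (h0.trans_lt hε)
    exact ⟨m k, (hg k ω).trans_lt hk⟩

/-! ### The conditional expectation as a contraction -/

/-- The norm `Ê[|ξ|]` of `L_G^1`. -/
noncomputable def gNorm (T σl σu : ℝ) (ξ : PathSpace T → ℝ) : ℝ≥0∞ :=
  gExpNonneg T σl σu fun ω => ENNReal.ofReal |ξ ω|

theorem gNorm_mono_qs {ξ ζ : PathSpace T → ℝ} (h : QuasiSurely T σl σu fun ω => |ξ ω| ≤ |ζ ω|) :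
    gNorm T σl σu ξ ≤ gNorm T σl σu ζ :=
  gExpNonneg_mono_qs (h.mono fun _ hω => ENNReal.ofReal_le_ofReal hω)

theorem gNorm_le_add {ξ ζ ζ' : PathSpace T → ℝ}
    (h : QuasiSurely T σl σu fun ω => |ξ ω| ≤ |ζ ω| + |ζ' ω|) :
    gNorm T σl σu ξ ≤ gNorm T σl σu ζ + gNorm T σl σu ζ' := by
  refine le_trans (gExpNonneg_mono_qs (h.mono fun ω hω => ?_)) (gExpNonneg_add_le _ _)
  rw [← ENNReal.ofReal_add (abs_nonneg _) (abs_nonneg _)]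
  exact ENNReal.ofReal_le_ofReal hω

theorem gNorm_sub_comm (ξ ζ : PathSpace T → ℝ) :
    gNorm T σl σu (fun ω => ξ ω - ζ ω) = gNorm T σl σu (fun ω => ζ ω - ξ ω) := by
  simp only [gNorm, abs_sub_comm]

theorem gNorm_mul_le {a ξ : PathSpace T → ℝ} {C : ℝ} (h : ∀ ω, |a ω| ≤ C) :
    gNorm T σl σu (fun ω => a ω * ξ ω) ≤ ENNReal.ofReal C * gNorm T σl σu ξ := by
  refine le_trans (gExpNonneg_mono_qs (.of_forall fun ω => ?_))
    (gExpNonneg_const_mul_le ENNReal.ofReal_ne_top _)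
  rw [abs_mul, ENNReal.ofReal_mul (abs_nonneg _)]
  exact mul_le_mul_left (ENNReal.ofReal_le_ofReal (h ω)) _

theorem gExpNonneg_ofReal_le {ξ : PathSpace T → ℝ} (h : BddMeasurable ξ) (h0 : ∀ ω, 0 ≤ ξ ω) :
    gExpNonneg T σl σu (fun ω => ENNReal.ofReal (ξ ω)) ≤ ENNReal.ofReal (gExp T σl σu ξ) := by
  refine (gExpNonneg_le_of_qs h.1.ennreal_ofReal (.of_forall fun _ => le_rfl)).trans ?_
  refine iSup₂_le fun P hP => ?_
  have := hP.1
  rw [← ofReal_integral_eq_lintegral_ofReal (h.integrable P) (ae_of_all _ h0)]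
  exact ENNReal.ofReal_le_ofReal (le_gExp h hP)

theorem ofReal_gExp_le (hne : (martingaleLaws T σl σu).Nonempty) {ξ : PathSpace T → ℝ}
    (h : BddMeasurable ξ) (h0 : ∀ ω, 0 ≤ ξ ω) :
    ENNReal.ofReal (gExp T σl σu ξ) ≤ gExpNonneg T σl σu (fun ω => ENNReal.ofReal (ξ ω)) := by
  refine le_of_forall_gt fun d hd => ?_
  obtain ⟨g, hgm, hg, hlt⟩ := exists_majorant hd
  refine lt_of_le_of_lt ?_ hlt
  rw [ENNReal.ofReal_le_iff_le_toReal hlt.ne_top]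
  refine gExp_le hne fun P hP => ?_
  have := hP.1
  rw [← ENNReal.ofReal_le_iff_le_toReal hlt.ne_top,
    ofReal_integral_eq_lintegral_ofReal (h.integrable P) (ae_of_all _ h0)]
  exact (lintegral_mono hg).trans (le_iSup₂ (f := fun P _ => ∫⁻ ω, g ω ∂P) P hP)

/-- Sublinearity gives |Ê_t[ξ] - Ê_t[ζ]| ≤ Ê_t[|ξ - ζ|]; the tower inequality then removes the
conditioning. -/
theorem gNorm_condGExpLip_sub_le (hne : (martingaleLaws T σl σu).Nonempty)
    {ξ ζ : PathSpace T → ℝ} (hξ : ξ ∈ Lip T) (hζ : ζ ∈ Lip T) (t : Time T) :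
    gNorm T σl σu (fun ω => condGExpLip T σl σu t ξ ω - condGExpLip T σl σu t ζ ω) ≤
      gNorm T σl σu (fun ω => ξ ω - ζ ω) := by
  have hd := Lip.abs (Lip.sub hξ hζ)
  have hc := Lip.bddMeasurable
    (Lip.abs (Lip.sub (condGExpLip_mem hne hξ t) (condGExpLip_mem hne hζ t)))
  have hcd := Lip.bddMeasurable (condGExpLip_mem hne hd t)
  refine (gExpNonneg_ofReal_le hc fun ω => abs_nonneg _).trans
    (le_trans (ENNReal.ofReal_le_ofReal ?_) (ofReal_gExp_le hne (Lip.bddMeasurable hd)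
      fun ω => abs_nonneg _))
  refine (gExp_mono hne hc hcd fun ω => ?_).trans (gExp_condGExpLip_le hne hd t)
  exact abs_gExp_sub_le hne ((Lip.bddMeasurable hξ).section t ω)
    ((Lip.bddMeasurable hζ).section t ω)

theorem tendstoLG_one_iff {ξ' : ℕ → PathSpace T → ℝ} {ξ : PathSpace T → ℝ} :
    TendstoLG T σl σu 1 ξ' ξ ↔
      Tendsto (fun n => gNorm T σl σu fun ω => ξ' n ω - ξ ω) atTop (𝓝 0) := by
  simp only [TendstoLG, gNorm, Real.rpow_one]

theorem isCondGExp_of_forall {t : Time T} {ξ ζ : PathSpace T → ℝ}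
    (h : ∀ ε : ℝ≥0∞, 0 < ε → ∃ ξ' ∈ Lip T, gNorm T σl σu (fun ω => ξ' ω - ξ ω) ≤ ε ∧
      gNorm T σl σu (fun ω => condGExpLip T σl σu t ξ' ω - ζ ω) ≤ ε) :
    IsCondGExp T σl σu t ξ ζ := by
  choose ξ' hL h1 h2 using fun n : ℕ => h ((n : ℝ≥0∞) + 1)⁻¹ (by simp)
  have hlim : Tendsto (fun n : ℕ => ((n : ℝ≥0∞) + 1)⁻¹) atTop (𝓝 0) := by
    simpa using (tendsto_add_atTop_iff_nat 1).2 ENNReal.tendsto_inv_nat_nhds_zero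
  exact ⟨ξ', hL, tendstoLG_one_iff.2 (tendsto_of_tendsto_of_tendsto_of_le_of_le
    tendsto_const_nhds hlim (fun _ => bot_le) h1), tendstoLG_one_iff.2
    (tendsto_of_tendsto_of_tendsto_of_le_of_le tendsto_const_nhds hlim (fun _ => bot_le) h2)⟩

theorem IsCondGExp.exists_approx {t : Time T} {ξ ζ : PathSpace T → ℝ}
    (h : IsCondGExp T σl σu t ξ ζ) {ε : ℝ≥0∞} (hε : 0 < ε) :
    ∃ ξ' ∈ Lip T, gNorm T σl σu (fun ω => ξ' ω - ξ ω) ≤ ε ∧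
      gNorm T σl σu (fun ω => condGExpLip T σl σu t ξ' ω - ζ ω) ≤ ε := by
  obtain ⟨ξ', hL, h1, h2⟩ := h
  rw [tendstoLG_one_iff] at h1 h2
  obtain ⟨n, hn1, hn2⟩ := ((h1.eventually (gt_mem_nhds hε)).and
    (h2.eventually (gt_mem_nhds hε))).exists
  exact ⟨ξ' n, hL n, hn1.le, hn2.le⟩

theorem gNorm_sub_le_add (ξ ζ χ : PathSpace T → ℝ) :
    gNorm T σl σu (fun ω => ξ ω - χ ω) ≤
      gNorm T σl σu (fun ω => ξ ω - ζ ω) + gNorm T σl σu (fun ω => ζ ω - χ ω) :=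
  gNorm_le_add (.of_forall fun ω => abs_sub_le (ξ ω) (ζ ω) (χ ω))

/-- The contraction extends to the completion, so any cylinder approximation of ξ may be used, not
just the sequence witnessing the definition. -/
theorem IsCondGExp.gNorm_le (hne : (martingaleLaws T σl σu).Nonempty) {t : Time T}
    {ξ ζ ξ' : PathSpace T → ℝ} (h : IsCondGExp T σl σu t ξ ζ) (hξ' : ξ' ∈ Lip T) :
    gNorm T σl σu (fun ω => condGExpLip T σl σu t ξ' ω - ζ ω) ≤
      gNorm T σl σu (fun ω => ξ' ω - ξ ω) := by
  refine ENNReal.le_of_forall_pos_le_add fun ε hε _ => ?_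
  obtain ⟨χ, hχ, h1, h2⟩ := h.exists_approx (ε := ε / 2) (by simp [hε.ne'])
  rw [gNorm_sub_comm] at h1
  calc _ ≤ gNorm T σl σu (fun ω => condGExpLip T σl σu t ξ' ω - condGExpLip T σl σu t χ ω) +
        gNorm T σl σu (fun ω => condGExpLip T σl σu t χ ω - ζ ω) := gNorm_sub_le_add _ _ _
    _ ≤ (gNorm T σl σu (fun ω => ξ' ω - ξ ω) + ε / 2) + ε / 2 :=
        add_le_add ((gNorm_condGExpLip_sub_le hne hξ' hχ t).trans
          ((gNorm_sub_le_add _ ξ _).trans (add_le_add le_rfl h1))) h2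
    _ = _ := by rw [add_assoc, ENNReal.add_halves]

/-! ### Riemann sums against decreasing G-martingales -/

/-- `ξ` depends only on the path up to time `t`. -/
def AdaptedTo (t : Time T) (ξ : PathSpace T → ℝ) : Prop :=
  ∀ s, t ≤ s → ∀ ω ω', ξ (concat s ω ω') = ξ ω

theorem AdaptedTo.mono {t s : Time T} (h : t ≤ s) {ξ : PathSpace T → ℝ} (hξ : AdaptedTo t ξ) :
    AdaptedTo s ξ := fun r hr => hξ r (h.trans hr)

theorem adaptedTo_condGExpLip (t : Time T) (ξ : PathSpace T → ℝ) :
    AdaptedTo t (condGExpLip T σl σu t ξ) := fun _ hs ω ω' => condGExpLip_concat t ξ hs ω ω'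

theorem IsGMartingale.exists_adapted (hne : (martingaleLaws T σl σu).Nonempty)
    {K : Time T → PathSpace T → ℝ} (hK : IsGMartingale T σl σu K) (t : Time T) {ε : ℝ≥0∞}
    (hε : 0 < ε) : ∃ κ ∈ Lip T, AdaptedTo t κ ∧ gNorm T σl σu (fun ω => κ ω - K t ω) ≤ ε := by
  obtain ⟨ξ', hξ', -, h2⟩ := (hK.2 t t le_rfl).exists_approx hε
  exact ⟨_, condGExpLip_mem hne hξ' t, adaptedTo_condGExpLip t ξ', h2⟩

/-- Approximate K_v by an adapted κ and subtract Ê_u[κ], which is close to Ê_u[K_v] = K_u by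
contraction. The conditional expectation is then exactly zero, which survives multiplication by
frozen coefficients. -/
theorem IsGMartingale.exists_increment (hne : (martingaleLaws T σl σu).Nonempty)
    {K : Time T → PathSpace T → ℝ} (hK : IsGMartingale T σl σu K) {u v : Time T} (huv : u ≤ v)
    {ε : ℝ≥0∞} (hε : 0 < ε) :
    ∃ l ∈ Lip T, AdaptedTo v l ∧ gNorm T σl σu (fun ω => l ω - (K v ω - K u ω)) ≤ ε ∧
      ∀ ω, condGExpLip T σl σu u l ω = 0 := by
  obtain ⟨κ, hκ, hκa, hκn⟩ := hK.exists_adapted hne v (ε := ε / 2) (by simp [hε.ne'])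
  have hc := condGExpLip_mem hne hκ u
  have hn2 := ((hK.2 u v huv).gNorm_le hne hκ).trans hκn
  have had := (adaptedTo_condGExpLip (σl := σl) (σu := σu) u κ)
  refine ⟨fun ω => κ ω - condGExpLip T σl σu u κ ω, Lip.sub hκ hc, ?_, ?_, fun ω => ?_⟩
  · intro s hs ω ω'
    simp only [hκa s hs, had s (huv.trans hs)]
  · rw [← ENNReal.add_halves ε]
    refine (gNorm_le_add (.of_forall fun ω => ?_)).trans (add_le_add hκn hn2)
    rw [sub_sub_sub_comm]
    exact abs_sub _ _
  · have h1 : ∀ ω', κ (concat u ω ω') - condGExpLip T σl σu u κ (concat u ω ω') =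
        -condGExpLip T σl σu u κ ω + κ (concat u ω ω') := fun ω' => by
      rw [had u le_rfl]; ring
    rw [condGExpLip]
    simp only [h1]
    rw [gExp_const_add hne _ ((Lip.bddMeasurable hκ).section u ω)]
    exact neg_add_cancel _

/-- Given the past, m, a and b are constants and one of a, b is zero. Only translation and positive
homogeneity are used; additivity would fail. -/
theorem condGExpLip_add_mul (hne : (martingaleLaws T σl σu).Nonempty) {u : Time T}
    {m a b l l' : PathSpace T → ℝ} (hm : AdaptedTo u m) (ha : AdaptedTo u a) (hb : AdaptedTo u b)
    (ha0 : ∀ ω, 0 ≤ a ω) (hb0 : ∀ ω, 0 ≤ b ω) (hab : ∀ ω, a ω = 0 ∨ b ω = 0)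
    (hl : l ∈ Lip T) (hl' : l' ∈ Lip T)
    (h : ∀ ω, condGExpLip T σl σu u l ω = 0) (h' : ∀ ω, condGExpLip T σl σu u l' ω = 0)
    (ω : PathSpace T) :
    condGExpLip T σl σu u (fun ω => m ω + (a ω * l ω + b ω * l' ω)) ω = m ω := by
  have e1 : ∀ (c : ℝ) (ξ : PathSpace T → ℝ), ξ ∈ Lip T → condGExpLip T σl σu u ξ ω = 0 → 0 ≤ c →
      gExp T σl σu (fun ω' => m ω + c * ξ (concat u ω ω')) = m ω := by
    intro c ξ hξ h0 hc
    rw [gExp_const_add hne _ (Lip.bddMeasurable (Lip.section (Lip.mul (Lip.const c) hξ) u ω)),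
      gExp_const_mul hc, show gExp T σl σu (fun ω' => ξ (concat u ω ω')) = 0 from h0]
    simp
  rw [condGExpLip]
  simp only [hm u le_rfl, ha u le_rfl, hb u le_rfl]
  rcases hab ω with h0 | h0
  · simp only [h0, zero_mul, zero_add]
    exact e1 _ _ hl' (h' ω) (hb0 ω)
  · simp only [h0, zero_mul, add_zero]
    exact e1 _ _ hl (h ω) (ha0 ω)

/-- The Riemann sums `∑ f¹_{c_k} (K¹_{c_{k+1}} - K¹_{c_k}) + f²_{c_k} (K²_{c_{k+1}} - K²_{c_k})`. -/
def riemannSum (f₁ f₂ K₁ K₂ : Time T → PathSpace T → ℝ) (c : ℕ → Time T) (n : ℕ)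
    (ω : PathSpace T) : ℝ :=
  ∑ k ∈ Finset.range n, (f₁ (c k) ω * (K₁ (c (k + 1)) ω - K₁ (c k) ω) +
    f₂ (c k) ω * (K₂ (c (k + 1)) ω - K₂ (c k) ω))

/-- Pairs of bounded, Lipschitz, adapted, nonnegative processes that are never both positive. -/
structure IsIntegrandPair (f₁ f₂ : Time T → PathSpace T → ℝ) : Prop where
  mem₁ : ∀ t, f₁ t ∈ Lip T
  mem₂ : ∀ t, f₂ t ∈ Lip T
  adapted₁ : ∀ t, AdaptedTo t (f₁ t)
  adapted₂ : ∀ t, AdaptedTo t (f₂ t)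
  nonneg₁ : ∀ t ω, 0 ≤ f₁ t ω
  nonneg₂ : ∀ t ω, 0 ≤ f₂ t ω
  eq_zero_or : ∀ t ω, f₁ t ω = 0 ∨ f₂ t ω = 0

/-- In the induction step the new term has conditional expectation zero at c_n, so conditioning the
new sum there returns the old one. The tower inequality then propagates the lower bound back to c_0.
-/
theorem exists_approx_riemannSum (hne : (martingaleLaws T σl σu).Nonempty)
    {f₁ f₂ K₁ K₂ : Time T → PathSpace T → ℝ} (hf : IsIntegrandPair f₁ f₂)
    (hK₁ : IsGMartingale T σl σu K₁) (hK₂ : IsGMartingale T σl σu K₂) {c : ℕ → Time T}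
    (hc : Monotone c) (n : ℕ) : ∀ ε : ℝ≥0∞, 0 < ε → ∃ S ∈ Lip T, AdaptedTo (c n) S ∧
      gNorm T σl σu (fun ω => S ω - riemannSum f₁ f₂ K₁ K₂ c n ω) ≤ ε ∧
      ∀ ω, 0 ≤ condGExpLip T σl σu (c 0) S ω := by
  induction n with
  | zero =>
    intro ε hε
    refine ⟨fun _ => 0, Lip.const 0, fun _ _ _ _ => rfl, ?_, fun ω => gExp_nonneg fun _ => le_rfl⟩
    simp only [riemannSum, Finset.range_zero, Finset.sum_empty, sub_zero, gNorm, abs_zero,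
      ENNReal.ofReal_zero]
    exact (gExpNonneg_const_le 0).trans bot_le
  | succ n ih =>
    intro ε hε
    obtain ⟨S, hS, hSa, hSn, hS0⟩ := ih (ε / 2) (by simp [hε.ne'])
    obtain ⟨C₁, hC₁⟩ := (Lip.bddMeasurable (hf.mem₁ (c n))).2
    obtain ⟨C₂, hC₂⟩ := (Lip.bddMeasurable (hf.mem₂ (c n))).2
    have hex : ∀ C : ℝ, ∃ ε' : ℝ≥0∞, 0 < ε' ∧ ENNReal.ofReal C * ε' ≤ ε / 2 / 2 := by
      intro C
      have hpos : 0 < ε / 2 / 2 := by simp [hε.ne']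
      -- Adding 1 keeps the denominator nonzero when the coefficient bound is 0.
      refine ⟨ε / 2 / 2 / (ENNReal.ofReal C + 1), ENNReal.div_pos hpos.ne' (by simp), ?_⟩
      rw [← mul_div_assoc, mul_comm]
      refine ENNReal.div_le_of_le_mul ?_
      exact mul_le_mul_right (le_self_add) _
    obtain ⟨ε₁, hε₁, hε₁'⟩ := hex C₁
    obtain ⟨ε₂, hε₂, hε₂'⟩ := hex C₂
    have hcn := hc (Nat.le_succ n)
    obtain ⟨l₁, hl₁, hl₁a, hl₁n, hl₁0⟩ := hK₁.exists_increment hne hcn hε₁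
    obtain ⟨l₂, hl₂, hl₂a, hl₂n, hl₂0⟩ := hK₂.exists_increment hne hcn hε₂
    have hmem : (fun ω => S ω + (f₁ (c n) ω * l₁ ω + f₂ (c n) ω * l₂ ω)) ∈ Lip T :=
      Lip.add hS (Lip.add (Lip.mul (hf.mem₁ _) hl₁) (Lip.mul (hf.mem₂ _) hl₂))
    refine ⟨_, hmem, ?_, ?_, fun ω => ?_⟩
    · intro s hs ω ω'
      simp only [hSa.mono hcn s hs, (hf.adapted₁ _).mono hcn s hs, (hf.adapted₂ _).mono hcn s hs,
        hl₁a s hs, hl₂a s hs]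
    · have h1 := (gNorm_mul_le (T := T) (σl := σl) (σu := σu) (a := f₁ (c n))
        (ξ := fun ω => l₁ ω - (K₁ (c (n + 1)) ω - K₁ (c n) ω)) hC₁).trans
        ((mul_le_mul_right hl₁n _).trans hε₁')
      have h2 := (gNorm_mul_le (T := T) (σl := σl) (σu := σu) (a := f₂ (c n))
        (ξ := fun ω => l₂ ω - (K₂ (c (n + 1)) ω - K₂ (c n) ω)) hC₂).trans
        ((mul_le_mul_right hl₂n _).trans hε₂')
      have h3 := (gNorm_le_add (T := T) (σl := σl) (σu := σu)
        (.of_forall fun ω => abs_add_le _ _)).trans (add_le_add h1 h2)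
      rw [ENNReal.add_halves] at h3
      rw [← ENNReal.add_halves ε]
      refine (gNorm_le_add (.of_forall fun ω => ?_)).trans (add_le_add hSn h3)
      refine le_trans (le_of_eq ?_) (abs_add_le _ _)
      rw [riemannSum, Finset.sum_range_succ, ← riemannSum]
      ring_nf
    · have h1 := condGExpLip_condGExpLip_le hne hmem (hc (Nat.zero_le n)) ω
      have h2 : condGExpLip T σl σu (c n)
          (fun ω => S ω + (f₁ (c n) ω * l₁ ω + f₂ (c n) ω * l₂ ω)) = S := funext fun ω =>
        condGExpLip_add_mul hne hSa (hf.adapted₁ _) (hf.adapted₂ _) (hf.nonneg₁ _) (hf.nonneg₂ _)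
          (hf.eq_zero_or _) hl₁ hl₂ hl₁0 hl₂0 ω
      rw [h2] at h1
      exact (hS0 ω).trans h1

/-- Here 0 ≤ Ê_u[S] ≤ Ê_u[S⁺], and S⁺ ≤ |S - R| quasi-surely because R ≤ 0. This replaces the
missing upper half of the tower property. -/
theorem gNorm_condGExpLip_le_of_nonpos (hne : (martingaleLaws T σl σu).Nonempty)
    {S R : PathSpace T → ℝ} {u : Time T} (hS : S ∈ Lip T)
    (h0 : ∀ ω, 0 ≤ condGExpLip T σl σu u S ω) (hR : QuasiSurely T σl σu fun ω => R ω ≤ 0) :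
    gNorm T σl σu (condGExpLip T σl σu u S) ≤ gNorm T σl σu (fun ω => S ω - R ω) := by
  have hz : ∀ ω, condGExpLip T σl σu u (fun _ => 0) ω = 0 := fun ω => gExp_const hne 0
  have h1 := gNorm_condGExpLip_sub_le hne (Lip.max_zero hS) (Lip.const 0) u
  simp only [hz, sub_zero] at h1
  refine (gNorm_mono_qs (.of_forall fun ω => ?_)).trans (h1.trans (gNorm_mono_qs
    (hR.mono fun ω hω => ?_)))
  · rw [abs_of_nonneg (h0 ω)]
    refine le_trans ?_ (le_abs_self _)
    exact gExp_mono hne ((Lip.bddMeasurable hS).section u ω)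
      ((Lip.bddMeasurable (Lip.max_zero hS)).section u ω) fun ω' => le_max_left _ _
  · rw [abs_of_nonneg (le_max_right _ _)]
    exact max_le ((by linarith : S ω ≤ S ω - R ω).trans (le_abs_self _)) (abs_nonneg _)

/-- M_s is approximated by an m known at time s, and M_t - M_s by an S with Ê_s[S] close to zero.
Then m + S approximates M_t, and Ê_s[m + S] = m + Ê_s[S] approximates M_s. -/
theorem isCondGExp_of_riemannSum (hne : (martingaleLaws T σl σu).Nonempty)
    {K₁ K₂ M : Time T → PathSpace T → ℝ} (hK₁ : IsDecreasingGMartingale T σl σu K₁)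
    (hK₂ : IsDecreasingGMartingale T σl σu K₂) {s t : Time T}
    (h : ∀ ε : ℝ≥0∞, 0 < ε → ∃ (f₁ f₂ : Time T → PathSpace T → ℝ) (n n' : ℕ) (c c' : ℕ → Time T),
      IsIntegrandPair f₁ f₂ ∧ Monotone c ∧ Monotone c' ∧ c n = s ∧ c' 0 = s ∧
      gNorm T σl σu (fun ω => riemannSum f₁ f₂ K₁ K₂ c n ω - M s ω) ≤ ε ∧
      gNorm T σl σu (fun ω => riemannSum f₁ f₂ K₁ K₂ c' n' ω - (M t ω - M s ω)) ≤ ε) :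
    IsCondGExp T σl σu s (M t) (M s) := by
  refine isCondGExp_of_forall fun ε hε => ?_
  have hε2 : 0 < ε / 2 / 2 := by simp [hε.ne']
  obtain ⟨f₁, f₂, n, n', c, c', hf, hc, hc', hcn, hc0, h1, h2⟩ := h _ hε2
  obtain ⟨m, hm, hma, hmn, -⟩ := exists_approx_riemannSum hne hf hK₁.1 hK₂.1 hc n _ hε2
  obtain ⟨S, hS, -, hSn, hS0⟩ := exists_approx_riemannSum hne hf hK₁.1 hK₂.1 hc' n' _ hε2
  rw [hc0] at hS0
  rw [hcn] at hma
  have hneg : QuasiSurely T σl σu fun ω => riemannSum f₁ f₂ K₁ K₂ c' n' ω ≤ 0 :=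
    (hK₁.2.and hK₂.2).mono fun ω hω => Finset.sum_nonpos fun k _ => add_nonpos
      (mul_nonpos_of_nonneg_of_nonpos (hf.nonneg₁ _ _)
        (sub_nonpos.2 (hω.1 (hc' (Nat.le_succ k)))))
      (mul_nonpos_of_nonneg_of_nonpos (hf.nonneg₂ _ _)
        (sub_nonpos.2 (hω.2 (hc' (Nat.le_succ k)))))
  have hES := (gNorm_condGExpLip_le_of_nonpos hne hS hS0 hneg).trans hSn
  have hms : gNorm T σl σu (fun ω => m ω - M s ω) ≤ ε / 2 := by
    rw [← ENNReal.add_halves (ε / 2)]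
    exact (gNorm_sub_le_add _ _ _).trans (add_le_add hmn h1)
  have hSt : gNorm T σl σu (fun ω => S ω - (M t ω - M s ω)) ≤ ε / 2 := by
    rw [← ENNReal.add_halves (ε / 2)]
    exact (gNorm_sub_le_add _ _ _).trans (add_le_add hSn h2)
  refine ⟨fun ω => m ω + S ω, Lip.add hm hS, ?_, ?_⟩
  · rw [← ENNReal.add_halves ε]
    refine (gNorm_le_add (.of_forall fun ω => ?_)).trans (add_le_add hms hSt)
    refine le_trans (le_of_eq ?_) (abs_add_le _ _)
    ring_nf
  · have hcond : ∀ ω, condGExpLip T σl σu s (fun ω => m ω + S ω) ω =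
        m ω + condGExpLip T σl σu s S ω := by
      intro ω
      rw [condGExpLip]
      simp only [hma s le_rfl]
      exact gExp_const_add hne _ ((Lip.bddMeasurable hS).section s ω)
    rw [← ENNReal.add_halves ε]
    refine (gNorm_le_add (.of_forall fun ω => ?_)).trans
      (add_le_add hms (hES.trans ENNReal.half_le_self))
    rw [hcond]
    refine le_trans (le_of_eq ?_) (abs_add_le _ _)
    ring_nf

/-! ### Pathwise Stieltjes integrals -/

/-- The Riemann sum of `∫_0^t f dg` along the grid that divides `[u, v]` into `n` intervals. -/
noncomputable def clampedSum (f g : Time T → ℝ) {u v : Time T} (h : u ≤ v) (n : ℕ) (t : Time T) :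
    ℝ :=
  ∑ k ∈ Finset.range n, f (grid u v h n k) *
    (g (min (grid u v h n (k + 1)) t) - g (min (grid u v h n k) t))

/-- The expression is the increment of g over the part of [c, c'] inside [u, v]. It vanishes if they
do not overlap; otherwise c is within one cell length plus v - u of τ. -/
theorem clamped_increment {g : Time T → ℝ} (hg : Antitone g) {u v c c' τ : Time T} {δ : ℝ}
    (huv : u ≤ v) (hcc : c ≤ c') (hδ : (v : ℝ) - u ≤ δ) (hδ' : (c' : ℝ) - c ≤ δ) (hu : u ≤ τ)
    (hv : τ ≤ v) :
    (g (min c' v) - g (min c v)) - (g (min c' u) - g (min c u)) ≤ 0 ∧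
    ((g (min c' v) - g (min c v)) - (g (min c' u) - g (min c u)) = 0 ∨
      |(c : ℝ) - τ| ≤ 2 * δ) := by
  rcases le_total c' u with h1 | h1
  · rw [min_eq_left h1, min_eq_left (hcc.trans h1), min_eq_left (h1.trans huv),
      min_eq_left (hcc.trans (h1.trans huv))]
    simp
  rcases le_total v c with h2 | h2
  · rw [min_eq_right h2, min_eq_right (huv.trans h2), min_eq_right (h2.trans hcc),
      min_eq_right ((huv.trans h2).trans hcc)]
    simp
  have h1' : (u : ℝ) ≤ c' := h1
  have h2' : (c : ℝ) ≤ v := h2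
  have hu' : (u : ℝ) ≤ τ := hu
  have hv' : (τ : ℝ) ≤ v := hv
  refine ⟨?_, Or.inr (by rw [abs_le]; constructor <;> linarith)⟩
  rw [min_eq_left h2, min_eq_right h1]
  rcases le_total c u with h3 | h3
  · rw [min_eq_left h3]
    have := hg (le_min h1 huv)
    linarith
  · rw [min_eq_right h3]
    have := hg (le_min hcc h2)
    linarith

/-- The error equals ∑ (f(c_k) - f(τ)) d_k with d_k ≤ 0 and ∑ d_k = g(v) - g(u). Only cells near τ
contribute. -/
theorem abs_clampedSum_sub_le (hT : 0 ≤ T) {f g : Time T → ℝ} (hg : Antitone g) {δ ε : ℝ}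
    (hosc : ∀ x y : Time T, |(x : ℝ) - y| ≤ 2 * δ → |f x - f y| ≤ ε) {n : ℕ} (hn : 0 < n)
    (hnδ : T / n ≤ δ) {u v τ : Time T} (hu : u ≤ τ) (hv : τ ≤ v) (huv : (v : ℝ) - u ≤ δ) :
    |clampedSum f g (show (⟨0, le_rfl, hT⟩ : Time T) ≤ ⟨T, hT, le_rfl⟩ from hT) n v -
      clampedSum f g (show (⟨0, le_rfl, hT⟩ : Time T) ≤ ⟨T, hT, le_rfl⟩ from hT) n u -
      f τ * (g v - g u)| ≤ ε * (g u - g v) := by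
  have hze : (⟨0, le_rfl, hT⟩ : Time T) ≤ ⟨T, hT, le_rfl⟩ := hT
  set c : ℕ → Time T := grid _ _ hze n with hc
  let d : ℕ → ℝ := fun k => (g (min (c (k + 1)) v) - g (min (c k) v)) -
    (g (min (c (k + 1)) u) - g (min (c k) u))
  have hd : ∀ k, d k ≤ 0 ∧ (d k = 0 ∨ |(c k : ℝ) - τ| ≤ 2 * δ) := fun k => by
    refine clamped_increment hg (hu.trans hv) (grid_mono hze n (Nat.le_succ k)) huv ?_ hu hv
    refine (grid_step hze n k).trans ?_
    simpa using hnδ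
  have hsum : ∑ k ∈ Finset.range n, d k = g v - g u := by
    have h0 : ∀ t : Time T, min (c 0) t = c 0 := fun t => by
      refine min_eq_left ?_
      rw [hc, grid_zero]; exact t.2.1
    have hl : ∀ t : Time T, min (c n) t = t := fun t => by
      refine min_eq_right ?_
      rw [hc, grid_last hze hn]; exact t.2.2
    simp only [d, Finset.sum_sub_distrib]
    have e1 := Finset.sum_range_sub (fun k => g (min (c k) v)) n
    have e2 := Finset.sum_range_sub (fun k => g (min (c k) u)) n
    simp only [Finset.sum_sub_distrib] at e1 e2
    rw [e1, e2, h0, h0, hl, hl]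
    ring
  have hdiff : clampedSum f g hze n v - clampedSum f g hze n u - f τ * (g v - g u) =
      ∑ k ∈ Finset.range n, (f (c k) - f τ) * d k := by
    rw [← hsum, Finset.mul_sum, clampedSum, clampedSum, ← Finset.sum_sub_distrib,
      ← Finset.sum_sub_distrib]
    refine Finset.sum_congr rfl fun k _ => ?_
    simp only [d, hc]
    ring
  rw [hdiff]
  calc |∑ k ∈ Finset.range n, (f (c k) - f τ) * d k|
      ≤ ∑ k ∈ Finset.range n, |(f (c k) - f τ) * d k| := Finset.abs_sum_le_sum_abs _ _
    _ ≤ ∑ k ∈ Finset.range n, ε * (-d k) := by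
      refine Finset.sum_le_sum fun k _ => ?_
      obtain ⟨h1, h2⟩ := hd k
      rw [abs_mul, abs_of_nonpos h1]
      rcases h2 with h2 | h2
      · rw [h2]; simp
      · exact mul_le_mul_of_nonneg_right (hosc _ _ h2) (neg_nonneg.2 h1)
    _ = ε * (g u - g v) := by
      rw [← Finset.mul_sum, Finset.sum_neg_distrib, hsum]; ring

theorem abs_clampedSum_le (hT : 0 ≤ T) {f g : Time T → ℝ} (hg : Antitone g) {C : ℝ}
    (hC : ∀ x, |f x| ≤ C) (n : ℕ) (t : Time T) :
    |clampedSum f g (show (⟨0, le_rfl, hT⟩ : Time T) ≤ ⟨T, hT, le_rfl⟩ from hT) n t| ≤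
      C * (g ⟨0, le_rfl, hT⟩ - g ⟨T, hT, le_rfl⟩) := by
  have hze : (⟨0, le_rfl, hT⟩ : Time T) ≤ ⟨T, hT, le_rfl⟩ := hT
  have hC0 : 0 ≤ C := (abs_nonneg _).trans (hC t)
  set c : ℕ → Time T := grid _ _ hze n with hc
  calc _ ≤ ∑ k ∈ Finset.range n, |f (c k) * (g (min (c (k + 1)) t) - g (min (c k) t))| :=
        Finset.abs_sum_le_sum_abs _ _
    _ ≤ ∑ k ∈ Finset.range n, C * -(g (min (c (k + 1)) t) - g (min (c k) t)) := by
        refine Finset.sum_le_sum fun k _ => ?_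
        have : g (min (c (k + 1)) t) - g (min (c k) t) ≤ 0 :=
          sub_nonpos.2 (hg (min_le_min (grid_mono hze n (Nat.le_succ k)) le_rfl))
        rw [abs_mul, abs_of_nonpos this]
        exact mul_le_mul_of_nonneg_right (hC _) (neg_nonneg.2 this)
    _ = C * (g (min (c 0) t) - g (min (c n) t)) := by
        rw [← Finset.mul_sum, Finset.sum_neg_distrib,
          Finset.sum_range_sub (fun k => g (min (c k) t)), neg_sub]
    _ ≤ _ := by
        refine mul_le_mul_of_nonneg_left ?_ hC0
        have h1 : g (min (c 0) t) ≤ g ⟨0, le_rfl, hT⟩ := hg (Subtype.coe_le_coe.1 (min (c 0) t).2.1)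
        have h2 : g ⟨T, hT, le_rfl⟩ ≤ g (min (c n) t) := hg (Subtype.coe_le_coe.1 (min (c n) t).2.2)
        linarith

/-- `F` is a primitive of `f dg`: on intervals of length at most `δ`, its increments differ from
`f τ dg` by at most the oscillation of `f` times the increment of `g`. -/
def IsPrimitive (f g F : Time T → ℝ) : Prop :=
  ∀ δ ε : ℝ, 0 < δ → (∀ x y : Time T, |(x : ℝ) - y| ≤ 2 * δ → |f x - f y| ≤ ε) →
    ∀ u v τ : Time T, u ≤ τ → τ ≤ v → (v : ℝ) - u ≤ δ →
      |F v - F u - f τ * (g v - g u)| ≤ ε * (g u - g v)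

/-- The grid sums are bounded for each t, so they converge along one ultrafilter for all t at once.
The primitive estimate holds eventually along the grids and is a closed condition, so the limit
inherits it. -/
theorem exists_isPrimitive (hT : 0 ≤ T) {f g : Time T → ℝ} (hf : Continuous f) (hg : Antitone g) :
    ∃ F : Time T → ℝ, F ⟨0, le_rfl, hT⟩ = 0 ∧ IsPrimitive f g F := by
  have hze : (⟨0, le_rfl, hT⟩ : Time T) ≤ ⟨T, hT, le_rfl⟩ := hT
  obtain ⟨C, hC⟩ : ∃ C, ∀ x, |f x| ≤ C := by
    obtain ⟨C, hC⟩ := isCompact_univ.exists_bound_of_continuousOn hf.continuousOn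
    exact ⟨C, fun x => hC x (Set.mem_univ x)⟩
  have hlim : ∀ t, ∃ I : ℝ, Tendsto (fun n => clampedSum f g hze n t) (hyperfilter ℕ) (𝓝 I) := by
    intro t
    set D := C * (g ⟨0, le_rfl, hT⟩ - g ⟨T, hT, le_rfl⟩)
    obtain ⟨I, -, hI⟩ := (isCompact_Icc (a := -D) (b := D)).ultrafilter_le_nhds
      ((hyperfilter ℕ).map fun n => clampedSum f g hze n t) (by
        refine le_principal_iff.2 (Eventually.of_forall (p := fun n => clampedSum f g hze n t ∈
          Set.Icc (-D) D) fun n => ?_)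
        exact abs_le.1 (abs_clampedSum_le hT hg hC n t))
    exact ⟨I, hI⟩
  choose F hF using hlim
  refine ⟨F, ?_, ?_⟩
  · refine tendsto_nhds_unique (hF _) (tendsto_const_nhds.congr fun n => ?_)
    rw [clampedSum]
    refine (Finset.sum_eq_zero fun k _ => ?_).symm
    rw [min_eq_right (le_grid hze n (k + 1)), min_eq_right (le_grid hze n k), sub_self, mul_zero]
  · intro δ ε hδ hosc u v τ hu hv huv
    have h1 := (((hF v).sub (hF u)).sub_const (f τ * (g v - g u))).abs
    refine le_of_tendsto h1 (Nat.hyperfilter_le_atTop ?_)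
    obtain ⟨N, hN⟩ := exists_nat_gt (T / δ)
    filter_upwards [eventually_ge_atTop (N + 1)] with n hn
    have hn0 : 0 < n := by omega
    refine abs_clampedSum_sub_le hT hg hosc hn0 ?_ hu hv huv
    rw [div_le_comm₀ (by positivity) hδ]
    refine hN.le.trans ?_
    exact_mod_cast (by omega : N ≤ n)

theorem sum_fin_sub {n : ℕ} (a : Fin (n + 1) → ℝ) :
    ∑ i : Fin n, (a i.succ - a i.castSucc) = a (Fin.last n) - a 0 := by
  induction n with
  | zero => simp
  | succ n ih =>
    rw [Fin.sum_univ_castSucc]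
    have := ih fun i => a i.castSucc
    simp only [Fin.castSucc_zero] at this
    simp only [Fin.succ_castSucc, this, Fin.succ_last]
    ring

theorem IsPrimitive.abs_sum_sub_le {f g F : Time T → ℝ} (hF : IsPrimitive f g F) {δ ε : ℝ}
    (hδ : 0 < δ) (hosc : ∀ x y : Time T, |(x : ℝ) - y| ≤ 2 * δ → |f x - f y| ≤ ε) {n : ℕ}
    (p : Fin (n + 1) → Time T) (τ : Fin n → Time T)
    (hτ : ∀ i : Fin n, p i.castSucc ≤ τ i ∧ τ i ≤ p i.succ)
    (hp : ∀ i : Fin n, (p i.succ : ℝ) - (p i.castSucc : ℝ) ≤ δ) :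
    |(∑ i : Fin n, f (τ i) * (g (p i.succ) - g (p i.castSucc))) -
      (F (p (Fin.last n)) - F (p 0))| ≤ ε * (g (p 0) - g (p (Fin.last n))) := by
  rw [← sum_fin_sub fun i => F (p i), ← Finset.sum_sub_distrib]
  calc _ ≤ ∑ i : Fin n, ε * -(g (p i.succ) - g (p i.castSucc)) := by
        refine (Finset.abs_sum_le_sum_abs _ _).trans (Finset.sum_le_sum fun i _ => ?_)
        rw [abs_sub_comm, neg_sub]
        exact hF δ ε hδ hosc _ _ _ (hτ i).1 (hτ i).2 (hp i)
    _ = _ := by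
        rw [← Finset.mul_sum, Finset.sum_neg_distrib, sum_fin_sub fun i => g (p i), neg_sub]

theorem exists_osc_le {f : Time T → ℝ} (hf : Continuous f) {ε : ℝ} (hε : 0 < ε) :
    ∃ δ > 0, ∀ x y : Time T, |(x : ℝ) - y| ≤ 2 * δ → |f x - f y| ≤ ε := by
  have huc : UniformContinuous f := CompactSpace.uniformContinuous_of_continuous hf
  obtain ⟨δ, hδ, h⟩ := Metric.uniformContinuous_iff.1 huc ε hε
  refine ⟨δ / 3, by positivity, fun x y hxy => ?_⟩
  have : dist x y < δ := lt_of_le_of_lt hxy (by linarith)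
  exact (h this).le

theorem IsPrimitive.hasStieltjesIntegral {f g F : Time T → ℝ} (hF : IsPrimitive f g F)
    (hf : Continuous f) (hg : Antitone g) {a b : Time T} (hab : a ≤ b) :
    HasStieltjesIntegral f g a b (F b - F a) := by
  intro ε hε
  have hgab : 0 ≤ g a - g b := sub_nonneg.2 (hg hab)
  -- The 1 in the denominator covers the case g(a) = g(b).
  obtain ⟨δ, hδ, hosc⟩ := exists_osc_le hf (ε := ε / (g a - g b + 1)) (by positivity)
  refine ⟨δ, hδ, fun n p τ _ h0 hl hτ hp => ?_⟩
  have := hF.abs_sum_sub_le hδ hosc p τ hτ hp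
  rw [h0, hl] at this
  refine this.trans ?_
  rw [div_mul_eq_mul_div, div_le_iff₀ (by positivity)]
  exact mul_le_mul_of_nonneg_left (by linarith) hε.le

theorem HasStieltjesIntegral.unique {f g : Time T → ℝ} {a b : Time T} (hab : a ≤ b) {I I' : ℝ}
    (h : HasStieltjesIntegral f g a b I) (h' : HasStieltjesIntegral f g a b I') : I = I' := by
  by_contra hne
  have hpos : 0 < |I - I'| / 3 := by
    have := abs_pos.2 (sub_ne_zero.2 hne)
    positivity
  obtain ⟨δ, hδ, h1⟩ := h _ hpos
  obtain ⟨δ', hδ', h1'⟩ := h' _ hpos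
  obtain ⟨N, hN⟩ := exists_nat_gt (((b : ℝ) - a) / min δ δ')
  have hm : 0 < min δ δ' := lt_min hδ hδ'
  have hba : (0 : ℝ) ≤ (b : ℝ) - a := sub_nonneg.2 hab
  have hN0 : (0 : ℝ) < N := lt_of_le_of_lt (by positivity) hN
  have hNpos : 0 < N := by exact_mod_cast hN0
  have hstep : ((b : ℝ) - a) / N ≤ min δ δ' := by
    rw [div_le_comm₀ hN0 hm]; exact hN.le
  let p : Fin (N + 1) → Time T := fun i => grid a b hab N i
  let τ : Fin N → Time T := fun i => p i.castSucc
  have hp : Monotone p := fun i j hij => grid_mono hab N hij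
  have hp0 : p 0 = a := grid_zero hab N
  have hpl : p (Fin.last N) = b := grid_last hab hNpos
  have hτ : ∀ i : Fin N, p i.castSucc ≤ τ i ∧ τ i ≤ p i.succ := fun i =>
    ⟨le_rfl, hp (Fin.castSucc_lt_succ).le⟩
  have hst : ∀ i : Fin N, (p i.succ : ℝ) - (p i.castSucc : ℝ) ≤ min δ δ' := fun i =>
    (grid_step hab N i).trans hstep
  have e1 := h1 N p τ hp hp0 hpl hτ fun i => (hst i).trans (min_le_left _ _)
  have e2 := h1' N p τ hp hp0 hpl hτ fun i => (hst i).trans (min_le_right _ _)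
  rw [abs_sub_comm] at e1
  have := (abs_sub_le I _ I').trans (add_le_add e1 e2)
  linarith

theorem exists_hasStieltjesIntegral (hT : 0 ≤ T) {f g : Time T → ℝ} (hf : Continuous f)
    (hg : Antitone g) (t : Time T) : ∃ I, HasStieltjesIntegral f g ⟨0, le_rfl, hT⟩ t I := by
  obtain ⟨F, -, hF⟩ := exists_isPrimitive hT hf hg
  exact ⟨_, hF.hasStieltjesIntegral hf hg t.2.1⟩

theorem stieltjesIntegral_eq {f g : Time T → ℝ} {a b : Time T} (hab : a ≤ b) {I : ℝ}
    (h : HasStieltjesIntegral f g a b I) : stieltjesIntegral f g a b = I := by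
  have hex : ∃ I, HasStieltjesIntegral f g a b I := ⟨I, h⟩
  rw [stieltjesIntegral, dif_pos hex]
  exact hex.choose_spec.unique hab h

theorem isPrimitive_stieltjesIntegral (hT : 0 ≤ T) {f g : Time T → ℝ} (hf : Continuous f)
    (hg : Antitone g) : IsPrimitive f g (stieltjesIntegral f g ⟨0, le_rfl, hT⟩) := by
  obtain ⟨F, hF0, hF⟩ := exists_isPrimitive hT hf hg
  have : stieltjesIntegral f g ⟨0, le_rfl, hT⟩ = F := by
    funext t
    rw [stieltjesIntegral_eq (Subtype.coe_le_coe.1 t.2.1)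
      (hF.hasStieltjesIntegral hf hg (Subtype.coe_le_coe.1 t.2.1)), hF0, sub_zero]
  rw [this]
  exact hF

theorem stieltjesIntegral_self (f g : Time T → ℝ) (a : Time T) : stieltjesIntegral f g a a = 0 := by
  refine stieltjesIntegral_eq le_rfl fun ε hε => ⟨1, one_pos, fun n p τ hp h0 hl _ _ => ?_⟩
  have hpa : ∀ i, p i = a := fun i =>
    le_antisymm (hl ▸ hp (Fin.le_last i)) (h0 ▸ hp (Fin.zero_le i))
  simp [hpa, hε.le]

theorem IsPrimitive.abs_grid_sum_sub_le {f g F : Time T → ℝ} (hF : IsPrimitive f g F) {δ ε : ℝ}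
    (hδ : 0 < δ) (hosc : ∀ x y : Time T, |(x : ℝ) - y| ≤ 2 * δ → |f x - f y| ≤ ε) {u v : Time T}
    (huv : u ≤ v) {n : ℕ} (hn : 0 < n) (hnδ : ((v : ℝ) - u) / n ≤ δ) :
    |(∑ k ∈ Finset.range n, f (grid u v huv n k) *
      (g (grid u v huv n (k + 1)) - g (grid u v huv n k))) - (F v - F u)| ≤ ε * (g u - g v) := by
  have := hF.abs_sum_sub_le hδ hosc (fun i : Fin (n + 1) => grid u v huv n i)
    (fun i : Fin n => grid u v huv n i)
    (fun i => ⟨le_rfl, grid_mono huv n (Nat.le_succ i)⟩)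
    (fun i => (grid_step huv n i).trans hnδ)
  simpa only [Fin.val_succ, Fin.val_castSucc, Fin.val_last, Fin.val_zero, grid_zero,
    grid_last huv hn, Finset.sum_range] using this

/-- Increments of F are limits of grid sums, and each such sum is nonpositive. -/
theorem IsPrimitive.antitone {f g F : Time T → ℝ} (hF : IsPrimitive f g F) (hf : Continuous f)
    (hf0 : ∀ t, 0 ≤ f t) (hg : Antitone g) : Antitone F := by
  intro u v huv
  have hguv : 0 ≤ g u - g v := sub_nonneg.2 (hg huv)
  refine le_of_forall_pos_le_add fun ε hε => ?_
  obtain ⟨δ, hδ, hosc⟩ := exists_osc_le hf (ε := ε / (g u - g v + 1)) (by positivity)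
  obtain ⟨N, hN⟩ := exists_nat_gt (((v : ℝ) - u) / δ)
  have hvu : (0 : ℝ) ≤ (v : ℝ) - u := sub_nonneg.2 huv
  have hN0 : (0 : ℝ) < N := lt_of_le_of_lt (by positivity) hN
  have hNpos : 0 < N := by exact_mod_cast hN0
  have h1 := hF.abs_grid_sum_sub_le hδ hosc huv hNpos (by rw [div_le_comm₀ hN0 hδ]; exact hN.le)
  have h2 : ∑ k ∈ Finset.range N, f (grid u v huv N k) *
      (g (grid u v huv N (k + 1)) - g (grid u v huv N k)) ≤ 0 :=
    Finset.sum_nonpos fun k _ => mul_nonpos_of_nonneg_of_nonpos (hf0 _)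
      (sub_nonpos.2 (hg (grid_mono huv N (Nat.le_succ k))))
  have h3 : ε / (g u - g v + 1) * (g u - g v) ≤ ε := by
    rw [div_mul_eq_mul_div, div_le_iff₀ (by positivity)]
    exact mul_le_mul_of_nonneg_left (by linarith) hε.le
  have := (abs_le.1 h1).1
  linarith

/-! ### Product estimates under the G-expectation -/

/-- Young's inequality for (e/b)(b k): the weight b first makes b^q Ê[k^q] small, and δ then absorbs
the fixed factor b^(-p). The factors 1/p and 1/q are dropped. -/
theorem exists_gExpNonneg_mul_le {p q : ℝ} (hpq : p.HolderConjugate q) {k : PathSpace T → ℝ≥0∞}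
    (hk : gExpNonneg T σl σu (fun ω => k ω ^ q) ≠ ⊤) {ε : ℝ≥0∞} (hε : 0 < ε) :
    ∃ δ > 0, ∀ e : PathSpace T → ℝ≥0∞, gExpNonneg T σl σu (fun ω => e ω ^ p) ≤ δ →
      gExpNonneg T σl σu (fun ω => e ω * k ω) ≤ ε := by
  set A := gExpNonneg T σl σu fun ω => k ω ^ q
  have hε2 : 0 < ε / 2 := by simp [hε.ne']
  let b : ℝ≥0∞ := min 1 (ε / 2 / (A + 1))
  have hb1 : b ≤ 1 := min_le_left _ _
  have hb0 : b ≠ 0 := by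
    refine (lt_min one_pos (ENNReal.div_pos hε2.ne' ?_)).ne'
    exact ENNReal.add_ne_top.2 ⟨hk, ENNReal.one_ne_top⟩
  have hbt : b ≠ ⊤ := ne_top_of_le_ne_top ENNReal.one_ne_top hb1
  have hbq : b ^ q * A ≤ ε / 2 := by
    have h1 : b ^ q ≤ b := ENNReal.rpow_le_self_of_le_one hb1 hpq.symm.lt.le
    calc b ^ q * A ≤ ε / 2 / (A + 1) * A := mul_le_mul_left (h1.trans (min_le_right _ _)) _
      _ = ε / 2 * A / (A + 1) := by
        rw [div_eq_mul_inv _ (A + 1), div_eq_mul_inv _ (A + 1), mul_right_comm]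
      _ ≤ ε / 2 := ENNReal.div_le_of_le_mul (mul_le_mul_right le_self_add _)
  have hc0 : (b⁻¹) ^ p ≠ 0 := by
    simp [ENNReal.rpow_eq_zero_iff, hbt, hb0]
  have hct : (b⁻¹) ^ p ≠ ⊤ := ENNReal.rpow_ne_top_of_nonneg hpq.pos.le (by simpa using hb0)
  have hbqt : b ^ q ≠ ⊤ := ENNReal.rpow_ne_top_of_nonneg hpq.symm.pos.le hbt
  have hdiv : ∀ {r : ℝ} (x : ℝ≥0∞), 1 ≤ r → x / ENNReal.ofReal r ≤ x := fun x hr =>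
    ENNReal.div_le_of_le_mul (le_mul_of_one_le_right' (by simpa using hr))
  refine ⟨ε / 2 / (b⁻¹) ^ p, ENNReal.div_pos hε2.ne' hct, fun e he => ?_⟩
  calc gExpNonneg T σl σu (fun ω => e ω * k ω)
      ≤ gExpNonneg T σl σu (fun ω => (b⁻¹) ^ p * e ω ^ p + b ^ q * k ω ^ q) := by
        refine gExpNonneg_mono_qs (.of_forall fun ω => ?_)
        have h1 := ENNReal.young_inequality (b⁻¹ * e ω) (b * k ω) hpq
        have h2 : b⁻¹ * e ω * (b * k ω) = e ω * k ω := by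
          rw [mul_mul_mul_comm, ENNReal.inv_mul_cancel hb0 hbt, one_mul]
        rw [h2] at h1
        refine h1.trans (add_le_add ((hdiv _ hpq.lt.le).trans ?_)
          ((hdiv _ hpq.symm.lt.le).trans ?_))
        · rw [ENNReal.mul_rpow_of_nonneg _ _ hpq.pos.le]
        · rw [ENNReal.mul_rpow_of_nonneg _ _ hpq.symm.pos.le]
    _ ≤ (b⁻¹) ^ p * gExpNonneg T σl σu (fun ω => e ω ^ p) + b ^ q * A :=
        (gExpNonneg_add_le _ _).trans (add_le_add (gExpNonneg_const_mul_le hct _)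
          (gExpNonneg_const_mul_le hbqt _))
    _ ≤ (b⁻¹) ^ p * (ε / 2 / (b⁻¹) ^ p) + ε / 2 :=
        add_le_add (mul_le_mul_right he _) hbq
    _ ≤ ε / 2 + ε / 2 := add_le_add ENNReal.mul_div_le le_rfl
    _ = ε := ENNReal.add_halves ε

theorem gExpNonneg_add_rpow_ne_top {q : ℝ} (hq : 1 ≤ q) {f g : PathSpace T → ℝ≥0∞}
    (hf : gExpNonneg T σl σu (fun ω => f ω ^ q) ≠ ⊤)
    (hg : gExpNonneg T σl σu (fun ω => g ω ^ q) ≠ ⊤) :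
    gExpNonneg T σl σu (fun ω => (f ω + g ω) ^ q) ≠ ⊤ := by
  have h2 : (2 : ℝ≥0∞) ^ (q - 1) ≠ ⊤ :=
    ENNReal.rpow_ne_top_of_nonneg (sub_nonneg.2 hq) (by simp)
  refine ne_top_of_le_ne_top ?_ ((gExpNonneg_mono_qs (.of_forall fun ω =>
    ENNReal.rpow_add_le_mul_rpow_add_rpow (f ω) (g ω) hq)).trans
      ((gExpNonneg_const_mul_le h2 _).trans (mul_le_mul_right (gExpNonneg_add_le _ _) _)))
  exact ENNReal.mul_ne_top h2 (ENNReal.add_ne_top.2 ⟨hf, hg⟩)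

/-- A member is within finite distance of a bounded variable, and (x + y)^q ≤ 2^(q-1) (x^q + y^q).
-/
theorem gExpNonneg_rpow_ne_top_of_mem_LG {q : ℝ} (hq : 1 ≤ q) {ξ : PathSpace T → ℝ}
    (h : ξ ∈ LG T σl σu q) :
    gExpNonneg T σl σu (fun ω => ENNReal.ofReal |ξ ω| ^ q) ≠ ⊤ := by
  have hq0 : 0 ≤ q := zero_le_one.trans hq
  obtain ⟨ξ', hL, hlim⟩ := h
  obtain ⟨n, hn⟩ := (hlim.eventually (gt_mem_nhds one_pos)).exists
  obtain ⟨C, hC⟩ := (Lip.bddMeasurable (hL n)).2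
  have h1 : gExpNonneg T σl σu (fun ω => ENNReal.ofReal |ξ' n ω - ξ ω| ^ q) ≠ ⊤ := by
    simp only [ENNReal.ofReal_rpow_of_nonneg (abs_nonneg _) hq0]
    exact hn.ne_top
  have h2 : gExpNonneg T σl σu (fun _ => ENNReal.ofReal C ^ q) ≠ ⊤ :=
    ne_top_of_le_ne_top (ENNReal.rpow_ne_top_of_nonneg hq0 ENNReal.ofReal_ne_top)
      (gExpNonneg_const_le _)
  refine ne_top_of_le_ne_top (gExpNonneg_add_rpow_ne_top hq h1 h2)
    (gExpNonneg_mono_qs (.of_forall fun ω => ENNReal.rpow_le_rpow ?_ hq0))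
  have hC0 : 0 ≤ C := (abs_nonneg _).trans (hC ω)
  rw [← ENNReal.ofReal_add (abs_nonneg _) hC0]
  refine ENNReal.ofReal_le_ofReal ?_
  have := abs_sub_abs_le_abs_sub (ξ ω) (ξ' n ω)
  rw [abs_sub_comm] at this
  linarith [hC ω]

/-! ### Oscillation and regularity of the integrands -/

/-- `g` is bounded by `C` and, on each path, its oscillation over time intervals of length `d` is
at most `L (d + b)`, where `b` bounds the oscillation of the path over such intervals. -/
def HasPathModulus (C L : ℝ) (g : Time T → PathSpace T → ℝ) : Prop :=
  (∀ t ω, |g t ω| ≤ C) ∧ ∀ ω (d b : ℝ), 0 ≤ d → 0 ≤ b →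
    (∀ x y : Time T, |(x : ℝ) - y| ≤ d → |B x ω - B y ω| ≤ b) →
    ∀ x y : Time T, |(x : ℝ) - y| ≤ d → |g x ω - g y ω| ≤ L * (d + b)

-- A bounded oscillation that is small outside an event of small capacity stays small in mean after
-- multiplication by k, since k is bounded up to a remainder of small expectation. The choice of δ
-- and w depends on g only through C and L.
open Classical in
theorem exists_osc_mul_le (hT : 0 < T) {k : PathSpace T → ℝ≥0∞}
    (hk : ∀ ε : ℝ≥0∞, 0 < ε → ∃ (C : ℝ) (r : PathSpace T → ℝ≥0∞),
      (∀ ω, k ω ≤ ENNReal.ofReal C + r ω) ∧ gExpNonneg T σl σu r ≤ ε)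
    {C L : ℝ} (hC : 0 ≤ C) (hL : 0 ≤ L) {ε : ℝ} (hε : 0 < ε) :
    ∃ δ > 0, ∃ w : PathSpace T → ℝ, (∀ ω, 0 ≤ w ω) ∧
      gExpNonneg T σl σu (fun ω => ENNReal.ofReal (w ω) * k ω) ≤ ENNReal.ofReal ε ∧
      ∀ g : Time T → PathSpace T → ℝ, HasPathModulus C L g →
        ∀ ω, ∀ x y : Time T, |(x : ℝ) - y| ≤ 2 * δ → |g x ω - g y ω| ≤ w ω := by
  obtain ⟨C', r, hkr, hr⟩ := hk (ENNReal.ofReal (ε / 2 / (2 * C + 1))) (by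
    rw [ENNReal.ofReal_pos]; positivity)
  let D := max C' 0
  have hD : 0 ≤ D := le_max_right _ _
  obtain ⟨b, hb, hb1, hb2⟩ : ∃ b > 0, L * (b + b) ≤ 1 ∧ D * (2 * C * b + L * (b + b)) ≤ ε / 2 := by
    refine ⟨min (1 / (2 * L + 1)) (ε / 2 / (D * (2 * C + 2 * L) + 1)), by positivity, ?_, ?_⟩
    · have h1 := min_le_left (1 / (2 * L + 1)) (ε / 2 / (D * (2 * C + 2 * L) + 1))
      rw [le_div_iff₀ (by positivity)] at h1
      have h2 : 0 < min (1 / (2 * L + 1)) (ε / 2 / (D * (2 * C + 2 * L) + 1)) := by positivity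
      nlinarith
    · have h1 := min_le_right (1 / (2 * L + 1)) (ε / 2 / (D * (2 * C + 2 * L) + 1))
      rw [le_div_iff₀ (by positivity)] at h1
      have h2 : 0 < min (1 / (2 * L + 1)) (ε / 2 / (D * (2 * C + 2 * L) + 1)) := by positivity
      nlinarith
  obtain ⟨δ₀, hδ₀, hosc⟩ := exists_measure_oscSet_le (σl := σl) (σu := σu) hT hb
  have hm : 0 < min δ₀ b := lt_min hδ₀ hb
  -- On paths with large oscillation only the bound 2C is available. On the others, times within min
  -- δ₀ b move the path by at most b, so the modulus gives L (b + b).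
  let w : PathSpace T → ℝ := fun ω => (if ω ∈ oscSet T δ₀ b then 2 * C else 0) + L * (b + b)
  have hw0 : ∀ ω, 0 ≤ w ω := fun ω => by
    simp only [w]; split_ifs <;> positivity
  refine ⟨min δ₀ b / 2, by positivity, w, hw0, ?_, ?_⟩
  · have hw1 : ∀ ω, w ω ≤ 2 * C + 1 := fun ω => by
      simp only [w]; split_ifs <;> linarith
    have hNw : gExpNonneg T σl σu (fun ω => ENNReal.ofReal (w ω)) ≤
        ENNReal.ofReal (2 * C * b + L * (b + b)) := by
      have hmeas : Measurable fun ω => (oscSet T δ₀ b).indicator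
          (fun _ => ENNReal.ofReal (2 * C)) ω + ENNReal.ofReal (L * (b + b)) :=
        (measurable_const.indicator (measurableSet_oscSet δ₀ b)).add measurable_const
      refine (gExpNonneg_le_of_qs hmeas (.of_forall fun ω => ?_)).trans
        (iSup₂_le fun P hP => ?_)
      · simp only [w]
        split_ifs with h
        · rw [Set.indicator_of_mem h, ENNReal.ofReal_add (by positivity) (by positivity)]
        · rw [Set.indicator_of_notMem h, zero_add, zero_add]
      · have := hP.1
        rw [lintegral_add_right _ measurable_const,
          lintegral_indicator_const (measurableSet_oscSet δ₀ b), lintegral_const, measure_univ,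
          mul_one, ENNReal.ofReal_add (by positivity) (by positivity),
          ENNReal.ofReal_mul (p := 2 * C) (by positivity)]
        exact add_le_add (mul_le_mul_right (hosc P hP) _) le_rfl
    calc gExpNonneg T σl σu (fun ω => ENNReal.ofReal (w ω) * k ω)
        ≤ gExpNonneg T σl σu (fun ω => ENNReal.ofReal D * ENNReal.ofReal (w ω) +
            ENNReal.ofReal (2 * C + 1) * r ω) := by
          refine gExpNonneg_mono_qs (.of_forall fun ω => ?_)
          calc _ ≤ ENNReal.ofReal (w ω) * (ENNReal.ofReal D + r ω) := by
                gcongr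
                exact (hkr ω).trans
                  (add_le_add (ENNReal.ofReal_le_ofReal (le_max_left _ _)) le_rfl)
            _ ≤ _ := by
                rw [mul_add, mul_comm]
                gcongr
                exact hw1 ω
      _ ≤ ENNReal.ofReal D * ENNReal.ofReal (2 * C * b + L * (b + b)) +
            ENNReal.ofReal (2 * C + 1) * ENNReal.ofReal (ε / 2 / (2 * C + 1)) := by
          refine (gExpNonneg_add_le _ _).trans (add_le_add
            ((gExpNonneg_const_mul_le ENNReal.ofReal_ne_top _).trans ?_)
            ((gExpNonneg_const_mul_le ENNReal.ofReal_ne_top _).trans ?_))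
          · exact mul_le_mul_right hNw _
          · exact mul_le_mul_right hr _
      _ = ENNReal.ofReal (D * (2 * C * b + L * (b + b)) + ε / 2) := by
          rw [← ENNReal.ofReal_mul hD, ← ENNReal.ofReal_mul (by positivity),
            ← ENNReal.ofReal_add (by positivity) (by positivity),
            mul_div_cancel₀ _ (by positivity)]
      _ ≤ ENNReal.ofReal ε := ENNReal.ofReal_le_ofReal (by linarith)
  · intro g hg ω x y hxy
    rw [mul_div_cancel₀ _ two_ne_zero] at hxy
    by_cases h : ω ∈ oscSet T δ₀ b
    · have h1 := hg.1 x ω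
      have h2 := hg.1 y ω
      have h3 : 0 ≤ L * (b + b) := by positivity
      simp only [w, if_pos h]
      linarith [abs_sub (g x ω) (g y ω)]
    · simp only [w, if_neg h, zero_add]
      have h1 := hg.2 ω (min δ₀ b) b hm.le hb.le (fun u v huv => by
        by_contra hcon
        exact h ⟨u, v, huv.trans (min_le_left _ _), not_le.1 hcon⟩) x y hxy
      refine h1.trans (mul_le_mul_of_nonneg_left ?_ hL)
      linarith [min_le_right δ₀ b]

theorem SG0.exists_modulus {η : Time T → PathSpace T → ℝ} (hη : η ∈ SG0 T) :
    ∃ C L : ℝ, 0 ≤ C ∧ 0 ≤ L ∧ HasPathModulus C L η := by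
  obtain ⟨n, τ, h, ⟨C, hC⟩, ⟨L, hL⟩, hη⟩ := hη
  refine ⟨C, L, (abs_nonneg _).trans (hC 0), L.2, fun t ω => by rw [hη]; exact hC _, ?_⟩
  intro ω d b hd hb hmod x y hxy
  rw [hη, hη, ← Real.dist_eq]
  refine (hL.dist_le_mul _ _).trans (mul_le_mul_of_nonneg_left ?_ L.2)
  rw [Prod.dist_eq]
  refine max_le ?_ ?_
  · rw [Real.dist_eq]
    exact hxy.trans (le_add_of_nonneg_right hb)
  · refine le_trans ?_ (le_add_of_nonneg_left hd)
    rw [dist_pi_le_iff hb]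
    intro i
    rw [Real.dist_eq]
    refine hmod _ _ (le_trans ?_ hxy)
    have e : ∀ t : Time T, ((min (τ i) t : Time T) : ℝ) = min (t : ℝ) (τ i : ℝ) := fun t => by
      rw [min_comm]
      exact (Subtype.mono_coe (· ∈ Set.Icc (0 : ℝ) T)).map_min
    rw [e, e]
    exact (abs_min_sub_min_le_max _ _ _ _).trans (by simp)

theorem SG0.mem_Lip {η : Time T → PathSpace T → ℝ} (hη : η ∈ SG0 T) (t : Time T) :
    η t ∈ Lip T := by
  obtain ⟨n, τ, h, ⟨C, hC⟩, ⟨L, hL⟩, hη⟩ := hη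
  refine ⟨n, fun i => min (τ i) t, fun x => h ((t : ℝ), x), ⟨C, fun x => hC _⟩, ⟨L, ?_⟩, fun ω => hη t ω⟩
  refine LipschitzWith.of_dist_le_mul fun x y => ?_
  refine (hL.dist_le_mul _ _).trans (le_of_eq ?_)
  rw [Prod.dist_eq, dist_self, max_eq_right dist_nonneg]

theorem SG0.adaptedTo {η : Time T → PathSpace T → ℝ} (hη : η ∈ SG0 T) (t : Time T) :
    AdaptedTo t (η t) := by
  obtain ⟨n, τ, h, -, -, hη⟩ := hη
  intro s hs ω ω'
  rw [hη, hη]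
  simp only [B_concat_of_le ((min_le_right _ _).trans hs)]

theorem SG0.isIntegrandPair {η : Time T → PathSpace T → ℝ} (hη : η ∈ SG0 T) :
    IsIntegrandPair (fun t ω => max (η t ω) 0) (fun t ω => max (-η t ω) 0) where
  mem₁ t := Lip.max_zero (SG0.mem_Lip hη t)
  mem₂ t := Lip.max_zero (Lip.neg (SG0.mem_Lip hη t))
  adapted₁ t s hs ω ω' := by simp only [SG0.adaptedTo hη t s hs]
  adapted₂ t s hs ω ω' := by simp only [SG0.adaptedTo hη t s hs]
  nonneg₁ t ω := le_max_right _ _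
  nonneg₂ t ω := le_max_right _ _
  eq_zero_or t ω := by
    rcases le_total (η t ω) 0 with h | h
    · exact Or.inl (max_eq_right h)
    · exact Or.inr (max_eq_right (neg_nonpos.2 h))

theorem SG0.continuous {η : Time T → PathSpace T → ℝ} (hη : η ∈ SG0 T) (ω : PathSpace T) :
    Continuous fun t => η t ω := by
  obtain ⟨n, τ, h, -, ⟨L, hL⟩, hη⟩ := hη
  simp only [hη]
  refine hL.continuous.comp (continuous_subtype_val.prodMk (continuous_pi fun i => ?_))
  exact ω.1.continuous.comp (continuous_const.min continuous_id)

/-- Off a polar set, X is uniformly approximated on the path by continuous processes. -/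
theorem SG.quasiSurely_continuous {p : ℝ} (hp : 0 < p) {X : Time T → PathSpace T → ℝ}
    (hX : X ∈ SG T σl σu p) : QuasiSurely T σl σu fun ω => Continuous fun t => X t ω := by
  obtain ⟨η, hη, hlim⟩ := hX
  refine (quasiSurely_exists_lt hlim).mono fun ω hω => ?_
  refine continuous_of_uniform_approx_of_continuous fun u hu => ?_
  obtain ⟨ε, hε, hεu⟩ := Metric.mem_uniformity_dist.1 hu
  obtain ⟨m, hm⟩ := hω (ENNReal.ofReal (ε ^ p)) (ENNReal.ofReal_pos.2 (Real.rpow_pos_of_pos hε p))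
  refine ⟨fun t => η m t ω, SG0.continuous (hη m) ω, fun t => hεu ?_⟩
  have h1 := (le_iSup (fun t : Time T => ENNReal.ofReal (|η m t ω - X t ω| ^ p)) t).trans_lt hm
  rw [ENNReal.ofReal_lt_ofReal_iff (Real.rpow_pos_of_pos hε p)] at h1
  rw [Real.dist_eq, abs_sub_comm]
  exact (Real.rpow_lt_rpow_iff (abs_nonneg _) hε.le hp).1 h1

/-! ### Convergence of the Riemann sums to the integral process -/

/-- The error of a Riemann sum of an approximate integrand. -/
theorem IsPrimitive.abs_grid_sum_approx_le (hT : 0 ≤ T) {f y g F : Time T → ℝ}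
    (hF : IsPrimitive f g F) (hg : Antitone g) (hg0 : g ⟨0, le_rfl, hT⟩ = 0) {δ e w : ℝ}
    (hδ : 0 < δ) (hy : ∀ t, |y t - f t| ≤ e)
    (hosc : ∀ a b : Time T, |(a : ℝ) - b| ≤ 2 * δ → |y a - y b| ≤ w) {u v : Time T}
    (huv : u ≤ v) {n : ℕ} (hn : 0 < n) (hnδ : ((v : ℝ) - u) / n ≤ δ) :
    |(∑ k ∈ Finset.range n, y (grid u v huv n k) *
      (g (grid u v huv n (k + 1)) - g (grid u v huv n k))) - (F v - F u)| ≤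
      (3 * e + w) * |g ⟨T, hT, le_rfl⟩| := by
  have he : 0 ≤ e := (abs_nonneg _).trans (hy u)
  have hw : 0 ≤ w := (abs_nonneg _).trans (hosc u u (by simp [hδ.le]))
  -- Passing from y to f adds e at each endpoint of the oscillation. Replacing y by f in the sum
  -- costs one more e, hence 3e + w.
  have hosc' : ∀ a b : Time T, |(a : ℝ) - b| ≤ 2 * δ → |f a - f b| ≤ 2 * e + w := by
    intro a b hab
    have h1 := hosc a b hab
    have h2 := hy a
    have h3 := hy b
    rw [abs_le] at *
    constructor <;> linarith [h1.1, h1.2, h2.1, h2.2, h3.1, h3.2]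
  have h1 := hF.abs_grid_sum_sub_le hδ hosc' huv hn hnδ
  have h2 : |(∑ k ∈ Finset.range n, y (grid u v huv n k) *
      (g (grid u v huv n (k + 1)) - g (grid u v huv n k))) -
      ∑ k ∈ Finset.range n, f (grid u v huv n k) *
      (g (grid u v huv n (k + 1)) - g (grid u v huv n k))| ≤ e * (g u - g v) := by
    rw [← Finset.sum_sub_distrib]
    calc _ ≤ ∑ k ∈ Finset.range n, e * -(g (grid u v huv n (k + 1)) - g (grid u v huv n k)) := by
          refine (Finset.abs_sum_le_sum_abs _ _).trans (Finset.sum_le_sum fun k _ => ?_)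
          have hneg : g (grid u v huv n (k + 1)) - g (grid u v huv n k) ≤ 0 :=
            sub_nonpos.2 (hg (grid_mono huv n (Nat.le_succ k)))
          rw [← sub_mul, abs_mul, abs_of_nonpos hneg]
          exact mul_le_mul_of_nonneg_right (hy _) (neg_nonneg.2 hneg)
      _ = e * (g u - g v) := by
          rw [← Finset.mul_sum, Finset.sum_neg_distrib,
            Finset.sum_range_sub (fun k => g (grid u v huv n k)), grid_last huv hn, grid_zero,
            neg_sub]
  have h3 : g u - g v ≤ |g ⟨T, hT, le_rfl⟩| := by
    have e1 : g u ≤ g ⟨0, le_rfl, hT⟩ := hg (Subtype.coe_le_coe.1 u.2.1)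
    have e2 : g ⟨T, hT, le_rfl⟩ ≤ g v := hg (Subtype.coe_le_coe.1 v.2.2)
    linarith [neg_le_abs (g ⟨T, hT, le_rfl⟩)]
  calc _ ≤ e * (g u - g v) + (2 * e + w) * (g u - g v) :=
        (abs_sub_le _ _ _).trans (add_le_add h2 h1)
    _ = (3 * e + w) * (g u - g v) := by ring
    _ ≤ _ := mul_le_mul_of_nonneg_left h3 (by positivity)

/-- A path along which `X` is continuous and `K₁`, `K₂` decrease from `0`. -/
structure IsRegularPath (hT : 0 ≤ T) (X K₁ K₂ : Time T → PathSpace T → ℝ) (ω : PathSpace T) :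
    Prop where
  continuous : Continuous fun t => X t ω
  antitone₁ : Antitone fun t => K₁ t ω
  antitone₂ : Antitone fun t => K₂ t ω
  zero₁ : K₁ ⟨0, le_rfl, hT⟩ ω = 0
  zero₂ : K₂ ⟨0, le_rfl, hT⟩ ω = 0

/-- The process `∫_0^t X_s⁺ dK₁_s + ∫_0^t X_s⁻ dK₂_s`. -/
noncomputable def integralProcess (hT : 0 ≤ T) (X K₁ K₂ : Time T → PathSpace T → ℝ) (t : Time T)
    (ω : PathSpace T) : ℝ :=
  stieltjesIntegral (fun s => max (X s ω) 0) (fun s => K₁ s ω) ⟨0, le_rfl, hT⟩ t +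
    stieltjesIntegral (fun s => max (-X s ω) 0) (fun s => K₂ s ω) ⟨0, le_rfl, hT⟩ t

theorem IsRegularPath.abs_riemannSum_sub_le {hT : 0 ≤ T} {X K₁ K₂ : Time T → PathSpace T → ℝ}
    {ω : PathSpace T} (h : IsRegularPath hT X K₁ K₂ ω) {η : Time T → PathSpace T → ℝ} {δ e w : ℝ}
    (hδ : 0 < δ) (hη : ∀ t, |η t ω - X t ω| ≤ e)
    (hosc : ∀ a b : Time T, |(a : ℝ) - b| ≤ 2 * δ → |η a ω - η b ω| ≤ w) {u v : Time T}
    (huv : u ≤ v) {n : ℕ} (hn : 0 < n) (hnδ : ((v : ℝ) - u) / n ≤ δ) :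
    |riemannSum (fun t ω => max (η t ω) 0) (fun t ω => max (-η t ω) 0) K₁ K₂ (grid u v huv n) n ω -
      (integralProcess hT X K₁ K₂ v ω - integralProcess hT X K₁ K₂ u ω)| ≤
      (3 * e + w) * (|K₁ ⟨T, hT, le_rfl⟩ ω| + |K₂ ⟨T, hT, le_rfl⟩ ω|) := by
  have hX₁ : Continuous fun s => max (X s ω) 0 := h.continuous.max continuous_const
  have hX₂ : Continuous fun s => max (-X s ω) 0 := h.continuous.neg.max continuous_const
  have h1 := (isPrimitive_stieltjesIntegral hT hX₁ h.antitone₁).abs_grid_sum_approx_le hT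
    (y := fun t => max (η t ω) 0) h.antitone₁ h.zero₁ hδ
    (fun t => (abs_max_sub_max_le_abs _ _ 0).trans (hη t))
    (fun a b hab => (abs_max_sub_max_le_abs _ _ 0).trans (hosc a b hab)) huv hn hnδ
  have h2 := (isPrimitive_stieltjesIntegral hT hX₂ h.antitone₂).abs_grid_sum_approx_le hT
    (y := fun t => max (-η t ω) 0) h.antitone₂ h.zero₂ hδ
    (fun t => (abs_max_sub_max_le_abs _ _ 0).trans (by
      rw [neg_sub_neg, abs_sub_comm]; exact hη t))
    (fun a b hab => (abs_max_sub_max_le_abs _ _ 0).trans (by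
      rw [neg_sub_neg, abs_sub_comm]; exact hosc a b hab)) huv hn hnδ
  rw [mul_add]
  refine le_trans (le_of_eq ?_) ((abs_add_le _ _).trans (add_le_add h1 h2))
  rw [riemannSum, Finset.sum_add_distrib, integralProcess, integralProcess]
  congr 1
  ring

/-- First η is chosen to make the uniform error small against K_T by Young's inequality; the mesh δ
is then adapted to the modulus of that η. The bound is uniform over intervals, so one η serves both
[0, s] and [s, t]. -/
theorem exists_approx_integralProcess (hT : 0 < T) {p q : ℝ} (hpq : p.HolderConjugate q)
    {X K₁ K₂ : Time T → PathSpace T → ℝ} (hX : X ∈ SG T σl σu p)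
    (hK₁ : K₁ ⟨T, hT.le, le_rfl⟩ ∈ LG T σl σu 1) (hK₂ : K₂ ⟨T, hT.le, le_rfl⟩ ∈ LG T σl σu 1)
    (hK₁T : K₁ ⟨T, hT.le, le_rfl⟩ ∈ LG T σl σu q) (hK₂T : K₂ ⟨T, hT.le, le_rfl⟩ ∈ LG T σl σu q)
    (hreg : QuasiSurely T σl σu (IsRegularPath hT.le X K₁ K₂)) {ε : ℝ≥0∞} (hε : 0 < ε) :
    ∃ η ∈ SG0 T, ∃ δ > 0, ∀ (u v : Time T) (huv : u ≤ v) (n : ℕ), 0 < n →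
      ((v : ℝ) - u) / n ≤ δ → gNorm T σl σu (fun ω =>
        riemannSum (fun t ω => max (η t ω) 0) (fun t ω => max (-η t ω) 0) K₁ K₂
          (grid u v huv n) n ω -
        (integralProcess hT.le X K₁ K₂ v ω - integralProcess hT.le X K₁ K₂ u ω)) ≤ ε := by
  set e₀ : Time T := ⟨T, hT.le, le_rfl⟩
  let k : PathSpace T → ℝ≥0∞ := fun ω => ENNReal.ofReal |K₁ e₀ ω| + ENNReal.ofReal |K₂ e₀ ω|
  have hq1 : 1 ≤ q := hpq.symm.lt.le
  have hkq : gExpNonneg T σl σu (fun ω => k ω ^ q) ≠ ⊤ := gExpNonneg_add_rpow_ne_top hq1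
    (gExpNonneg_rpow_ne_top_of_mem_LG hq1 hK₁T) (gExpNonneg_rpow_ne_top_of_mem_LG hq1 hK₂T)
  have hk1 : ∀ {ξ : PathSpace T → ℝ}, ξ ∈ LG T σl σu 1 → ∀ ε : ℝ≥0∞, 0 < ε → ∃ C : ℝ, 0 ≤ C ∧
      ∃ r : PathSpace T → ℝ≥0∞, (∀ ω, ENNReal.ofReal |ξ ω| ≤ ENNReal.ofReal C + r ω) ∧
        gExpNonneg T σl σu r ≤ ε := by
    intro ξ hξ ε hε
    obtain ⟨ξ', hL, hlim⟩ := hξ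
    rw [tendstoLG_one_iff] at hlim
    obtain ⟨n, hn⟩ := (hlim.eventually (gt_mem_nhds hε)).exists
    obtain ⟨C, hC⟩ := (Lip.bddMeasurable (hL n)).2
    refine ⟨max C 0, le_max_right _ _, _, fun ω => ?_, hn.le⟩
    rw [← ENNReal.ofReal_add (le_max_right _ _) (abs_nonneg _)]
    refine ENNReal.ofReal_le_ofReal ?_
    have := abs_sub_abs_le_abs_sub (ξ ω) (ξ' n ω)
    rw [abs_sub_comm] at this
    linarith [hC ω, le_max_left C 0]
  have hk : ∀ ε : ℝ≥0∞, 0 < ε → ∃ (C : ℝ) (r : PathSpace T → ℝ≥0∞),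
      (∀ ω, k ω ≤ ENNReal.ofReal C + r ω) ∧ gExpNonneg T σl σu r ≤ ε := by
    intro ε hε
    have hε2 : 0 < ε / 2 := by simp [hε.ne']
    obtain ⟨C, hC, r, hr, hrn⟩ := hk1 hK₁ _ hε2
    obtain ⟨C', hC', r', hr', hrn'⟩ := hk1 hK₂ _ hε2
    refine ⟨C + C', fun ω => r ω + r' ω, fun ω => ?_, ?_⟩
    · rw [ENNReal.ofReal_add hC hC', add_add_add_comm]
      exact add_le_add (hr ω) (hr' ω)
    · rw [← ENNReal.add_halves ε]
      exact (gExpNonneg_add_le _ _).trans (add_le_add hrn hrn')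
  obtain ⟨ε₁, -, hε₁, hε₁'⟩ := ENNReal.lt_iff_exists_real_btwn.1
    (show 0 < ε / 2 by simp [hε.ne'])
  rw [ENNReal.ofReal_pos] at hε₁
  have hε3 : 0 < ε / 2 / 3 := ENNReal.div_pos (by simp [hε.ne']) (by simp)
  obtain ⟨δ', hδ', hmul⟩ := exists_gExpNonneg_mul_le hpq hkq hε3
  obtain ⟨η, hη, hlim⟩ := hX
  obtain ⟨m, hm⟩ := (hlim.eventually (gt_mem_nhds hδ')).exists
  obtain ⟨C, L, hC, hL, hmod⟩ := SG0.exists_modulus (hη m)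
  obtain ⟨δ, hδ, w, hw0, hw, hwosc⟩ := exists_osc_mul_le hT hk hC hL hε₁
  let D : PathSpace T → ℝ≥0∞ := fun ω => ⨆ t : Time T, ENNReal.ofReal (|η m t ω - X t ω| ^ p)
  -- This is the supremum over time of |η - X|. The outer expectation makes its measurability
  -- irrelevant.
  let e : PathSpace T → ℝ≥0∞ := fun ω => D ω ^ p⁻¹
  have hep : gExpNonneg T σl σu (fun ω => e ω ^ p) ≤ δ' := by
    simp only [e, ENNReal.rpow_inv_rpow hpq.ne_zero]
    exact hm.le
  refine ⟨η m, hη m, δ, hδ, fun u v huv n hn hnδ => ?_⟩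
  have hbound : gNorm T σl σu (fun ω =>
        riemannSum (fun t ω => max (η m t ω) 0) (fun t ω => max (-η m t ω) 0) K₁ K₂
          (grid u v huv n) n ω -
        (integralProcess hT.le X K₁ K₂ v ω - integralProcess hT.le X K₁ K₂ u ω)) ≤
      gExpNonneg T σl σu (fun ω => 3 * (e ω * k ω) + ENNReal.ofReal (w ω) * k ω) := by
    refine gExpNonneg_mono_qs (hreg.mono fun ω hω => ?_)
    -- Continuity on the compact time interval makes e finite on a regular path, so passing to real
    -- numbers loses nothing.
    obtain ⟨A, hA⟩ := isCompact_univ.exists_bound_of_continuousOn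
      ((SG0.continuous (hη m) ω).sub hω.continuous).continuousOn
    have hA' : ∀ t, |η m t ω - X t ω| ≤ A := fun t => hA t (Set.mem_univ t)
    have hDtop : D ω ≠ ⊤ := by
      refine ne_top_of_le_ne_top (ENNReal.ofReal_ne_top (r := A ^ p)) (iSup_le fun t => ?_)
      exact ENNReal.ofReal_le_ofReal (Real.rpow_le_rpow (abs_nonneg _) (hA' t) hpq.pos.le)
    have hetop : e ω ≠ ⊤ :=
      ENNReal.rpow_ne_top_of_nonneg (inv_nonneg.2 hpq.pos.le) hDtop
    have hle : ∀ t, |η m t ω - X t ω| ≤ (e ω).toReal := by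
      intro t
      rw [← ENNReal.ofReal_le_iff_le_toReal hetop]
      have h1 : ENNReal.ofReal (|η m t ω - X t ω| ^ p) ≤ D ω :=
        le_iSup (fun t : Time T => ENNReal.ofReal (|η m t ω - X t ω| ^ p)) t
      have h2 := ENNReal.rpow_le_rpow h1 (inv_nonneg.2 hpq.pos.le)
      rwa [← ENNReal.ofReal_rpow_of_nonneg (abs_nonneg _) hpq.pos.le,
        ENNReal.rpow_rpow_inv hpq.ne_zero] at h2
    have h3 := hω.abs_riemannSum_sub_le hδ hle (hwosc (η m) hmod ω) huv hn hnδ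
    refine (ENNReal.ofReal_le_ofReal h3).trans (le_of_eq ?_)
    have he0 : 0 ≤ (e ω).toReal := ENNReal.toReal_nonneg
    rw [ENNReal.ofReal_mul (by have := hw0 ω; positivity),
      ENNReal.ofReal_add (by positivity) (hw0 ω), ENNReal.ofReal_mul (by norm_num),
      ENNReal.ofReal_toReal hetop, ENNReal.ofReal_add (abs_nonneg _) (abs_nonneg _), add_mul,
      mul_assoc]
    simp [k, e₀]
  calc _ ≤ _ := hbound
    _ ≤ 3 * gExpNonneg T σl σu (fun ω => e ω * k ω) +
        gExpNonneg T σl σu (fun ω => ENNReal.ofReal (w ω) * k ω) :=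
      (gExpNonneg_add_le _ _).trans (add_le_add (gExpNonneg_const_mul_le (by simp) _) le_rfl)
    _ ≤ 3 * (ε / 2 / 3) + ε / 2 :=
      add_le_add (mul_le_mul_right (hmul e hep) _) (hw.trans hε₁'.le)
    _ ≤ ε / 2 + ε / 2 := add_le_add ENNReal.mul_div_le le_rfl
    _ = ε := ENNReal.add_halves ε

/-! ### The martingale property and the conclusion -/

theorem isCondGExp_of_isEmpty (hemp : martingaleLaws T σl σu = ∅) (t : Time T)
    (ξ ζ : PathSpace T → ℝ) : IsCondGExp T σl σu t ξ ζ := by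
  have h0 : ∀ f : PathSpace T → ℝ≥0∞, gExpNonneg T σl σu f ≤ 0 := fun f => by
    refine (gExpNonneg_le_of_qs (g := fun _ => ⊤) measurable_const
      (.of_forall fun _ => le_top)).trans ?_
    simp [hemp]
  exact isCondGExp_of_forall fun ε _ => ⟨fun _ => 0, Lip.const 0, (h0 _).trans bot_le,
    (h0 _).trans bot_le⟩

theorem IsCondGExp.mem_LG {t : Time T} {ξ ζ : PathSpace T → ℝ} (h : IsCondGExp T σl σu t ξ ζ) :
    ξ ∈ LG T σl σu 1 := by
  obtain ⟨ξ', hL, h1, -⟩ := h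
  exact ⟨ξ', hL, h1⟩

theorem isCondGExp_integralProcess (hT : 0 < T) {p q : ℝ} (hpq : p.HolderConjugate q)
    {X K₁ K₂ : Time T → PathSpace T → ℝ} (hX : X ∈ SG T σl σu p)
    (hK₁ : IsDecreasingGMartingale T σl σu K₁) (hK₂ : IsDecreasingGMartingale T σl σu K₂)
    (hK₁T : K₁ ⟨T, hT.le, le_rfl⟩ ∈ LG T σl σu q) (hK₂T : K₂ ⟨T, hT.le, le_rfl⟩ ∈ LG T σl σu q)
    (hreg : QuasiSurely T σl σu (IsRegularPath hT.le X K₁ K₂)) {s t : Time T} (hst : s ≤ t) :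
    IsCondGExp T σl σu s (integralProcess hT.le X K₁ K₂ t) (integralProcess hT.le X K₁ K₂ s) := by
  rcases Set.eq_empty_or_nonempty (martingaleLaws T σl σu) with hemp | hne
  · exact isCondGExp_of_isEmpty hemp s _ _
  refine isCondGExp_of_riemannSum hne hK₁ hK₂ fun ε hε => ?_
  obtain ⟨η, hη, δ, hδ, happ⟩ := exists_approx_integralProcess hT hpq hX (hK₁.1.1 _) (hK₂.1.1 _)
    hK₁T hK₂T hreg hε
  obtain ⟨N, hN⟩ := exists_nat_gt (T / δ)
  have hN0 : (0 : ℝ) < N := lt_of_le_of_lt (by positivity) hN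
  have hNpos : 0 < N := by exact_mod_cast hN0
  have hstep : ∀ u v : Time T, ((v : ℝ) - u) / N ≤ δ := fun u v => by
    rw [div_le_comm₀ hN0 hδ]
    refine le_trans ?_ hN.le
    gcongr
    linarith [v.2.2, u.2.1]
  have hzs : (⟨0, le_rfl, hT.le⟩ : Time T) ≤ s := s.2.1
  -- One grid over [0, s] represents M_s, using M_0 = 0, and one over [s, t] represents M_t - M_s;
  -- both use the same integrands.
  refine ⟨_, _, N, N, grid _ s hzs N, grid s t hst N, SG0.isIntegrandPair hη, grid_mono hzs N,
    grid_mono hst N, grid_last hzs hNpos, grid_zero hst N, ?_,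
    happ s t hst N hNpos (hstep s t)⟩
  have h1 := happ _ s hzs N hNpos (hstep _ s)
  have h0 : ∀ ω, integralProcess hT.le X K₁ K₂ ⟨0, le_rfl, hT.le⟩ ω = 0 := fun ω => by
    rw [integralProcess, stieltjesIntegral_self, stieltjesIntegral_self, add_zero]
  simpa only [h0, sub_zero] using h1

end GExpectation

theorem lemma3p4 (T σl σu : ℝ) (hT : 0 < T) (hσl : 0 < σl) (hσ : σl ≤ σu)
    (α : ℝ) (hα : 1 < α)
    (X : GExpectation.Time T → GExpectation.PathSpace T → ℝ)
    (hX : X ∈ GExpectation.SG T σl σu α)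
    (K₁ K₂ : GExpectation.Time T → GExpectation.PathSpace T → ℝ)
    (hK₁ : GExpectation.IsDecreasingGMartingale T σl σu K₁)
    (hK₂ : GExpectation.IsDecreasingGMartingale T σl σu K₂)
    (hK₁0 : GExpectation.QuasiSurely T σl σu (fun ω => K₁ ⟨0, le_rfl, hT.le⟩ ω = 0))
    (hK₂0 : GExpectation.QuasiSurely T σl σu (fun ω => K₂ ⟨0, le_rfl, hT.le⟩ ω = 0))
    (hK₁T : K₁ ⟨T, hT.le, le_rfl⟩ ∈ GExpectation.LG T σl σu (α / (α - 1)))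
    (hK₂T : K₂ ⟨T, hT.le, le_rfl⟩ ∈ GExpectation.LG T σl σu (α / (α - 1))) :
    -- quasi-surely both pathwise integrals exist for all `t ∈ [0, T]`
    GExpectation.QuasiSurely T σl σu (fun ω => ∀ t : GExpectation.Time T,
      (∃ I, GExpectation.HasStieltjesIntegral
        (fun s => max (X s ω) 0) (fun s => K₁ s ω) ⟨0, le_rfl, hT.le⟩ t I) ∧
      (∃ I, GExpectation.HasStieltjesIntegral
        (fun s => max (-X s ω) 0) (fun s => K₂ s ω) ⟨0, le_rfl, hT.le⟩ t I)) ∧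
    -- `∫_0^t X_s⁺ dK₁_s + ∫_0^t X_s⁻ dK₂_s` is a decreasing `G`-martingale
    GExpectation.IsDecreasingGMartingale T σl σu (fun t ω =>
      GExpectation.stieltjesIntegral
        (fun s => max (X s ω) 0) (fun s => K₁ s ω) ⟨0, le_rfl, hT.le⟩ t +
      GExpectation.stieltjesIntegral
        (fun s => max (-X s ω) 0) (fun s => K₂ s ω) ⟨0, le_rfl, hT.le⟩ t) := by
  have hreg : GExpectation.QuasiSurely T σl σu (GExpectation.IsRegularPath hT.le X K₁ K₂) :=
    (((GExpectation.SG.quasiSurely_continuous (by linarith) hX).and (hK₁.2.and hK₂.2)).and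
      (hK₁0.and hK₂0)).mono fun ω h => ⟨h.1.1, h.1.2.1, h.1.2.2, h.2.1, h.2.2⟩
  have hcond := fun s t (hst : s ≤ t) => GExpectation.isCondGExp_integralProcess hT
    (Real.HolderConjugate.conjExponent hα) hX hK₁ hK₂ hK₁T hK₂T hreg hst
  -- Membership in L_G^1 is read off from the martingale identity with s = t.
  refine ⟨hreg.mono fun ω h t => ⟨?_, ?_⟩, ⟨fun t => (hcond t t le_rfl).mem_LG, hcond⟩,
    hreg.mono fun ω h => ?_⟩
  · exact GExpectation.exists_hasStieltjesIntegral hT.le (h.continuous.max continuous_const)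
      h.antitone₁ t
  · exact GExpectation.exists_hasStieltjesIntegral hT.le (h.continuous.neg.max continuous_const)
      h.antitone₂ t
  · have hX₁ : Continuous fun s => max (X s ω) 0 := h.continuous.max continuous_const
    have hX₂ : Continuous fun s => max (-X s ω) 0 := h.continuous.neg.max continuous_const
    exact ((GExpectation.isPrimitive_stieltjesIntegral hT.le hX₁ h.antitone₁).antitone hX₁
      (fun t => le_max_right _ _) h.antitone₁).add
      ((GExpectation.isPrimitive_stieltjesIntegral hT.le hX₂ h.antitone₂).antitone hX₂
      (fun t => le_max_right _ _) h.antitone₂)
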